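/- Let $k$ be an algebraically closed field. A finite semisimple category is a $k$-linear abelian category with finite-dimensional hom spaces and finitely many simple objects up to isomorphism, in which every object is a finite direct sum of simple objects. A fusion category is a finite semisimple monoidal category with bilinear tensor product in which every object has left and right duals and the unit is simple. Let $\mathsf{Fus1Cat}/\mathsf{fdVec}$ be the following 2-category. Objects are pairs $(C,F)$ of a fusion category $C$ and a faithful $k$-linear strong monoidal functor $F\colon C\to\mathsf{fdVec}$; 1-morphisms $(C_1,F_1)\to(C_2,F_2)$ are pairs $(T,\tau)$ of a $k$-linear monoidal functor $T\colon C_1\to C_2$ and a monoidal natural isomorphism $\tau\colon F_1\Rightarrow F_2T$; 2-morphisms $(T,\tau)\Rightarrow(T',\tau')$ are monoidal natural transformations $\sigma\colon T\Rightarrow T'$ with $\tau'=F_2(\sigma)\circ\tau$. Any two parallel 2-morphisms are equal and every 2-morphism is invertible, so we regard $\mathsf{Fus1Cat}/\mathsf{fdVec}$ as a category whose morphisms are the isomorphism classes of 1-morphisms. It has a monoidal structure with unit $(\mathsf{fdVec},\mathrm{id})$ given by the Deligne tensor product, $(C,F)\boxtimes(C',F')=(C\boxtimes C',\otimes\circ(F\boxtimes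 F'))$, where $\boxtimes\colon C\times C'\to C\boxtimes C'$ is a monoidal bilinear bifunctor, universal among bilinear bifunctors to finite semisimple categories, and where the tensor product of morphisms, the associator and the unitors are the ones induced by $\boxtimes$. Let $\mathsf{Hopf}^{ss}$ be the category of finite-dimensional semisimple Hopf algebras over $k$ and bialgebra homomorphisms, monoidal under $\otimes_k$. Theorem. (1) For every $A\in\mathsf{Hopf}^{ss}$ the category $\mathrm{Mod}(A)$ of finite-dimensional $A$-modules, with tensor product given by the comultiplication, is a fusion category and $\mathrm{Forget}_A\colon\mathrm{Mod}(A)\to\mathsf{fdVec}$ is a faithful monoidal functor. With restriction of modules along homomorphisms, $A\mapsto(\mathrm{Mod}(A),\mathrm{Forget}_A)$ is a contravariant functor $\mathsf{Hopf}^{ss}\to\mathsf{Fus1Cat}/\mathsf{fdVec}$. (2) For every $(C,F)$ the algebra $\mathrm{End}(F)$ of natural endomorphisms of $F$ is a finite-dimensional semisimple Hopf algebra with the following structure. If $\Delta(\eta)=\sum\eta_{(1)}\otimes\eta_{(2)}$, then $\eta_{c\otimes d}$ corresponds to $\sum(\eta_{(1)})_c\otimes(\eta_{(2)})_d$ under the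 tensorator $F(c)\otimes F(d)\cong F(c\otimes d)$; the counit of $\eta$ is the scalar by which $\eta$ acts on $F(1)\cong k$; and if $d$ is a dual of $c$ with evaluation $d\otimes c\to 1$, then $S(\eta)_c$ is the transpose of $\eta_d$ with respect to the induced pairing $F(d)\otimes F(c)\to F(1)$. With $(T,\tau)\mapsto\bigl(\eta\mapsto\tau^{-1}\circ\eta_T\circ\tau\bigr)$ this defines a contravariant functor $\mathsf{Fus1Cat}/\mathsf{fdVec}\to\mathsf{Hopf}^{ss}$, $(C,F)\mapsto\mathrm{End}(F)$. (3) These two functors are mutually inverse contravariant equivalences; more precisely they form an adjoint equivalence whose unit and counit are given by the natural isomorphism $A\cong\mathrm{End}(\mathrm{Forget}_A)$, which sends $a$ to the action of $a$, and the natural isomorphism $(C,F)\cong(\mathrm{Mod}(\mathrm{End}(F)),\mathrm{Forget})$, which sends $c$ to $F(c)$ with its evident $\mathrm{End}(F)$-action. (4) For every monoidal structure given by Deligne tensor products as above, both functors are monoidal and the adjoint equivalence is a monoidal equivalence; the monoidal structure $\mathrm{End}(F)\otimes\mathrm{End}(F')\cong\mathrm{End}(\otimes\circ(F\boxtimes F'))$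 sends $\eta\otimes\eta'$ to the transformation whose component at $c\boxtimes c'$ corresponds to $\eta_c\otimes\eta'_{c'}$. -/

import Mathlib

open CategoryTheory MonoidalCategory TensorProduct Opposite
open CategoryTheory.Functor.LaxMonoidal

universe u v w

noncomputable section

/-! ### Fusion categories with a fiber functor -/

/-- A `k`-linear category is finite semisimple if it is abelian, its hom spaces are
finite-dimensional, every object is a finite direct sum of simple objects, and there are only
finitely many simple objects up to isomorphism. -/
structure IsFiniteSemisimple (k : Type u) [Field k] (C : Type w) [Category.{v} C]
    [P : Preadditive C] [Linear k C] : Prop where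
  abelian : ∃ a : Abelian C, a.toPreadditive = P
  finite_hom : ∀ X Y : C, Module.Finite k (X ⟶ Y)
  sum_of_simples : ∀ X : C, ∃ (n : ℕ) (s : Fin n → C) (b : Limits.Bicone s),
    (∀ i, Simple (s i)) ∧ Nonempty b.IsBilimit ∧ Nonempty (b.pt ≅ X)
  finite_simples : ∃ (n : ℕ) (s : Fin n → C), ∀ X : C, Simple X → ∃ i, Nonempty (X ≅ s i)

/-- A fusion category: a finite semisimple `k`-linear category, with a bilinear tensor product,
in which every object has a left and a right dual and the unit object is simple. -/
structure IsFusion (k : Type u) [Field k] (C : Type w) [Category.{v} C]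
    [Preadditive C] [Linear k C] [MonoidalCategory C] : Prop where
  semisimple : IsFiniteSemisimple k C
  preadditive : MonoidalPreadditive C
  linear : MonoidalLinear k C
  hasLeftDual : ∀ X : C, Nonempty (HasLeftDual X)
  hasRightDual : ∀ X : C, Nonempty (HasRightDual X)
  simple_unit : Simple (𝟙_ C)

/-- A `k`-linear monoidal category `C` with a `k`-linear (strong) monoidal functor `F` to
finite-dimensional vector spaces. -/
structure FibCat (k : Type u) [Field k] where
  C : Type (u + 1)
  [cat : Category.{u} C]
  [preadditive : Preadditive C]
  [linear : Linear k C]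
  [monoidal : MonoidalCategory C]
  F : C ⥤ FGModuleCat.{u} k
  [additiveF : F.Additive]
  [linearF : F.Linear k]
  [monoidalF : F.Monoidal]

namespace FibCat

attribute [instance] cat preadditive linear monoidal additiveF linearF monoidalF

variable {k : Type u} [Field k]

/-- A `1`-morphism in the slice over vector spaces: a linear monoidal functor `T` with a monoidal
natural isomorphism from `F₁` to `F₂ ∘ T`. -/
structure Mor (X Y : FibCat k) where
  T : X.C ⥤ Y.C
  [additive : T.Additive]
  [linear : T.Linear k]
  [monoidal : T.Monoidal]
  τ : X.F ≅ T ⋙ Y.F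
  [isMonoidal : NatTrans.IsMonoidal τ.hom]

attribute [instance] Mor.additive Mor.linear Mor.monoidal Mor.isMonoidal

/-- A `2`-morphism in the slice: a monoidal natural transformation `σ : T ⟶ T'` such that
`τ' = F₂(σ) ∘ τ`. -/
structure TwoMor {X Y : FibCat k} (m m' : Mor X Y) where
  σ : m.T ⟶ m'.T
  [isMonoidal : NatTrans.IsMonoidal σ]
  comm : m.τ.hom ≫ Functor.whiskerRight σ Y.F = m'.τ.hom

attribute [instance] TwoMor.isMonoidal

/-- `1`-morphisms are identified when there is an invertible `2`-morphism between them. -/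
instance Mor.setoid (X Y : FibCat k) : Setoid (Mor X Y) where
  r m m' := ∃ s : TwoMor m m', IsIso s.σ
  iseqv :=
    { refl := fun m => ⟨{ σ := 𝟙 _, comm := by ext; simp }, by dsimp; infer_instance⟩
      symm := by
        rintro m m' ⟨s, hs⟩
        let e := asIso s.σ
        have : NatTrans.IsMonoidal e.hom := s.isMonoidal
        refine ⟨{ σ := e.inv, comm := ?_ }, by dsimp; infer_instance⟩
        rw [← s.comm, Category.assoc, ← Functor.whiskerRight_comp]
        change m.τ.hom ≫ Functor.whiskerRight (e.hom ≫ e.inv) _ = _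
        simp
      trans := by
        rintro m m' m'' ⟨s, hs⟩ ⟨t, ht⟩
        refine ⟨{ σ := s.σ ≫ t.σ, comm := ?_ }, by dsimp; infer_instance⟩
        rw [Functor.whiskerRight_comp, ← Category.assoc, s.comm, t.comm] }

/-- The identity `1`-morphism. -/
abbrev Mor.id (X : FibCat k) : Mor X X where
  T := 𝟭 X.C
  τ := X.F.leftUnitor.symm
  isMonoidal := inferInstanceAs (NatTrans.IsMonoidal X.F.leftUnitor.inv)

/-- Composition of `1`-morphisms, by pasting. -/
abbrev Mor.comp {X Y Z : FibCat k} (m : Mor X Y) (n : Mor Y Z) : Mor X Z where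
  T := m.T ⋙ n.T
  τ := m.τ ≪≫ Functor.isoWhiskerLeft m.T n.τ ≪≫ (Functor.associator _ _ _).symm
  isMonoidal := inferInstanceAs (NatTrans.IsMonoidal (m.τ.hom ≫
    Functor.whiskerLeft m.T n.τ.hom ≫ (Functor.associator m.T n.T Z.F).inv))

/-- The slice category: its morphisms are the isomorphism classes of `1`-morphisms. -/
instance : Category (FibCat k) where
  Hom X Y := Quotient (Mor.setoid X Y)
  id X := Quotient.mk _ (Mor.id X)
  comp := Quotient.map₂ Mor.comp (by
    rintro m m' ⟨s, hs⟩ n n' ⟨t, ht⟩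
    refine ⟨{ σ := s.σ ◫ t.σ, comm := ?_ },
      (NatIso.hcomp (asIso s.σ) (asIso t.σ)).isIso_hom⟩
    ext c : 2
    have h₁ := NatTrans.congr_app s.comm c
    have h₂ := fun d => NatTrans.congr_app t.comm d
    simp only [NatTrans.comp_app, Functor.whiskerRight_app, Functor.comp_obj] at h₁ h₂
    simp [← h₁, ← h₂, ← Functor.map_comp])
  id_comp := by
    rintro X Y ⟨m⟩
    refine Quotient.sound ⟨{ σ := m.T.leftUnitor.hom, comm := ?_ }, by dsimp; infer_instance⟩
    ext c : 2
    simp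
  comp_id := by
    rintro X Y ⟨m⟩
    refine Quotient.sound ⟨{ σ := m.T.rightUnitor.hom, comm := ?_ }, by dsimp; infer_instance⟩
    ext c : 2
    simp
  assoc := by
    rintro X Y Z W ⟨m⟩ ⟨n⟩ ⟨p⟩
    refine Quotient.sound ⟨{ σ := (Functor.associator _ _ _).hom, comm := ?_ },
      by dsimp; infer_instance⟩
    ext c : 2
    simp

/-- If the fiber functor of the target is faithful, a natural isomorphism compatible with the fiber
functors is automatically monoidal. -/
theorem Mor.sound {X Y : FibCat k} [Y.F.Faithful] (m m' : Mor X Y) (σ : m.T ≅ m'.T)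
    (h : ∀ c, m.τ.hom.app c ≫ Y.F.map (σ.hom.app c) = m'.τ.hom.app c) :
    (Quotient.mk _ m : Quotient (Mor.setoid X Y)) = Quotient.mk _ m' := by
  refine Quotient.sound ⟨{ σ := σ.hom, isMonoidal := ?_, comm := ?_ }, σ.isIso_hom⟩
  · constructor
    · apply Y.F.map_injective
      have h₁ := NatTrans.IsMonoidal.unit (τ := m.τ.hom)
      have h₂ := NatTrans.IsMonoidal.unit (τ := m'.τ.hom)
      rw [Functor.LaxMonoidal.comp_ε] at h₁ h₂
      rw [← cancel_epi (ε Y.F), ← h₂, ← h, Functor.map_comp, ← Category.assoc, ← h₁,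
        Category.assoc]
    · intro c d
      apply Y.F.map_injective
      have h₁ := NatTrans.IsMonoidal.tensor (τ := m.τ.hom) c d
      have h₂ := NatTrans.IsMonoidal.tensor (τ := m'.τ.hom) c d
      rw [Functor.LaxMonoidal.comp_μ] at h₁ h₂
      rw [← cancel_epi (μ Y.F _ _), ← cancel_epi (m.τ.hom.app c ⊗ₘ m.τ.hom.app d), Functor.map_comp,
        Functor.map_comp, ← Functor.LaxMonoidal.μ_natural_assoc,
        MonoidalCategory.tensorHom_comp_tensorHom_assoc, h, h, ← h₂, ← h]
      simp only [← Category.assoc] at h₁ ⊢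
      rw [h₁]
  · ext c : 2
    exact h c

/-- The monoidal category of finite-dimensional vector spaces, with the identity functor. -/
abbrev vec (k : Type u) [Field k] : FibCat k where
  C := FGModuleCat.{u} k
  F := 𝟭 _

/-- `(C, F)` is a fusion category with a faithful fiber functor. -/
def isFusion (k : Type u) [Field k] : ObjectProperty (FibCat k) :=
  fun X => IsFusion k X.C ∧ X.F.Faithful

end FibCat

/-- The category of fusion categories over `k` with a faithful linear monoidal functor to
finite-dimensional vector spaces. -/
abbrev FusFib (k : Type u) [Field k] := (FibCat.isFusion k).FullSubcategory

namespace FusFib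

variable {k : Type u} [Field k]

/-- The underlying category. -/
abbrev Cat (X : FusFib k) : Type (u + 1) := X.obj.C

/-- The fiber functor. -/
abbrev fib (X : FusFib k) : X.Cat ⥤ FGModuleCat.{u} k := X.obj.F

/-- The `1`-morphism `m` represents the morphism `f`. -/
def Represents {X Y : FusFib k} (m : FibCat.Mor X.obj Y.obj) (f : X ⟶ Y) : Prop :=
  Quotient.mk _ m = f.hom

end FusFib

/-! ### Semisimple Hopf algebras and their modules -/

/-- Finite-dimensional modules over a `k`-algebra `A`: a finite-dimensional vector space `V` with
an action `A → End V`. -/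
structure FDMod (k : Type u) [Field k] (A : Type u) [Ring A] [Algebra k A] where
  V : FGModuleCat.{u} k
  ρ : A →ₐ[k] Module.End k V

namespace FDMod

variable {k : Type u} [Field k]

section Algebra

variable {A : Type u} [Ring A] [Algebra k A]

/-- Morphisms of modules. -/
@[ext]
structure Hom (M N : FDMod k A) where
  hom : M.V ⟶ N.V
  comm : ∀ a : A, hom.hom.hom ∘ₗ M.ρ a = N.ρ a ∘ₗ hom.hom.hom

instance : Category (FDMod k A) where
  Hom := Hom
  id M := ⟨𝟙 M.V, fun _ => rfl⟩
  comp f g := ⟨f.hom ≫ g.hom, fun a => by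
    simp only [FGModuleCat.hom_hom_comp, LinearMap.comp_assoc, f.comm]
    rw [← LinearMap.comp_assoc, g.comm, LinearMap.comp_assoc]⟩

@[ext] theorem hom_ext {M N : FDMod k A} {f g : M ⟶ N} (h : f.hom = g.hom) : f = g :=
  Hom.ext h

variable (k A) in
/-- The forgetful functor to vector spaces. -/
@[simps] def forget : FDMod k A ⥤ FGModuleCat.{u} k where
  obj M := M.V
  map f := f.hom

instance : (forget k A).Faithful where
  map_injective h := hom_ext h

section

variable {M N : FDMod k A}

instance : Zero (M ⟶ N) := ⟨⟨0, fun a => by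
  change (0 : M.V →ₗ[k] N.V) ∘ₗ M.ρ a = N.ρ a ∘ₗ (0 : M.V →ₗ[k] N.V)
  simp⟩⟩
instance : Add (M ⟶ N) := ⟨fun f g => ⟨f.hom + g.hom, fun a => by
  change (f.hom.hom.hom + g.hom.hom.hom) ∘ₗ M.ρ a = N.ρ a ∘ₗ (f.hom.hom.hom + g.hom.hom.hom)
  rw [LinearMap.add_comp, LinearMap.comp_add, f.comm, g.comm]⟩⟩
instance : Neg (M ⟶ N) := ⟨fun f => ⟨-f.hom, fun a => by
  change (-f.hom.hom.hom) ∘ₗ M.ρ a = N.ρ a ∘ₗ (-f.hom.hom.hom)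
  rw [LinearMap.neg_comp, LinearMap.comp_neg, f.comm]⟩⟩
instance : Sub (M ⟶ N) := ⟨fun f g => ⟨f.hom - g.hom, fun a => by
  change (f.hom.hom.hom - g.hom.hom.hom) ∘ₗ M.ρ a = N.ρ a ∘ₗ (f.hom.hom.hom - g.hom.hom.hom)
  rw [LinearMap.sub_comp, LinearMap.comp_sub, f.comm, g.comm]⟩⟩
instance : SMul k (M ⟶ N) := ⟨fun c f => ⟨c • f.hom, fun a => by
  change (c • f.hom.hom.hom) ∘ₗ M.ρ a = N.ρ a ∘ₗ (c • f.hom.hom.hom)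
  rw [LinearMap.smul_comp, LinearMap.comp_smul, f.comm]⟩⟩
instance : SMul ℕ (M ⟶ N) := ⟨fun c f => ⟨c • f.hom, fun a => by
  change (c • f.hom.hom.hom) ∘ₗ M.ρ a = N.ρ a ∘ₗ (c • f.hom.hom.hom)
  rw [LinearMap.smul_comp, LinearMap.comp_smul, f.comm]⟩⟩
instance : SMul ℤ (M ⟶ N) := ⟨fun c f => ⟨c • f.hom, fun a => by
  change (c • f.hom.hom.hom) ∘ₗ M.ρ a = N.ρ a ∘ₗ (c • f.hom.hom.hom)
  rw [LinearMap.smul_comp, LinearMap.comp_smul, f.comm]⟩⟩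

instance : AddCommGroup (M ⟶ N) :=
  Function.Injective.addCommGroup (fun f : M ⟶ N => f.hom) (fun _ _ h => hom_ext h)
    rfl (fun _ _ => rfl) (fun _ => rfl) (fun _ _ => rfl) (fun _ _ => rfl) (fun _ _ => rfl)

instance : Module k (M ⟶ N) :=
  Function.Injective.module k
    { toFun := fun f : M ⟶ N => f.hom, map_zero' := rfl, map_add' := fun _ _ => rfl }
    (fun _ _ h => hom_ext h) (fun _ _ => rfl)

end

instance : Preadditive (FDMod k A) where
  add_comp _ _ _ f f' g := hom_ext (Preadditive.add_comp _ _ _ f.hom f'.hom g.hom)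
  comp_add _ _ _ f g g' := hom_ext (Preadditive.comp_add _ _ _ f.hom g.hom g'.hom)

instance : Linear k (FDMod k A) where
  smul_comp _ _ _ r f g := hom_ext (Linear.smul_comp _ _ _ r f.hom g.hom)
  comp_smul _ _ _ f r g := hom_ext (Linear.comp_smul _ _ _ f.hom r g.hom)

instance : (forget k A).Additive where
instance : (forget k A).Linear k where

/-- A linear isomorphism commuting with the actions is an isomorphism of modules. -/
@[simps] def mkIso {M N : FDMod k A} (e : M.V ≅ N.V)
    (h : ∀ a : A, e.hom.hom.hom ∘ₗ M.ρ a = N.ρ a ∘ₗ e.hom.hom.hom) : M ≅ N where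
  hom := ⟨e.hom, h⟩
  inv := ⟨e.inv, fun a => by
    have h₁ : e.inv.hom.hom ∘ₗ e.hom.hom.hom = LinearMap.id :=
      congrArg (fun f => f.hom.hom) e.hom_inv_id
    have h₂ : e.hom.hom.hom ∘ₗ e.inv.hom.hom = LinearMap.id :=
      congrArg (fun f => f.hom.hom) e.inv_hom_id
    calc e.inv.hom.hom ∘ₗ N.ρ a
        = e.inv.hom.hom ∘ₗ (N.ρ a ∘ₗ e.hom.hom.hom) ∘ₗ e.inv.hom.hom := by
          rw [LinearMap.comp_assoc, h₂, LinearMap.comp_id]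
      _ = (e.inv.hom.hom ∘ₗ e.hom.hom.hom) ∘ₗ M.ρ a ∘ₗ e.inv.hom.hom := by
          rw [← h]; rfl
      _ = M.ρ a ∘ₗ e.inv.hom.hom := by rw [h₁, LinearMap.id_comp]⟩
  hom_inv_id := hom_ext e.hom_inv_id
  inv_hom_id := hom_ext e.inv_hom_id

/-- Restriction of modules along an algebra homomorphism. -/
@[simps] def restrict {B : Type u} [Ring B] [Algebra k B] (f : A →ₐ[k] B) :
    FDMod k B ⥤ FDMod k A where
  obj M := ⟨M.V, M.ρ.comp f⟩
  map g := ⟨g.hom, fun a => g.comm (f a)⟩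

instance {B : Type u} [Ring B] [Algebra k B] (f : A →ₐ[k] B) : (restrict f).Additive where
instance {B : Type u} [Ring B] [Algebra k B] (f : A →ₐ[k] B) : (restrict f).Linear k where

end Algebra

section Bialgebra

variable {A : Type u} [Ring A] [Bialgebra k A]

/-- The action of `A` on `V ⊗ W` through the comultiplication. -/
def tensorAction {V W : FGModuleCat.{u} k} (ρ : A →ₐ[k] Module.End k V)
    (σ : A →ₐ[k] Module.End k W) : A →ₐ[k] Module.End k (V ⊗[k] W) :=
  (Module.endTensorEndAlgHom (R := k) (S := k) (A := k) (M := V) (N := W)).comp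
    ((Algebra.TensorProduct.map ρ σ).comp (Bialgebra.comulAlgHom k A))

theorem tensorAction_apply {V W : FGModuleCat.{u} k} (ρ : A →ₐ[k] Module.End k V)
    (σ : A →ₐ[k] Module.End k W) (a : A) :
    tensorAction ρ σ a =
      Module.endTensorEndAlgHom (R := k) (S := k) (A := k) (M := V) (N := W)
        (TensorProduct.map ρ.toLinearMap σ.toLinearMap (Coalgebra.comul (R := k) a)) := rfl

theorem tensorAction_natural {V W V' W' : FGModuleCat.{u} k}
    {ρ : A →ₐ[k] Module.End k V} {σ : A →ₐ[k] Module.End k W}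
    {ρ' : A →ₐ[k] Module.End k V'} {σ' : A →ₐ[k] Module.End k W'}
    (f : V →ₗ[k] V') (g : W →ₗ[k] W') (hf : ∀ a, f ∘ₗ ρ a = ρ' a ∘ₗ f)
    (hg : ∀ a, g ∘ₗ σ a = σ' a ∘ₗ g) (a : A) :
    TensorProduct.map f g ∘ₗ tensorAction ρ σ a =
      tensorAction ρ' σ' a ∘ₗ TensorProduct.map f g := by
  simp only [tensorAction_apply]
  induction (Coalgebra.comul (R := k) a) with
  | zero => simp
  | add x y hx hy => simp only [map_add, LinearMap.comp_add, LinearMap.add_comp, hx, hy]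
  | tmul x y =>
    simp only [TensorProduct.map_tmul, AlgHom.toLinearMap_apply, Module.endTensorEndAlgHom_apply]
    change TensorProduct.map f g ∘ₗ TensorProduct.map (ρ x) (σ y) =
      TensorProduct.map (ρ' x) (σ' y) ∘ₗ TensorProduct.map f g
    rw [← TensorProduct.map_comp, ← TensorProduct.map_comp, hf, hg]

/-- The linear map `A ⊗ A → End (V ⊗ W)` given by two actions of `A`. -/
def pairAction {V W : FGModuleCat.{u} k} (ρ : A →ₐ[k] Module.End k V)
    (σ : A →ₐ[k] Module.End k W) : A ⊗[k] A →ₗ[k] Module.End k (V ⊗[k] W) :=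
  (Module.endTensorEndAlgHom (R := k) (S := k) (A := k) (M := V) (N := W)).toLinearMap ∘ₗ
    TensorProduct.map ρ.toLinearMap σ.toLinearMap

theorem tensorAction_toLinearMap {V W : FGModuleCat.{u} k} (ρ : A →ₐ[k] Module.End k V)
    (σ : A →ₐ[k] Module.End k W) :
    (tensorAction ρ σ).toLinearMap = pairAction ρ σ ∘ₗ Coalgebra.comul := rfl

theorem tensorAction_assoc {V W U : FGModuleCat.{u} k}
    (ρ : A →ₐ[k] Module.End k V) (σ : A →ₐ[k] Module.End k W) (τ : A →ₐ[k] Module.End k U)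
    (a : A) :
    (TensorProduct.assoc k V W U).toLinearMap ∘ₗ
        tensorAction (V := V ⊗ W) (tensorAction ρ σ) τ a =
      tensorAction (W := W ⊗ U) ρ (tensorAction σ τ) a ∘ₗ
        (TensorProduct.assoc k V W U).toLinearMap := by
  rw [tensorAction_apply, tensorAction_apply, tensorAction_toLinearMap, tensorAction_toLinearMap]
  have h₁ : ∀ t : A ⊗[k] A, TensorProduct.map (pairAction ρ σ ∘ₗ Coalgebra.comul) τ.toLinearMap t =
      TensorProduct.map (pairAction ρ σ) τ.toLinearMap
        ((Coalgebra.comul (R := k) (A := A)).rTensor A t) := fun t => by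
    rw [LinearMap.rTensor, ← LinearMap.comp_apply, ← TensorProduct.map_comp, LinearMap.comp_id]
  have h₂ : ∀ t : A ⊗[k] A, TensorProduct.map ρ.toLinearMap (pairAction σ τ ∘ₗ Coalgebra.comul) t =
      TensorProduct.map ρ.toLinearMap (pairAction σ τ)
        ((Coalgebra.comul (R := k) (A := A)).lTensor A t) := fun t => by
    rw [LinearMap.lTensor, ← LinearMap.comp_apply, ← TensorProduct.map_comp, LinearMap.comp_id]
  have h₃ : ∀ t : (A ⊗[k] A) ⊗[k] A, (TensorProduct.assoc k V W U).toLinearMap ∘ₗ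
      Module.endTensorEndAlgHom (R := k) (S := k) (A := k) (M := (V ⊗[k] W)) (N := U)
        (TensorProduct.map (pairAction ρ σ) τ.toLinearMap t) =
      Module.endTensorEndAlgHom (R := k) (S := k) (A := k) (M := V) (N := (W ⊗[k] U))
        (TensorProduct.map ρ.toLinearMap (pairAction σ τ) (TensorProduct.assoc k A A A t)) ∘ₗ
        (TensorProduct.assoc k V W U).toLinearMap := fun t => by
    induction t with
    | zero => simp
    | add x y hx hy => simp only [map_add, LinearMap.comp_add, LinearMap.add_comp, hx, hy]
    | tmul x z =>
      induction x with
      | zero => simp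
      | add x y hx hy =>
        simp only [TensorProduct.add_tmul, map_add, LinearMap.comp_add, LinearMap.add_comp, hx, hy]
      | tmul x y =>
        refine TensorProduct.ext_threefold fun v w u => ?_
        rfl
  have h := h₃ ((Coalgebra.comul (R := k) (A := A)).rTensor A (Coalgebra.comul (R := k) a))
  rw [Coalgebra.coassoc_apply, ← h₂, ← h₁] at h
  exact h

/-- The trivial action of `A`, through the counit. -/
def unitAction : A →ₐ[k] Module.End k k :=
  (Algebra.ofId k (Module.End k k)).comp (Bialgebra.counitAlgHom k A)

theorem unitAction_apply (a : A) (x : k) :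
    unitAction a x = Coalgebra.counit (R := k) a * x := rfl

theorem tensorAction_unit_left {V : FGModuleCat.{u} k} (ρ : A →ₐ[k] Module.End k V) (a : A) :
    (TensorProduct.lid k V).toLinearMap ∘ₗ
        tensorAction (V := 𝟙_ (FGModuleCat.{u} k)) unitAction ρ a =
      ρ a ∘ₗ (TensorProduct.lid k V).toLinearMap := by
  rw [tensorAction_apply]
  have h : ∀ t : A ⊗[k] A, (TensorProduct.lid k V).toLinearMap ∘ₗ
      Module.endTensorEndAlgHom (R := k) (S := k) (A := k) (M := k) (N := V)
        (TensorProduct.map unitAction.toLinearMap ρ.toLinearMap t) =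
      ρ (TensorProduct.lid k A ((Coalgebra.counit (R := k) (A := A)).rTensor A t)) ∘ₗ
        (TensorProduct.lid k V).toLinearMap := fun t => by
    induction t with
    | zero => simp
    | add x y hx hy => simp only [map_add, LinearMap.comp_add, LinearMap.add_comp, hx, hy]
    | tmul x y =>
      ext v
      simp only [TensorProduct.map_tmul, AlgHom.toLinearMap_apply, LinearMap.rTensor_tmul,
        TensorProduct.lid_tmul, map_smul]
      change (Coalgebra.counit (R := k) x * (1 : k)) • (ρ y) v =
        Coalgebra.counit (R := k) x • (ρ y) ((1 : k) • v)
      rw [mul_one, one_smul]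
  have h' := h (Coalgebra.comul (R := k) a)
  rw [Coalgebra.rTensor_counit_comul] at h'
  simpa using h'

theorem tensorAction_unit_right {V : FGModuleCat.{u} k} (ρ : A →ₐ[k] Module.End k V) (a : A) :
    (TensorProduct.rid k V).toLinearMap ∘ₗ
        tensorAction (W := 𝟙_ (FGModuleCat.{u} k)) ρ unitAction a =
      ρ a ∘ₗ (TensorProduct.rid k V).toLinearMap := by
  rw [tensorAction_apply]
  have h : ∀ t : A ⊗[k] A, (TensorProduct.rid k V).toLinearMap ∘ₗ
      Module.endTensorEndAlgHom (R := k) (S := k) (A := k) (M := V) (N := k)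
        (TensorProduct.map ρ.toLinearMap unitAction.toLinearMap t) =
      ρ (TensorProduct.rid k A ((Coalgebra.counit (R := k) (A := A)).lTensor A t)) ∘ₗ
        (TensorProduct.rid k V).toLinearMap := fun t => by
    induction t with
    | zero => simp
    | add x y hx hy => simp only [map_add, LinearMap.comp_add, LinearMap.add_comp, hx, hy]
    | tmul x y =>
      ext v
      simp only [TensorProduct.map_tmul, AlgHom.toLinearMap_apply, LinearMap.lTensor_tmul,
        TensorProduct.rid_tmul, map_smul]
      change (Coalgebra.counit (R := k) y * (1 : k)) • (ρ x) v =
        Coalgebra.counit (R := k) y • (ρ x) ((1 : k) • v)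
      rw [mul_one, one_smul]
  have h' := h (Coalgebra.comul (R := k) a)
  rw [Coalgebra.lTensor_counit_comul] at h'
  simpa using h'

/-- The tensor product of modules over a bialgebra; the forgetful functor is strictly monoidal. -/
instance : MonoidalCategoryStruct (FDMod k A) where
  tensorObj M N := ⟨M.V ⊗ N.V, tensorAction M.ρ N.ρ⟩
  tensorUnit := ⟨𝟙_ _, unitAction⟩
  tensorHom f g := ⟨f.hom ⊗ₘ g.hom, tensorAction_natural _ _ f.comm g.comm⟩
  whiskerLeft M _ _ f := ⟨M.V ◁ f.hom, tensorAction_natural _ _ (fun _ => rfl) f.comm⟩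
  whiskerRight f M := ⟨f.hom ▷ M.V, tensorAction_natural _ _ f.comm (fun _ => rfl)⟩
  associator M N P := mkIso (α_ M.V N.V P.V) (tensorAction_assoc M.ρ N.ρ P.ρ)
  leftUnitor M := mkIso (λ_ M.V) (tensorAction_unit_left M.ρ)
  rightUnitor M := mkIso (ρ_ M.V) (tensorAction_unit_right M.ρ)

instance : MonoidalCategory (FDMod k A) where
  tensorHom_def f g := hom_ext (MonoidalCategory.tensorHom_def f.hom g.hom)
  id_tensorHom_id M N := hom_ext (MonoidalCategory.id_tensorHom_id M.V N.V)
  tensorHom_comp_tensorHom f g h i :=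
    hom_ext (MonoidalCategory.tensorHom_comp_tensorHom f.hom g.hom h.hom i.hom)
  whiskerLeft_id M N := hom_ext (MonoidalCategory.whiskerLeft_id M.V N.V)
  id_whiskerRight M N := hom_ext (MonoidalCategory.id_whiskerRight M.V N.V)
  associator_naturality f g h :=
    hom_ext (MonoidalCategory.associator_naturality f.hom g.hom h.hom)
  leftUnitor_naturality f := hom_ext (MonoidalCategory.leftUnitor_naturality f.hom)
  rightUnitor_naturality f := hom_ext (MonoidalCategory.rightUnitor_naturality f.hom)
  pentagon M N P Q := hom_ext (MonoidalCategory.pentagon M.V N.V P.V Q.V)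
  triangle M N := hom_ext (MonoidalCategory.triangle M.V N.V)

instance : (forget k A).Monoidal :=
  Functor.CoreMonoidal.toMonoidal
    { εIso := Iso.refl _
      μIso := fun _ _ => Iso.refl _
      μIso_hom_natural_left := fun f M => (Category.comp_id _).trans (Category.id_comp _).symm
      μIso_hom_natural_right := fun M f => (Category.comp_id _).trans (Category.id_comp _).symm
      associativity := fun M N P => by
        change 𝟙 (M.V ⊗ N.V) ▷ P.V ≫ 𝟙 _ ≫ (α_ M.V N.V P.V).hom =
          (α_ M.V N.V P.V).hom ≫ M.V ◁ 𝟙 (N.V ⊗ P.V) ≫ 𝟙 _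
        simp only [MonoidalCategory.id_whiskerRight, MonoidalCategory.whiskerLeft_id,
          Category.id_comp, Category.comp_id]
      left_unitality := fun M => by
        change (λ_ M.V).hom = 𝟙 (𝟙_ (FGModuleCat.{u} k)) ▷ M.V ≫ 𝟙 _ ≫ (λ_ M.V).hom
        simp only [MonoidalCategory.id_whiskerRight, Category.id_comp]
      right_unitality := fun M => by
        change (ρ_ M.V).hom = M.V ◁ 𝟙 (𝟙_ (FGModuleCat.{u} k)) ≫ 𝟙 _ ≫ (ρ_ M.V).hom
        simp only [MonoidalCategory.whiskerLeft_id, Category.id_comp] }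

theorem restrict_tensorAction {B : Type u} [Ring B] [Bialgebra k B] (f : A →ₐc[k] B)
    {V W : FGModuleCat.{u} k} (ρ : B →ₐ[k] Module.End k V) (σ : B →ₐ[k] Module.End k W) (a : A) :
    tensorAction (ρ.comp (f : A →ₐ[k] B)) (σ.comp (f : A →ₐ[k] B)) a = tensorAction ρ σ (f a) := by
  rw [tensorAction_apply, tensorAction_apply, ← CoalgHomClass.map_comp_comul_apply f a,
    ← LinearMap.comp_apply (TensorProduct.map ρ.toLinearMap _), ← TensorProduct.map_comp]
  rfl

theorem restrict_unitAction {B : Type u} [Ring B] [Bialgebra k B] (f : A →ₐc[k] B) (a : A) :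
    unitAction a = (unitAction (k := k) (f a) : Module.End k k) := by
  ext
  simp [unitAction_apply]

instance {B : Type u} [Ring B] [Bialgebra k B] (f : A →ₐc[k] B) :
    (restrict (f : A →ₐ[k] B)).Monoidal :=
  Functor.CoreMonoidal.toMonoidal
    { εIso := mkIso (Iso.refl (𝟙_ (FGModuleCat.{u} k))) (restrict_unitAction f)
      μIso := fun M N => mkIso (Iso.refl (M.V ⊗ N.V)) (restrict_tensorAction f M.ρ N.ρ)
      μIso_hom_natural_left := fun f M =>
        hom_ext ((Category.comp_id _).trans (Category.id_comp _).symm)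
      μIso_hom_natural_right := fun M f =>
        hom_ext ((Category.comp_id _).trans (Category.id_comp _).symm)
      associativity := fun M N P => hom_ext <| by
        change 𝟙 (M.V ⊗ N.V) ▷ P.V ≫ 𝟙 _ ≫ (α_ M.V N.V P.V).hom =
          (α_ M.V N.V P.V).hom ≫ M.V ◁ 𝟙 (N.V ⊗ P.V) ≫ 𝟙 _
        simp only [MonoidalCategory.id_whiskerRight, MonoidalCategory.whiskerLeft_id,
          Category.id_comp, Category.comp_id]
      left_unitality := fun M => hom_ext <| by
        change (λ_ M.V).hom = 𝟙 (𝟙_ (FGModuleCat.{u} k)) ▷ M.V ≫ 𝟙 _ ≫ (λ_ M.V).hom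
        simp only [MonoidalCategory.id_whiskerRight, Category.id_comp]
      right_unitality := fun M => hom_ext <| by
        change (ρ_ M.V).hom = M.V ◁ 𝟙 (𝟙_ (FGModuleCat.{u} k)) ≫ 𝟙 _ ≫ (ρ_ M.V).hom
        simp only [MonoidalCategory.whiskerLeft_id, Category.id_comp] }

end Bialgebra

end FDMod

/-- The category of finite-dimensional modules over a Hopf algebra, with the forgetful functor. -/
abbrev modFib (k : Type u) [Field k] (A : HopfAlgCat.{u} k) : FibCat k where
  C := FDMod k A
  F := FDMod.forget k A

/-- Restriction along a homomorphism of Hopf algebras, as a morphism over vector spaces. -/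
abbrev modRestrict {k : Type u} [Field k] {A B : HopfAlgCat.{u} k} (f : A ⟶ B) :
    FibCat.Mor (modFib k B) (modFib k A) where
  T := FDMod.restrict (f.toBialgHom : A →ₐ[k] B)
  τ := Iso.refl _
  isMonoidal :=
    { unit := rfl
      tensor := fun M N => by
        change 𝟙 (M.V ⊗ N.V) ≫ 𝟙 _ = (𝟙 M.V ⊗ₘ 𝟙 N.V) ≫ 𝟙 _ ≫ 𝟙 _
        simp only [MonoidalCategory.id_tensorHom_id, Category.comp_id] }

instance (k : Type u) [Field k] (A : HopfAlgCat.{u} k) : (modFib k A).F.Faithful :=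
  inferInstanceAs (FDMod.forget k A).Faithful

/-- The contravariant functor `A ↦ (Mod A, Forget)`, which sends a homomorphism to restriction
along it. -/
def modFunctor (k : Type u) [Field k] : (HopfAlgCat.{u} k)ᵒᵖ ⥤ FibCat k where
  obj A := modFib k A.unop
  map f := Quotient.mk _ (modRestrict f.unop)
  map_id A := FibCat.Mor.sound _ _
    (NatIso.ofComponents (F := FDMod.restrict _) (G := 𝟭 (FDMod k A.unop))
      (fun M => FDMod.mkIso (Iso.refl M.V) fun _ => rfl)
      fun f => FDMod.hom_ext ((Category.comp_id f.hom).trans (Category.id_comp f.hom).symm))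
    fun M => Category.comp_id (𝟙 M.V)
  map_comp f g := FibCat.Mor.sound _ _
    (NatIso.ofComponents (F := FDMod.restrict _) (G := FDMod.restrict _ ⋙ FDMod.restrict _)
      (fun M => FDMod.mkIso (Iso.refl M.V) fun _ => rfl)
      fun f => FDMod.hom_ext ((Category.comp_id f.hom).trans (Category.id_comp f.hom).symm))
    fun M => (Category.comp_id (𝟙 M.V)).trans <| by
      change 𝟙 M.V = 𝟙 M.V ≫ 𝟙 M.V ≫ 𝟙 M.V
      simp only [Category.comp_id]

/-- A Hopf algebra is finite-dimensional and semisimple. -/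
def isSemisimpleHopf (k : Type u) [Field k] : ObjectProperty (HopfAlgCat.{u} k) :=
  fun A => Module.Finite k A ∧ IsSemisimpleRing A

theorem isSemisimpleRing_tensorProduct (k : Type u) [Field k] [IsAlgClosed k]
    (A B : Type u) [Ring A] [Algebra k A] [Ring B] [Algebra k B] [Module.Finite k A]
    [Module.Finite k B] [IsSemisimpleRing A] [IsSemisimpleRing B] :
    IsSemisimpleRing (A ⊗[k] B) := by
  obtain ⟨n, d, _, ⟨e⟩⟩ := IsSemisimpleRing.exists_algEquiv_pi_matrix_of_isAlgClosed k A
  obtain ⟨m, d', _, ⟨e'⟩⟩ := IsSemisimpleRing.exists_algEquiv_pi_matrix_of_isAlgClosed k B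
  classical
  have h₁ : ∀ j, IsSemisimpleRing (A ⊗[k] Matrix (Fin (d' j)) (Fin (d' j)) k) := fun j => by
    let E : A ⊗[k] Matrix (Fin (d' j)) (Fin (d' j)) k ≃ₐ[k]
        ∀ i, Matrix (Fin (d' j) × Fin (d i)) (Fin (d' j) × Fin (d i)) k :=
      (Algebra.TensorProduct.comm k _ _).trans <|
        (Algebra.TensorProduct.congr AlgEquiv.refl e).trans <|
          (Algebra.TensorProduct.piRight k k _ _).trans <|
            AlgEquiv.piCongrRight fun i => Matrix.kroneckerAlgEquiv _ _ _
    exact E.symm.toRingEquiv.isSemisimpleRing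
  let E : A ⊗[k] B ≃ₐ[k] ∀ j, A ⊗[k] Matrix (Fin (d' j)) (Fin (d' j)) k :=
    (Algebra.TensorProduct.congr AlgEquiv.refl e').trans (Algebra.TensorProduct.piRight k k _ _)
  exact E.symm.toRingEquiv.isSemisimpleRing

instance (k : Type u) [Field k] [IsAlgClosed k] : (isSemisimpleHopf k).IsMonoidal where
  prop_unit := ⟨inferInstanceAs (Module.Finite k k), inferInstanceAs (IsSemisimpleRing k)⟩
  prop_tensor A B := by
    rintro ⟨_, _⟩ ⟨_, _⟩
    exact ⟨inferInstanceAs (Module.Finite k (A ⊗[k] B)),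
      isSemisimpleRing_tensorProduct k A B⟩

/-- The category of finite-dimensional semisimple Hopf algebras over `k`. It is monoidal under the
tensor product over `k`. -/
abbrev SSHopf (k : Type u) [Field k] := (isSemisimpleHopf k).FullSubcategory

/-- `A ↦ (Mod A, Forget)` on finite-dimensional semisimple Hopf algebras, given that the module
categories are fusion categories. -/
def modSS (k : Type u) [Field k] (h : ∀ A : SSHopf k, FibCat.isFusion k (modFib k A.obj)) :
    SSHopf k ⥤ (FusFib k)ᵒᵖ :=
  ((FibCat.isFusion k).lift ((isSemisimpleHopf k).ι.op ⋙ modFunctor k) fun A => h A.unop).rightOp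

/-! ### The Hopf algebra of endomorphisms of a fiber functor -/

/-- An identification of the Hopf algebra `A` with the endomorphism algebra `End F` of the fiber
functor `F` of `X`. (As the category of `X` is large, `A` is a small copy of `End F`.) The product
of `End F` is composition of natural transformations.

* If `Δ η = ∑ η₁ ⊗ η₂` then, up to the tensorator `F c ⊗ F d ≅ F (c ⊗ d)`, the component of `η` at
  `c ⊗ d` is `∑ (η₁)_c ⊗ (η₂)_d`.
* The counit of `η` is the scalar by which `η` acts on `F 𝟙 ≅ k`.
* If `d` is a dual of `c`, with evaluation `d ⊗ c ⟶ 𝟙`, then the pairing `F d ⊗ F c ⟶ F 𝟙` exhibits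
  `F d` as the dual of the vector space `F c`, and `(S η)_c` is the transpose of `η_d`. -/
structure EndIso {k : Type u} [Field k] (X : FusFib k) (A : HopfAlgCat.{u} k) where
  iso : A ≃ₐ[k] End X.fib
  comul : ∀ (a : A) {ι : Type u} (s : Finset ι) (l r : ι → A),
    Coalgebra.comul (R := k) a = ∑ i ∈ s, l i ⊗ₜ[k] r i → ∀ c d : X.Cat,
      μ X.fib c d ≫ NatTrans.app (iso a) (c ⊗ d) =
        (∑ i ∈ s, (NatTrans.app (iso (l i)) c ⊗ₘ NatTrans.app (iso (r i)) d)) ≫ μ X.fib c d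
  counit : ∀ a : A,
    ε X.fib ≫ NatTrans.app (iso a) (𝟙_ X.Cat) = Coalgebra.counit (R := k) a • ε X.fib
  antipode : ∀ (a : A) (c d : X.Cat) [ExactPairing c d],
    NatTrans.app (iso a) d ▷ X.fib.obj c ≫ μ X.fib d c ≫ X.fib.map (ε_ c d) =
      X.fib.obj d ◁ NatTrans.app (iso (HopfAlgebra.antipode k a)) c ≫
        μ X.fib d c ≫ X.fib.map (ε_ c d)

/-- The functor from `X` to modules over `End F` which equips `F c` with the evident action. -/
def EndIso.functor {k : Type u} [Field k] {X : FusFib k} {A : HopfAlgCat.{u} k}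
    (e : EndIso X A) : X.Cat ⥤ FDMod k A where
  obj c :=
    { V := X.fib.obj c
      ρ :=
        { toFun := fun a => (NatTrans.app (e.iso a) c).hom.hom
          map_one' := by rw [map_one]; rfl
          map_mul' := fun a b => by rw [map_mul]; rfl
          map_zero' := by rw [map_zero]; rfl
          map_add' := fun a b => by rw [map_add]; rfl
          commutes' := fun r => by rw [AlgEquiv.commutes]; rfl } }
  map f := ⟨X.fib.map f, fun a =>
    congrArg (fun g => g.hom.hom) (NatTrans.naturality (e.iso a) f).symm⟩
  map_id c := FDMod.hom_ext (X.fib.map_id c)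
  map_comp f g := FDMod.hom_ext (X.fib.map_comp f g)

/-! ### The Deligne tensor product -/

section Deligne

variable (k : Type u) [Field k]

/-- Bilinear bifunctors. -/
structure IsBilinear {C D E : Type (u + 1)} [Category.{u} C] [Category.{u} D] [Category.{u} E]
    [Preadditive C] [Preadditive D] [Preadditive E] [Linear k C] [Linear k D] [Linear k E]
    (B : C × D ⥤ E) : Prop where
  additive_left : ∀ d, ((Functor.curry.obj B).flip.obj d).Additive
  linear_left : ∀ d, ((Functor.curry.obj B).flip.obj d).Linear k
  additive_right : ∀ c, ((Functor.curry.obj B).obj c).Additive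
  linear_right : ∀ c, ((Functor.curry.obj B).obj c).Linear k

/-- A bilinear bifunctor `B : C × D ⥤ M` exhibits `M` as the Deligne tensor product of `C` and `D`
if, for every finite semisimple category `E`, precomposition with `B` is an equivalence from linear
functors `M ⥤ E` to bilinear bifunctors `C × D ⥤ E`. -/
structure IsDeligneProduct {C D M : Type (u + 1)} [Category.{u} C] [Category.{u} D]
    [Category.{u} M] [Preadditive C] [Preadditive D] [Preadditive M] [Linear k C] [Linear k D]
    [Linear k M] (B : C × D ⥤ M) : Prop where
  bilinear : IsBilinear k B
  exists_lift : ∀ (E : Type (u + 1)) [Category.{u} E] [Preadditive E] [Linear k E],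
    IsFiniteSemisimple k E → ∀ G : C × D ⥤ E, IsBilinear k G →
      ∃ H : M ⥤ E, H.Additive ∧ H.Linear k ∧ Nonempty (B ⋙ H ≅ G)
  whisker_bijective : ∀ (E : Type (u + 1)) [Category.{u} E] [Preadditive E] [Linear k E],
    IsFiniteSemisimple k E → ∀ (H H' : M ⥤ E) [H.Additive] [H.Linear k] [H'.Additive]
      [H'.Linear k], Function.Bijective fun t : H ⟶ H' => Functor.whiskerLeft B t

variable {k}

/-- `Z` is the tensor product of `X` and `Y`: its underlying category is the Deligne product, with a
monoidal universal bifunctor `⊠`, and its fiber functor is induced by `F ⊗ F'`. -/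
structure DeligneProduct (X Y Z : FusFib k) where
  box : X.Cat × Y.Cat ⥤ Z.Cat
  [monoidal : box.Monoidal]
  isDeligneProduct : IsDeligneProduct k box
  fibIso : box ⋙ Z.fib ≅ X.fib.prod Y.fib ⋙ tensor (FGModuleCat.{u} k)
  [isMonoidal : NatTrans.IsMonoidal fibIso.hom]

namespace DeligneProduct

variable {X Y Z : FusFib k} (P : DeligneProduct X Y Z)

/-- The object `x ⊠ y`. -/
abbrev obj (x : X.Cat) (y : Y.Cat) : Z.Cat := P.box.obj (x, y)

/-- The isomorphism from the fiber of `x ⊠ y` to the tensor product of the fibers. -/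
abbrev fib (x : X.Cat) (y : Y.Cat) : Z.fib.obj (P.obj x y) ⟶ X.fib.obj x ⊗ Y.fib.obj y :=
  P.fibIso.hom.app (x, y)

end DeligneProduct

/-- A monoidal structure on the category of fusion categories with fiber functor given by the
Deligne tensor product. The tensor product of morphisms, the associator and the unitors are the ones
induced by the universal bifunctors `⊠`; in each case the natural isomorphism `u` that expresses this
is compatible with the fiber functors. -/
structure DeligneMonoidal (k : Type u) [Field k] where
  monoidal : MonoidalCategory (FusFib k)
  boxProd (X Y : FusFib k) : DeligneProduct X Y (X ⊗ Y)
  /-- The unit is the category of vector spaces with the identity functor. -/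
  unit : Nonempty ((𝟙_ (FusFib k)).obj ≅ FibCat.vec k)
  /-- `(f ⊗ g) (x ⊠ y) ≅ f x ⊠ g y`. -/
  tensorHom : ∀ {X X' Y Y' : FusFib k} (f : X ⟶ X') (g : Y ⟶ Y') (m : FibCat.Mor X.obj X'.obj)
    (n : FibCat.Mor Y.obj Y'.obj) (p : FibCat.Mor (X ⊗ Y).obj (X' ⊗ Y').obj),
    FusFib.Represents m f → FusFib.Represents n g → FusFib.Represents p (f ⊗ₘ g) →
      ∃ u : (boxProd X Y).box ⋙ p.T ≅ m.T.prod n.T ⋙ (boxProd X' Y').box,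
        ∀ (x : X.Cat) (y : Y.Cat),
          p.τ.hom.app ((boxProd X Y).obj x y) ≫ (X' ⊗ Y').fib.map (u.hom.app (x, y)) ≫
              (boxProd X' Y').fib (m.T.obj x) (n.T.obj y) =
            (boxProd X Y).fib x y ≫ (m.τ.hom.app x ⊗ₘ n.τ.hom.app y)
  /-- `(x ⊠ y) ⊠ z ↦ x ⊠ (y ⊠ z)`. -/
  associator : ∀ (X Y Z : FusFib k) (m : FibCat.Mor ((X ⊗ Y) ⊗ Z).obj (X ⊗ (Y ⊗ Z)).obj),
    FusFib.Represents m (α_ X Y Z).hom →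
      ∃ u : (boxProd X Y).box.prod (𝟭 Z.Cat) ⋙ (boxProd (X ⊗ Y) Z).box ⋙ m.T ≅
          CategoryTheory.prod.associator X.Cat Y.Cat Z.Cat ⋙ (𝟭 X.Cat).prod (boxProd Y Z).box ⋙
            (boxProd X (Y ⊗ Z)).box,
        ∀ (x : X.Cat) (y : Y.Cat) (z : Z.Cat),
          m.τ.hom.app ((boxProd (X ⊗ Y) Z).obj ((boxProd X Y).obj x y) z) ≫
              (X ⊗ (Y ⊗ Z)).fib.map (u.hom.app ((x, y), z)) ≫
                (boxProd X (Y ⊗ Z)).fib x ((boxProd Y Z).obj y z) ≫ X.fib.obj x ◁ (boxProd Y Z).fib y z =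
            (boxProd (X ⊗ Y) Z).fib ((boxProd X Y).obj x y) z ≫ (boxProd X Y).fib x y ▷ Z.fib.obj z ≫
              (α_ (X.fib.obj x) (Y.fib.obj y) (Z.fib.obj z)).hom
  /-- `𝟙 ⊠ x ↦ x`. -/
  leftUnitor : ∀ (X : FusFib k) (m : FibCat.Mor (𝟙_ (FusFib k) ⊗ X).obj X.obj),
    FusFib.Represents m (λ_ X).hom →
      ∃ u : (Functor.curry.obj (boxProd (𝟙_ (FusFib k)) X).box).obj (𝟙_ _) ⋙ m.T ≅ 𝟭 X.Cat,
        ∀ x : X.Cat,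
          m.τ.hom.app ((boxProd (𝟙_ (FusFib k)) X).obj (𝟙_ _) x) ≫ X.fib.map (u.hom.app x) =
            (boxProd (𝟙_ (FusFib k)) X).fib (𝟙_ _) x ≫
              Functor.OplaxMonoidal.η (𝟙_ (FusFib k)).fib ▷ X.fib.obj x ≫ (λ_ (X.fib.obj x)).hom
  /-- `x ⊠ 𝟙 ↦ x`. -/
  rightUnitor : ∀ (X : FusFib k) (m : FibCat.Mor (X ⊗ 𝟙_ (FusFib k)).obj X.obj),
    FusFib.Represents m (ρ_ X).hom →
      ∃ u : (Functor.curry.obj (boxProd X (𝟙_ (FusFib k))).box).flip.obj (𝟙_ _) ⋙ m.T ≅ 𝟭 X.Cat,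
        ∀ x : X.Cat,
          m.τ.hom.app ((boxProd X (𝟙_ (FusFib k))).obj x (𝟙_ _)) ≫ X.fib.map (u.hom.app x) =
            (boxProd X (𝟙_ (FusFib k))).fib x (𝟙_ _) ≫
              X.fib.obj x ◁ Functor.OplaxMonoidal.η (𝟙_ (FusFib k)).fib ≫ (ρ_ (X.fib.obj x)).hom

end Deligne

/-! ### The reconstruction equivalence -/

/-- Data exhibiting `A ↦ (Mod A, Forget)` and `(C, F) ↦ End F` as mutually inverse contravariant
equivalences. -/
structure Reconstruction (k : Type u) [Field k] where
  /-- The category of modules over a finite-dimensional semisimple Hopf algebra is a fusion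
  category (with faithful forgetful functor). -/
  fusion : ∀ A : SSHopf k, FibCat.isFusion k (modFib k A.obj)
  /-- The functor `(C, F) ↦ End F`. -/
  Q : (FusFib k)ᵒᵖ ⥤ SSHopf k
  endIso : ∀ X : FusFib k, EndIso X (Q.obj (op X)).obj
  /-- On the class of `(T, τ)` the functor is `η ↦ τ⁻¹ ∘ (η T) ∘ τ`. -/
  endIso_map : ∀ {X Y : FusFib k} (f : X ⟶ Y) (m : FibCat.Mor X.obj Y.obj),
    FusFib.Represents m f → ∀ (a : (Q.obj (op Y)).obj) (c : X.Cat),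
      NatTrans.app ((endIso X).iso ((Q.map f.op).hom.toBialgHom a)) c =
        m.τ.hom.app c ≫ NatTrans.app ((endIso Y).iso a) (m.T.obj c) ≫ m.τ.inv.app c
  /-- The natural isomorphism `A ≅ End (Forget_A)`. -/
  γ : 𝟭 (SSHopf k) ≅ modSS k fusion ⋙ Q
  /-- The element `a` of `A` is sent to the natural transformation given by the action of `a`. -/
  γ_apply : ∀ (A : SSHopf k) (a : A.obj) (M : FDMod k A.obj),
    (NatTrans.app ((endIso ((modSS k fusion).obj A).unop).iso
      ((γ.hom.app A).hom.toBialgHom a)) M).hom.hom = M.ρ a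
  /-- The natural isomorphism `(C, F) ≅ (Mod (End F), Forget)`. -/
  ζ : Q ⋙ modSS k fusion ≅ 𝟭 (FusFib k)ᵒᵖ
  /-- It is represented by the functor which equips `F c` with its action of `End F`. -/
  ζ_represents : ∀ (X : FusFib k)
    (m : FibCat.Mor X.obj (modFib k (Q.obj (op X)).obj)),
    FusFib.Represents (Y := ((Q ⋙ modSS k fusion).obj (op X)).unop) m (ζ.hom.app (op X)).unop →
      ∃ u : m.T ≅ (endIso X).functor,
        ∀ c : X.Cat, m.τ.hom.app c ≫ (u.hom.app c).hom = 𝟙 (X.fib.obj c)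
  triangle : ∀ A : SSHopf k,
    (modSS k fusion).map (γ.hom.app A) ≫ ζ.hom.app ((modSS k fusion).obj A) =
      𝟙 ((modSS k fusion).obj A)

/-- The resulting equivalence between finite-dimensional semisimple Hopf algebras and the opposite
of the category of fusion categories with fiber functor. -/
abbrev Reconstruction.equivalence {k : Type u} [Field k] (R : Reconstruction k) :
    SSHopf k ≌ (FusFib k)ᵒᵖ where
  functor := modSS k R.fusion
  inverse := R.Q
  unitIso := R.γ
  counitIso := R.ζ
  functor_unitIso_comp := R.triangle

end

noncomputable section

/-! ### Actions on tensor products of objects -/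

section TensEnd

variable {k : Type u} [Field k] {C : Type w} [Category.{v} C] [Preadditive C] [Linear k C]
  [MonoidalCategory C] [MonoidalPreadditive C] [MonoidalLinear k C]
  {A B D : Type*} [Ring A] [Algebra k A] [Ring B] [Algebra k B] [Ring D] [Algebra k D]

variable (k) in
/-- Whiskering endomorphisms on the right. -/
def whiskerRightEnd (V W : C) : End V →ₐ[k] End (V ⊗ W) :=
  AlgHom.ofLinearMap
    { toFun := fun f => MonoidalCategoryStruct.whiskerRight (C := C) f W
      map_add' := fun _ _ => MonoidalPreadditive.add_whiskerRight _ _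
      map_smul' := fun _ _ => MonoidalLinear.smul_whiskerRight _ _ _ }
    (id_whiskerRight V W) fun f g => comp_whiskerRight (C := C) g f W

variable (k) in
/-- Whiskering endomorphisms on the left. -/
def whiskerLeftEnd (V W : C) : End W →ₐ[k] End (V ⊗ W) :=
  AlgHom.ofLinearMap
    { toFun := fun f => MonoidalCategoryStruct.whiskerLeft (C := C) V f
      map_add' := fun _ _ => MonoidalPreadditive.whiskerLeft_add _ _
      map_smul' := fun _ _ => MonoidalLinear.whiskerLeft_smul _ _ _ }
    (whiskerLeft_id V W) fun f g => whiskerLeft_comp (C := C) V g f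

theorem commute_whiskerEnd {V W : C} (ρ : A →ₐ[k] End V) (σ : B →ₐ[k] End W) (a : A) (b : B) :
    Commute (((whiskerRightEnd k V W).comp ρ) a) (((whiskerLeftEnd k V W).comp σ) b) :=
  whisker_exchange (ρ a) (σ b)

/-- The action of `A ⊗ B` on `V ⊗ W` given by actions of `A` on `V` and of `B` on `W`. -/
def tensEnd {V W : C} (ρ : A →ₐ[k] End V) (σ : B →ₐ[k] End W) : A ⊗[k] B →ₐ[k] End (V ⊗ W) :=
  Algebra.TensorProduct.lift ((whiskerRightEnd k V W).comp ρ) ((whiskerLeftEnd k V W).comp σ)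
    (commute_whiskerEnd ρ σ)

theorem tensEnd_tmul {V W : C} (ρ : A →ₐ[k] End V) (σ : B →ₐ[k] End W) (a : A) (b : B) :
    tensEnd ρ σ (a ⊗ₜ b) = (ρ a ⊗ₘ σ b) := by
  rw [tensEnd, Algebra.TensorProduct.lift_tmul]
  exact (tensorHom_def' (ρ a) (σ b)).symm

theorem tensEnd_natural {V W V' W' : C} {ρ : A →ₐ[k] End V} {σ : B →ₐ[k] End W}
    {ρ' : A →ₐ[k] End V'} {σ' : B →ₐ[k] End W'} (f : V ⟶ V') (g : W ⟶ W')
    (hf : ∀ a, ρ a ≫ f = f ≫ ρ' a) (hg : ∀ b, σ b ≫ g = g ≫ σ' b) (t : A ⊗[k] B) :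
    tensEnd ρ σ t ≫ (f ⊗ₘ g) = (f ⊗ₘ g) ≫ tensEnd ρ' σ' t := by
  induction t with
  | zero =>
    rw [map_zero, map_zero]
    exact Limits.zero_comp.trans Limits.comp_zero.symm
  | add x y hx hy =>
    rw [map_add, map_add]
    exact (Preadditive.add_comp ..).trans ((congrArg₂ (· + ·) hx hy).trans
      (Preadditive.comp_add ..).symm)
  | tmul a b =>
    rw [tensEnd_tmul, tensEnd_tmul]
    simp only [tensorHom_comp_tensorHom, hf, hg]

theorem tensEnd_map {A' B' : Type*} [Ring A'] [Algebra k A'] [Ring B'] [Algebra k B'] {V W : C}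
    (ρ : A →ₐ[k] End V) (σ : B →ₐ[k] End W) (f : A' →ₐ[k] A) (g : B' →ₐ[k] B) (t : A' ⊗[k] B') :
    tensEnd ρ σ (Algebra.TensorProduct.map f g t) = tensEnd (ρ.comp f) (σ.comp g) t := by
  induction t with
  | zero => simp only [map_zero]
  | add x y hx hy => simp only [map_add, hx, hy]
  | tmul a b => rw [Algebra.TensorProduct.map_tmul, tensEnd_tmul, tensEnd_tmul]; rfl

theorem tensEnd_assoc {V W U : C} (ρ : A →ₐ[k] End V) (σ : B →ₐ[k] End W) (τ : D →ₐ[k] End U)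
    (t : (A ⊗[k] B) ⊗[k] D) :
    tensEnd (tensEnd ρ σ) τ t ≫ (α_ V W U).hom =
      (α_ V W U).hom ≫ tensEnd ρ (tensEnd σ τ) (TensorProduct.assoc k A B D t) := by
  induction t with
  | zero =>
    simp only [map_zero]
    exact Limits.zero_comp.trans Limits.comp_zero.symm
  | add x y hx hy =>
    simp only [map_add]
    exact (Preadditive.add_comp ..).trans ((congrArg₂ (· + ·) hx hy).trans
      (Preadditive.comp_add ..).symm)
  | tmul x d =>
    induction x with
    | zero =>
      simp only [TensorProduct.zero_tmul, map_zero]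
      exact Limits.zero_comp.trans Limits.comp_zero.symm
    | add x y hx hy =>
      simp only [TensorProduct.add_tmul, map_add]
      exact (Preadditive.add_comp ..).trans ((congrArg₂ (· + ·) hx hy).trans
        (Preadditive.comp_add ..).symm)
    | tmul a b =>
      simp only [TensorProduct.assoc_tmul, tensEnd_tmul]
      exact associator_naturality _ _ _

end TensEnd

/-! ### Finite-dimensional vector spaces -/

namespace FGModuleCat

variable {k : Type u} [Field k]

/-- Categorical endomorphisms of a vector space are linear endomorphisms. -/
def endEquiv (V : FGModuleCat.{u} k) : End V ≃ₐ[k] Module.End k V where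
  toFun f := f.hom.hom
  invFun f := FGModuleCat.ofHom f
  left_inv _ := rfl
  right_inv _ := rfl
  map_mul' _ _ := rfl
  map_add' _ _ := rfl
  commutes' _ := rfl

theorem endEquiv_tensEnd {A B : Type*} [Ring A] [Algebra k A] [Ring B] [Algebra k B]
    {V W : FGModuleCat.{u} k} (ρ : A →ₐ[k] End V) (σ : B →ₐ[k] End W) (t : A ⊗[k] B) :
    endEquiv (V ⊗ W) (tensEnd ρ σ t) = homTensorHomEquiv k V W V W
      (TensorProduct.map (((endEquiv V).toAlgHom.comp ρ).toLinearMap)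
        (((endEquiv W).toAlgHom.comp σ).toLinearMap) t) := by
  induction t with
  | zero => simp only [map_zero]
  | add x y hx hy => simp only [map_add, hx, hy]
  | tmul a b =>
    rw [tensEnd_tmul, TensorProduct.map_tmul, homTensorHomEquiv_apply]
    rfl

theorem tensEnd_injective {A B : Type*} [Ring A] [Algebra k A] [Ring B] [Algebra k B]
    {V W : FGModuleCat.{u} k} {ρ : A →ₐ[k] End V} {σ : B →ₐ[k] End W}
    (hρ : Function.Injective ρ) (hσ : Function.Injective σ) :
    Function.Injective (tensEnd ρ σ) := by
  intro x y h
  have h' := congrArg (endEquiv (V ⊗ W)) h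
  rw [endEquiv_tensEnd, endEquiv_tensEnd] at h'
  exact TensorProduct.map_injective_of_flat_flat _ _
    ((endEquiv V).injective.comp hρ) ((endEquiv W).injective.comp hσ)
    ((homTensorHomEquiv k V W V W).injective h')

theorem exists_tensEnd_eq {V W : FGModuleCat.{u} k} (θ : End (V ⊗ W)) :
    ∃ t : End V ⊗[k] End W, tensEnd (AlgHom.id k _) (AlgHom.id k _) t = θ := by
  refine ⟨TensorProduct.map (endEquiv V).symm.toLinearMap (endEquiv W).symm.toLinearMap
    ((homTensorHomEquiv k V W V W).symm (endEquiv (V ⊗ W) θ)), (endEquiv _).injective ?_⟩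
  rw [endEquiv_tensEnd, ← LinearMap.comp_apply, ← TensorProduct.map_comp]
  erw [TensorProduct.map_id]
  exact (homTensorHomEquiv k V W V W).apply_symm_apply _

theorem end_unit_eq_smul (f : 𝟙_ (FGModuleCat.{u} k) ⟶ 𝟙_ (FGModuleCat.{u} k)) :
    ∃ r : k, f = r • 𝟙 _ := by
  refine ⟨f.hom.hom (1 : k), FGModuleCat.hom_ext ?_⟩
  refine LinearMap.ext_ring (R := k) (M₃ := k) ?_
  exact (mul_one (M := k) _).symm

end FGModuleCat

/-! ### Decompositions into simple objects -/

/-- A decomposition of `c` as a finite direct sum of members of the family `s`. -/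
structure Decomposition {C : Type*} [Category C] [Preadditive C] {ι : Type*}
    (s : ι → C) (c : C) where
  n : ℕ
  φ : Fin n → ι
  p : ∀ t, c ⟶ s (φ t)
  i : ∀ t, s (φ t) ⟶ c
  i_p : ∀ t, i t ≫ p t = 𝟙 (s (φ t))
  i_p_ne : ∀ t u, t ≠ u → i t ≫ p u = 0
  total : ∑ t, p t ≫ i t = 𝟙 c

namespace Decomposition

variable {C : Type*} [Category C] [Preadditive C] {ι : Type*} {s : ι → C}

/-- The decomposition given by a biproduct. -/
def ofBicone {n : ℕ} (φ : Fin n → ι) {f : Fin n → C} (e : ∀ t, f t ≅ s (φ t))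
    (b : Limits.Bicone f) (hb : b.IsBilimit) : Decomposition s b.pt where
  n := n
  φ := φ
  p t := b.π t ≫ (e t).hom
  i t := (e t).inv ≫ b.ι t
  i_p t := by simp
  i_p_ne t u h := by simp [Limits.bicone_ι_π_ne_assoc b h]
  total := by simpa using Limits.IsBilimit.total hb

/-- Transport of a decomposition along an isomorphism. -/
def ofIso {c d : C} (D : Decomposition s c) (e : c ≅ d) : Decomposition s d where
  n := D.n
  φ := D.φ
  p t := e.inv ≫ D.p t
  i t := D.i t ≫ e.hom
  i_p t := by simp [D.i_p]
  i_p_ne t u h := by simp [D.i_p_ne t u h]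
  total := by
    have := congrArg (fun f => e.inv ≫ f ≫ e.hom) D.total
    simpa [Preadditive.sum_comp, Preadditive.comp_sum] using this

/-- The biproduct given by a decomposition. -/
def bicone {c : C} (D : Decomposition s c) : Limits.Bicone fun t => s (D.φ t) where
  pt := c
  π := D.p
  ι := D.i
  ι_π t u := by
    split_ifs with h
    · subst h
      simp [D.i_p]
    · exact D.i_p_ne t u h

/-- The biproduct given by a decomposition. -/
def isBilimit {c : C} (D : Decomposition s c) : D.bicone.IsBilimit :=
  Limits.isBilimitOfTotal _ D.total

theorem total_map {c : C} (D : Decomposition s c) {E : Type*} [Category E] [Preadditive E]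
    (F : C ⥤ E) [F.Additive] : ∑ t, F.map (D.p t) ≫ F.map (D.i t) = 𝟙 (F.obj c) := by
  simp only [← F.map_comp, ← F.map_sum, D.total, F.map_id]

variable {E : Type*} [Category E] [Preadditive E]

theorem natTrans_ext (h : ∀ c, Nonempty (Decomposition s c)) {F G : C ⥤ E} [F.Additive]
    {α β : F ⟶ G} (hαβ : ∀ i, α.app (s i) = β.app (s i)) : α = β := by
  ext c
  obtain ⟨D⟩ := h c
  rw [← Category.id_comp (α.app c), ← Category.id_comp (β.app c), ← D.total_map F,
    Preadditive.sum_comp, Preadditive.sum_comp]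
  refine Finset.sum_congr rfl fun t _ => ?_
  rw [Category.assoc, Category.assoc, α.naturality, β.naturality, hαβ]

/-- A natural transformation of additive functors given on a generating family. -/
def extendNat (h : ∀ c, Nonempty (Decomposition s c)) (F G : C ⥤ E) [F.Additive] [G.Additive]
    (θ : ∀ i, F.obj (s i) ⟶ G.obj (s i))
    (hθ : ∀ i j (f : s i ⟶ s j), F.map f ≫ θ j = θ i ≫ G.map f) : F ⟶ G where
  app c := ∑ t, F.map ((h c).some.p t) ≫ θ _ ≫ G.map ((h c).some.i t)
  naturality c d f := by
    have h₁ : ∀ t u, F.map ((h c).some.i t ≫ f ≫ (h d).some.p u) ≫ θ _ =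
        θ _ ≫ G.map ((h c).some.i t ≫ f ≫ (h d).some.p u) := fun t u => hθ _ _ _
    calc F.map f ≫ ∑ u, F.map ((h d).some.p u) ≫ θ _ ≫ G.map ((h d).some.i u)
        = (∑ t, F.map ((h c).some.p t) ≫ F.map ((h c).some.i t)) ≫ F.map f ≫
            ∑ u, F.map ((h d).some.p u) ≫ θ _ ≫ G.map ((h d).some.i u) := by
          rw [total_map, Category.id_comp]
      _ = ∑ t, ∑ u, F.map ((h c).some.p t) ≫ (F.map ((h c).some.i t ≫ f ≫ (h d).some.p u) ≫ θ _) ≫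
            G.map ((h d).some.i u) := by
          simp only [Preadditive.sum_comp, Preadditive.comp_sum, Functor.map_comp, Category.assoc]
          exact Finset.sum_comm
      _ = (∑ t, F.map ((h c).some.p t) ≫ θ _ ≫ G.map ((h c).some.i t)) ≫ G.map f ≫
            ∑ u, G.map ((h d).some.p u) ≫ G.map ((h d).some.i u) := by
          simp only [h₁]
          simp only [Preadditive.sum_comp, Preadditive.comp_sum, Functor.map_comp, Category.assoc]
          exact Finset.sum_comm
      _ = _ := by rw [total_map, Category.comp_id]

theorem extendNat_app (h : ∀ c, Nonempty (Decomposition s c)) (F G : C ⥤ E) [F.Additive]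
    [G.Additive] (θ : ∀ i, F.obj (s i) ⟶ G.obj (s i))
    (hθ : ∀ i j (f : s i ⟶ s j), F.map f ≫ θ j = θ i ≫ G.map f) (i : ι) :
    (extendNat h F G θ hθ).app (s i) = θ i := by
  change ∑ t, F.map ((h (s i)).some.p t) ≫ θ _ ≫ G.map ((h (s i)).some.i t) = θ i
  simp only [← hθ]
  refine Eq.trans ?_ (Category.id_comp (θ i))
  rw [← total_map (h (s i)).some F, Preadditive.sum_comp]
  simp only [Category.assoc]

end Decomposition

/-- A family of objects with scalar endomorphisms and no other morphisms between them, such that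
every object is a finite direct sum of members of the family. -/
structure IsSimpleFamily (k : Type u) [Field k] {C : Type*} [Category C] [Preadditive C]
    [Linear k C]
    {ι : Type*} (s : ι → C) : Prop where
  end_scalar : ∀ i (f : s i ⟶ s i), ∃ r : k, f = r • 𝟙 (s i)
  hom_eq_zero : ∀ i j, i ≠ j → ∀ f : s i ⟶ s j, f = 0
  decomp : ∀ c, Nonempty (Decomposition s c)

namespace IsSimpleFamily

variable {k : Type u} [Field k] {C : Type*} [Category C] [Preadditive C] [Linear k C] {ι : Type*}
  {s : ι → C} (h : IsSimpleFamily k s) {E : Type*} [Category E] [Preadditive E] [Linear k E]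

include h

theorem comm (F G : C ⥤ E) [F.Additive] [F.Linear k] [G.Additive] [G.Linear k]
    (θ : ∀ i, F.obj (s i) ⟶ G.obj (s i)) (i j : ι) (f : s i ⟶ s j) :
    F.map f ≫ θ j = θ i ≫ G.map f := by
  by_cases hij : i = j
  · subst hij
    obtain ⟨r, rfl⟩ := h.end_scalar i f
    simp
  · rw [h.hom_eq_zero i j hij f]
    simp

end IsSimpleFamily

/-- Natural endomorphisms of a linear functor are determined freely by their components on a family
of simple objects. -/
def IsSimpleFamily.endEquiv {k : Type u} [Field k] {C : Type*} [Category C] [Preadditive C]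
    [Linear k C] {ι : Type*} {s : ι → C} (h : IsSimpleFamily k s) {E : Type*} [Category E]
    [Preadditive E] [Linear k E] (F : C ⥤ E) [F.Additive] [F.Linear k] :
    (∀ i, End (F.obj (s i))) ≃ₐ[k] End F :=
  AlgEquiv.symm
    { toFun := fun η i => NatTrans.app η (s i)
      invFun := fun θ => Decomposition.extendNat h.decomp F F θ (h.comm F F θ)
      left_inv := fun _ => Decomposition.natTrans_ext h.decomp fun i =>
        Decomposition.extendNat_app h.decomp F F _ _ i
      right_inv := fun _ => funext fun i => Decomposition.extendNat_app h.decomp F F _ _ i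
      map_mul' := fun _ _ => rfl
      map_add' := fun _ _ => rfl
      commutes' := fun _ => rfl }

theorem IsSimpleFamily.endEquiv_app {k : Type u} [Field k] {C : Type*} [Category C] [Preadditive C]
    [Linear k C] {ι : Type*} {s : ι → C} (h : IsSimpleFamily k s) {E : Type*} [Category E]
    [Preadditive E] [Linear k E] (F : C ⥤ E) [F.Additive] [F.Linear k]
    (θ : ∀ i, End (F.obj (s i))) (i : ι) : NatTrans.app (h.endEquiv F θ) (s i) = θ i :=
  Decomposition.extendNat_app h.decomp F F θ (h.comm F F θ) i

section

variable {C : Type w} [Category.{v} C] [Preadditive C]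

/-- Over an algebraically closed field, representatives of the simple objects of a finite semisimple
category form a simple family. -/
theorem IsFiniteSemisimple.exists_simpleFamily {k : Type u} [Field k] [IsAlgClosed k] [Linear k C]
    (h : IsFiniteSemisimple k C) :
    ∃ (n : ℕ) (s : Fin n → C), (∀ i, Simple (s i)) ∧ IsSimpleFamily k s := by
  obtain ⟨a, rfl⟩ := h.abelian
  obtain ⟨m, s₀, hs₀⟩ := h.finite_simples
  have hfin := h.finite_hom
  classical
  let S : Type := {i : Fin m // Simple (s₀ i)}
  let r : Setoid S := ⟨fun i j => Nonempty (s₀ i.1 ≅ s₀ j.1),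
    fun i => ⟨Iso.refl _⟩, fun ⟨e⟩ => ⟨e.symm⟩, fun ⟨e⟩ ⟨e'⟩ => ⟨e ≪≫ e'⟩⟩
  let T := Quotient r
  let e : Fin (Fintype.card T) ≃ T := (Fintype.equivFin T).symm
  let s : Fin (Fintype.card T) → C := fun i => s₀ (e i).out.1
  have hs : ∀ i, Simple (s i) := fun i => (e i).out.2
  have hiso : ∀ X : C, Simple X → ∃ i, Nonempty (X ≅ s i) := by
    intro X hX
    obtain ⟨j, ⟨f⟩⟩ := hs₀ X hX
    have hj : Simple (s₀ j) := Simple.of_iso f.symm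
    let q : T := Quotient.mk r ⟨j, hj⟩
    obtain ⟨g⟩ : Nonempty (s₀ q.out.1 ≅ s₀ j) := Quotient.mk_out (s := r) ⟨j, hj⟩
    refine ⟨e.symm q, ⟨f ≪≫ g.symm ≪≫ eqToIso ?_⟩⟩
    simp only [s, Equiv.apply_symm_apply]
  have hne : ∀ i j, i ≠ j → ∀ f : s i ⟶ s j, f = 0 := by
    intro i j hij f
    by_contra hf
    have := hs i
    have := hs j
    have := isIso_of_hom_simple hf
    refine hij (e.injective ?_)
    rw [← Quotient.out_eq (e i), ← Quotient.out_eq (e j)]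
    exact Quotient.sound ⟨asIso f⟩
  refine ⟨_, s, hs, ⟨fun i f => ?_, hne, fun c => ?_⟩⟩
  · have := hs i
    obtain ⟨r, hr⟩ := endomorphism_simple_eq_smul_id k f
    exact ⟨r, hr.symm⟩
  · obtain ⟨n, f, b, hf, ⟨hb⟩, ⟨g⟩⟩ := h.sum_of_simples c
    choose φ hφ using fun t => hiso (f t) (hf t)
    exact ⟨(Decomposition.ofBicone φ (fun t => (hφ t).some) b hb).ofIso g⟩

end

/-! ### The action of the endomorphism algebra of a functor -/

section Ev

variable {k : Type u} [Field k] {C : Type*} [Category C] {F : C ⥤ FGModuleCat.{u} k}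
  {A : Type*} [Ring A] [Algebra k A]

/-- The action of the endomorphisms of `F` on `F c`. -/
def ev (e : A ≃ₐ[k] End F) (c : C) : A →ₐ[k] End (F.obj c) where
  toFun a := NatTrans.app (e a) c
  map_one' := by rw [map_one]; rfl
  map_mul' a b := by rw [map_mul]; rfl
  map_zero' := by rw [map_zero]; rfl
  map_add' a b := by rw [map_add]; rfl
  commutes' r := by rw [AlgEquiv.commutes]; rfl

theorem ev_apply (e : A ≃ₐ[k] End F) (c : C) (a : A) : ev e c a = NatTrans.app (e a) c := rfl

theorem ev_natural (e : A ≃ₐ[k] End F) {c d : C} (f : c ⟶ d) (a : A) :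
    ev e c a ≫ F.map f = F.map f ≫ ev e d a :=
  ((e a).naturality f).symm

theorem ev_ext (e : A ≃ₐ[k] End F) {a b : A} (h : ∀ c, ev e c a = ev e c b) : a = b :=
  e.injective (NatTrans.ext (funext h))

theorem ev_symm (e : A ≃ₐ[k] End F) (η : F ⟶ F) (c : C) : ev e c (e.symm η) = η.app c := by
  rw [ev_apply]
  exact congrArg (fun η => NatTrans.app η c) (e.apply_symm_apply η)

variable {D : Type*} [Category D] {G : D ⥤ FGModuleCat.{u} k} {B : Type*} [Ring B] [Algebra k B]

theorem tensEnd_ev_natural (e : A ≃ₐ[k] End F) (e' : B ≃ₐ[k] End G) {c c' : C} {d d' : D}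
    (f : c ⟶ c') (g : d ⟶ d') (t : A ⊗[k] B) :
    tensEnd (ev e c) (ev e' d) t ≫ (F.map f ⊗ₘ G.map g) =
      (F.map f ⊗ₘ G.map g) ≫ tensEnd (ev e c') (ev e' d') t :=
  tensEnd_natural _ _ (ev_natural e f) (ev_natural e' g) t

section

variable [Preadditive C] [F.Additive] {ι : Type*} {s : ι → C} [Preadditive D] [G.Additive]
  {κ : Type*} {s' : κ → D}

theorem exists_injective_ev [Finite ι] [Limits.HasFiniteBiproducts C]
    (hs : ∀ c, Nonempty (Decomposition s c)) (e : A ≃ₐ[k] End F) :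
    ∃ g, Function.Injective (ev e g) := by
  refine ⟨⨁ s, fun a b h => e.injective (Decomposition.natTrans_ext hs fun i => ?_)⟩
  have h' : ∀ a, NatTrans.app (e a) (s i) =
      F.map (Limits.biproduct.ι s i) ≫ ev e (⨁ s) a ≫ F.map (Limits.biproduct.π s i) := fun a => by
    rw [ev_natural, ← F.map_comp_assoc, Limits.biproduct.ι_π_self, F.map_id, Category.id_comp]
    rfl
  rw [h', h', h]

theorem binatural_ext (hs : ∀ c, Nonempty (Decomposition s c))
    (hs' : ∀ d, Nonempty (Decomposition s' d)) {θ θ' : ∀ c d, F.obj c ⊗ G.obj d ⟶ F.obj c ⊗ G.obj d}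
    (hθ : ∀ {c c' d d'} (f : c ⟶ c') (g : d ⟶ d'),
      θ c d ≫ (F.map f ⊗ₘ G.map g) = (F.map f ⊗ₘ G.map g) ≫ θ c' d')
    (hθ' : ∀ {c c' d d'} (f : c ⟶ c') (g : d ⟶ d'),
      θ' c d ≫ (F.map f ⊗ₘ G.map g) = (F.map f ⊗ₘ G.map g) ≫ θ' c' d')
    (h : ∀ i j, θ (s i) (s' j) = θ' (s i) (s' j)) (c : C) (d : D) : θ c d = θ' c d := by
  have h₁ : ∀ c j, θ c (s' j) = θ' c (s' j) := fun c j => by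
    let α : F ⋙ tensorRight (G.obj (s' j)) ⟶ F ⋙ tensorRight (G.obj (s' j)) :=
      { app := fun c => θ c (s' j)
        naturality := fun c d f => by
          have := hθ f (𝟙 (s' j))
          simp only [CategoryTheory.Functor.map_id, tensorHom_id] at this
          exact this.symm }
    let β : F ⋙ tensorRight (G.obj (s' j)) ⟶ F ⋙ tensorRight (G.obj (s' j)) :=
      { app := fun c => θ' c (s' j)
        naturality := fun c d f => by
          have := hθ' f (𝟙 (s' j))
          simp only [CategoryTheory.Functor.map_id, tensorHom_id] at this
          exact this.symm }
    have : α = β := Decomposition.natTrans_ext hs fun i => h i j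
    exact NatTrans.congr_app this c
  let α : G ⋙ tensorLeft (F.obj c) ⟶ G ⋙ tensorLeft (F.obj c) :=
    { app := fun d => θ c d
      naturality := fun d d' f => by
        have := hθ (𝟙 c) f
        simp only [CategoryTheory.Functor.map_id, id_tensorHom] at this
        exact this.symm }
  let β : G ⋙ tensorLeft (F.obj c) ⟶ G ⋙ tensorLeft (F.obj c) :=
    { app := fun d => θ' c d
      naturality := fun d d' f => by
        have := hθ' (𝟙 c) f
        simp only [CategoryTheory.Functor.map_id, id_tensorHom] at this
        exact this.symm }
  have : α = β := Decomposition.natTrans_ext hs' fun j => h₁ c j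
  exact NatTrans.congr_app this d

variable [Linear k C] [Linear k D] [F.Linear k] [G.Linear k]

/-- The element of the endomorphism algebra concentrated at one simple object. -/
theorem IsSimpleFamily.exists_single (h : IsSimpleFamily k s) (e : A ≃ₐ[k] End F) (i : ι) :
    ∃ φ : End (F.obj (s i)) →ₗ[k] A, (∀ f, ev e (s i) (φ f) = f) ∧
      ∀ j, j ≠ i → ∀ f, ev e (s j) (φ f) = 0 := by
  classical
  refine ⟨e.symm.toLinearMap ∘ₗ (h.endEquiv F).toLinearMap ∘ₗ
    LinearMap.single k (fun i => End (F.obj (s i))) i, fun f => ?_, fun j hj f => ?_⟩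
  · refine (ev_symm e _ _).trans ((h.endEquiv_app F _ i).trans ?_)
    exact Pi.single_eq_same (M := fun i => End (F.obj (s i))) i f
  · refine (ev_symm e _ _).trans ((h.endEquiv_app F _ j).trans ?_)
    exact Pi.single_eq_of_ne (M := fun i => End (F.obj (s i))) hj f

theorem exists_tensEnd_ev_simples [Finite ι] [Finite κ] (h : IsSimpleFamily k s)
    (h' : IsSimpleFamily k s') (e : A ≃ₐ[k] End F) (e' : B ≃ₐ[k] End G)
    (θ : ∀ i j, F.obj (s i) ⊗ G.obj (s' j) ⟶ F.obj (s i) ⊗ G.obj (s' j)) :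
    ∃ t : A ⊗[k] B, ∀ i j, tensEnd (ev e (s i)) (ev e' (s' j)) t = θ i j := by
  classical
  have := Fintype.ofFinite ι
  have := Fintype.ofFinite κ
  choose φ hφ hφ' using h.exists_single e
  choose ψ hψ hψ' using h'.exists_single e'
  choose t ht using fun i j => FGModuleCat.exists_tensEnd_eq (θ i j)
  have key : ∀ i j i' j' (t : End (F.obj (s i)) ⊗[k] End (G.obj (s' j))),
      (i ≠ i' ∨ j ≠ j') → tensEnd (ev e (s i')) (ev e' (s' j'))
        (TensorProduct.map (φ i) (ψ j) t) = 0 := by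
    intro i j i' j' t hij
    induction t with
    | zero => simp only [map_zero]
    | add x y hx hy => simp only [map_add, hx, hy, add_zero]
    | tmul a b =>
      rw [TensorProduct.map_tmul, tensEnd_tmul]
      rcases hij with hij | hij
      · rw [hφ' i i' (Ne.symm hij)]
        exact MonoidalPreadditive.zero_tensor _
      · rw [hψ' j j' (Ne.symm hij)]
        exact MonoidalPreadditive.tensor_zero _
  have key' : ∀ i j (t : End (F.obj (s i)) ⊗[k] End (G.obj (s' j))),
      tensEnd (ev e (s i)) (ev e' (s' j)) (TensorProduct.map (φ i) (ψ j) t) =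
        tensEnd (AlgHom.id k _) (AlgHom.id k _) t := by
    intro i j t
    induction t with
    | zero => simp only [map_zero]
    | add x y hx hy => simp only [map_add, hx, hy]
    | tmul a b => rw [TensorProduct.map_tmul, tensEnd_tmul, tensEnd_tmul, hφ, hψ]; rfl
  refine ⟨∑ i, ∑ j, TensorProduct.map (φ i) (ψ j) (t i j), fun i j => ?_⟩
  rw [map_sum, Finset.sum_eq_single i, map_sum, Finset.sum_eq_single j, key', ht]
  · exact fun j' _ hj' => key _ _ _ _ _ (Or.inr hj')
  · simp
  · exact fun i' _ hi' => (map_sum _ _ _).trans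
      (Finset.sum_eq_zero fun j' _ => key _ _ _ _ _ (Or.inl hi'))
  · simp

theorem exists_tensEnd_ev_eq [Finite ι] [Finite κ] (h : IsSimpleFamily k s)
    (h' : IsSimpleFamily k s') (e : A ≃ₐ[k] End F) (e' : B ≃ₐ[k] End G)
    (θ : ∀ c d, F.obj c ⊗ G.obj d ⟶ F.obj c ⊗ G.obj d)
    (hθ : ∀ {c c' d d'} (f : c ⟶ c') (g : d ⟶ d'),
      θ c d ≫ (F.map f ⊗ₘ G.map g) = (F.map f ⊗ₘ G.map g) ≫ θ c' d') :
    ∃ t : A ⊗[k] B, ∀ c d, tensEnd (ev e c) (ev e' d) t = θ c d := by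
  obtain ⟨t, ht⟩ := exists_tensEnd_ev_simples h h' e e' fun i j => θ (s i) (s' j)
  exact ⟨t, binatural_ext (θ := fun c d => tensEnd (ev e c) (ev e' d) t) h.decomp h'.decomp
    (fun f g => tensEnd_ev_natural e e' f g t) hθ ht⟩

end

end Ev

/-! ### The endomorphism algebra of a fiber functor -/

theorem IsFiniteSemisimple.hasFiniteBiproducts {k : Type u} [Field k] {C : Type w} [Category.{v} C]
    [Preadditive C] [Linear k C] (h : IsFiniteSemisimple k C) : Limits.HasFiniteBiproducts C := by
  obtain ⟨a, rfl⟩ := h.abelian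
  exact Abelian.hasFiniteBiproducts

namespace FusFib

variable {k : Type u} [Field k]

instance (X : FusFib k) : X.obj.F.Faithful := X.property.2

variable [IsAlgClosed k]

theorem exists_simples (X : FusFib k) :
    ∃ (n : ℕ) (s : Fin n → X.Cat), (∀ i, Simple (s i)) ∧ IsSimpleFamily k s :=
  X.property.1.semisimple.exists_simpleFamily

/-- The number of simple objects. -/
def rank (X : FusFib k) : ℕ := X.exists_simples.choose

/-- Representatives of the simple objects. -/
def simples (X : FusFib k) : Fin X.rank → X.Cat := X.exists_simples.choose_spec.choose

theorem simple_simples (X : FusFib k) (i : Fin X.rank) : Simple (X.simples i) :=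
  X.exists_simples.choose_spec.choose_spec.1 i

theorem isSimpleFamily (X : FusFib k) : IsSimpleFamily k X.simples :=
  X.exists_simples.choose_spec.choose_spec.2

section

variable {A : Type*} [Ring A] [Algebra k A]

theorem exists_injective (X : FusFib k) (e : A ≃ₐ[k] End X.fib) :
    ∃ g, Function.Injective (ev e g) :=
  have := X.property.1.semisimple.hasFiniteBiproducts
  exists_injective_ev X.isSimpleFamily.decomp e

theorem exists_tensEnd_eq (X Y : FusFib k) {B : Type*} [Ring B] [Algebra k B]
    (e : A ≃ₐ[k] End X.fib) (e' : B ≃ₐ[k] End Y.fib)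
    (θ : ∀ c d, X.fib.obj c ⊗ Y.fib.obj d ⟶ X.fib.obj c ⊗ Y.fib.obj d)
    (hθ : ∀ {c c' d d'} (f : c ⟶ c') (g : d ⟶ d'),
      θ c d ≫ (X.fib.map f ⊗ₘ Y.fib.map g) = (X.fib.map f ⊗ₘ Y.fib.map g) ≫ θ c' d') :
    ∃ t : A ⊗[k] B, ∀ c d, tensEnd (ev e c) (ev e' d) t = θ c d :=
  exists_tensEnd_ev_eq X.isSimpleFamily Y.isSimpleFamily e e' θ hθ

end

/-- A small model of the algebra of natural endomorphisms of the fiber functor. -/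
def EndAlg (X : FusFib k) : Type u := ∀ i, End (X.fib.obj (X.simples i))

instance (X : FusFib k) : Ring X.EndAlg :=
  inferInstanceAs (Ring (∀ i, End (X.fib.obj (X.simples i))))

instance (X : FusFib k) : Algebra k X.EndAlg :=
  inferInstanceAs (Algebra k (∀ i, End (X.fib.obj (X.simples i))))

instance (X : FusFib k) : Module.Finite k X.EndAlg :=
  inferInstanceAs (Module.Finite k (∀ i, X.fib.obj (X.simples i) ⟶ X.fib.obj (X.simples i)))

instance (X : FusFib k) : IsSemisimpleRing X.EndAlg :=
  have : ∀ i, IsSemisimpleRing (End (X.fib.obj (X.simples i))) := fun i =>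
    have := IsSemisimpleRing.moduleEnd k (X.fib.obj (X.simples i))
    (FGModuleCat.endEquiv (X.fib.obj (X.simples i))).symm.toRingEquiv.isSemisimpleRing
  inferInstanceAs (IsSemisimpleRing (∀ i, End (X.fib.obj (X.simples i))))

/-- The identification of the small model with the algebra of natural endomorphisms. -/
def endAlgEquiv (X : FusFib k) : X.EndAlg ≃ₐ[k] End X.fib := X.isSimpleFamily.endEquiv X.fib

end FusFib

/-! ### Exact pairings -/

section ExactPairing

variable {C : Type*} [Category C] [MonoidalCategory C]

theorem CategoryTheory.ExactPairing.exists_mate (V W : C) [ExactPairing V W] (g : W ⟶ W) :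
    ∃ s : V ⟶ V, W ◁ s ≫ ε_ V W = g ▷ V ≫ ε_ V W ∧ η_ V W ≫ s ▷ W = η_ V W ≫ V ◁ g :=
  letI : HasLeftDual W := ⟨V⟩
  ⟨leftAdjointMate g, leftAdjointMate_comp_evaluation g, coevaluation_comp_leftAdjointMate g⟩

theorem CategoryTheory.ExactPairing.exists_dual {V W V' W' : C} [ExactPairing V W]
    [ExactPairing V' W']
    (f : V ⟶ V') : ∃ g : W' ⟶ W, g ▷ V ≫ ε_ V W = W' ◁ f ≫ ε_ V' W' :=
  letI : HasRightDual V := ⟨W⟩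
  letI : HasRightDual V' := ⟨W'⟩
  ⟨rightAdjointMate f, rightAdjointMate_comp_evaluation f⟩

theorem CategoryTheory.ExactPairing.whiskerLeft_evaluation_injective {V W Z : C} [ExactPairing V W]
    {f g : Z ⟶ V}
    (h : W ◁ f ≫ ε_ V W = W ◁ g ≫ ε_ V W) : f = g := by
  have key : ∀ f : Z ⟶ V, f = (λ_ Z).inv ≫ η_ V W ▷ Z ≫ (α_ V W Z).hom ≫
      V ◁ (W ◁ f ≫ ε_ V W) ≫ (ρ_ V).hom := fun f => by
    have := evaluation_coevaluation V W
    calc f = (λ_ Z).inv ≫ (𝟙_ C ◁ f) ≫ (η_ V W ▷ V ≫ (α_ V W V).hom ≫ V ◁ ε_ V W) ≫ (ρ_ V).hom := by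
          rw [this]; simp
      _ = _ := by
          simp only [MonoidalCategory.whiskerLeft_comp, Category.assoc]
          rw [whisker_exchange_assoc]
          simp
  rw [key f, key g, h]

theorem CategoryTheory.ExactPairing.coevaluation_whiskerRight_injective {V W Z : C}
    [ExactPairing V W]
    {f g : V ⟶ Z} (h : η_ V W ≫ f ▷ W = η_ V W ≫ g ▷ W) : f = g := by
  have key : ∀ f : V ⟶ Z, f = (λ_ V).inv ≫ (η_ V W ≫ f ▷ W) ▷ V ≫ (α_ Z W V).hom ≫
      Z ◁ ε_ V W ≫ (ρ_ Z).hom := fun f => by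
    have := evaluation_coevaluation V W
    calc f = (λ_ V).inv ≫ (η_ V W ▷ V ≫ (α_ V W V).hom ≫ V ◁ ε_ V W) ≫ (f ▷ 𝟙_ C) ≫ (ρ_ Z).hom := by
          rw [this]; simp
      _ = _ := by
          simp only [Category.assoc, comp_whiskerRight, associator_naturality_left_assoc,
            whisker_exchange_assoc]
  rw [key f, key g, h]

/-- A monoidal functor preserves exact pairings. -/
@[reducible]
def CategoryTheory.ExactPairing.map {D : Type*} [Category D] [MonoidalCategory D]
    (F : C ⥤ D) [F.Monoidal]
    (V W : C) [ExactPairing V W] : ExactPairing (F.obj V) (F.obj W) where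
  coevaluation' := ε F ≫ F.map (η_ V W) ≫ Functor.OplaxMonoidal.δ F _ _
  evaluation' := μ F _ _ ≫ F.map (ε_ V W) ≫ Functor.OplaxMonoidal.η F
  coevaluation_evaluation' := by
    have h := congrArg F.map (coevaluation_evaluation V W)
    simp only [Functor.map_comp, Functor.Monoidal.map_whiskerLeft,
      Functor.Monoidal.map_whiskerRight, Functor.Monoidal.map_associator_inv,
      Functor.Monoidal.map_rightUnitor, Functor.Monoidal.map_leftUnitor_inv, Category.assoc,
      Functor.Monoidal.μ_δ_assoc] at h
    have h' := congrArg (fun f => F.obj W ◁ ε F ≫ μ F _ _ ≫ f ≫ Functor.OplaxMonoidal.δ F _ _ ≫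
      Functor.OplaxMonoidal.η F ▷ F.obj W) h
    simp only [Functor.Monoidal.μ_δ_assoc, Category.assoc, Functor.Monoidal.whiskerLeft_ε_η_assoc,
      Functor.Monoidal.whiskerRight_ε_η, Category.comp_id] at h'
    simp only [Category.assoc, MonoidalCategory.whiskerLeft_comp, comp_whiskerRight]
    exact h'
  evaluation_coevaluation' := by
    have h := congrArg F.map (evaluation_coevaluation V W)
    simp only [Functor.map_comp, Functor.Monoidal.map_whiskerLeft,
      Functor.Monoidal.map_whiskerRight, Functor.Monoidal.map_associator,
      Functor.Monoidal.map_leftUnitor, Functor.Monoidal.map_rightUnitor_inv, Category.assoc,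
      Functor.Monoidal.μ_δ_assoc] at h
    have h' := congrArg (fun f => ε F ▷ F.obj V ≫ μ F _ _ ≫ f ≫ Functor.OplaxMonoidal.δ F _ _ ≫
      F.obj V ◁ Functor.OplaxMonoidal.η F) h
    simp only [Functor.Monoidal.μ_δ_assoc, Category.assoc, Functor.Monoidal.whiskerRight_ε_η_assoc,
      Functor.Monoidal.whiskerLeft_ε_η, Category.comp_id] at h'
    simp only [Category.assoc, MonoidalCategory.whiskerLeft_comp, comp_whiskerRight]
    exact h'

end ExactPairing

theorem AlgHom.exists_factor {k A B E : Type*} [CommRing k] [Ring A] [Algebra k A] [Ring B]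
    [Algebra k B] [Ring E] [Algebra k E] {j : B →ₐ[k] E} (hj : Function.Injective j) (m : A →ₐ[k] E)
    (h : ∀ a, ∃ b, j b = m a) : ∃ f : A →ₐ[k] B, ∀ a, j (f a) = m a :=
  ⟨(AlgEquiv.ofInjective j hj).symm.toAlgHom.comp (m.codRestrict j.range h), fun a =>
    congrArg Subtype.val ((AlgEquiv.ofInjective j hj).apply_symm_apply ⟨m a, h a⟩)⟩

/-- Conjugation of endomorphisms by an isomorphism. -/
def conjEnd (k : Type*) [CommRing k] {C : Type*} [Category C] [Preadditive C] [Linear k C] {V W : C}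
    (i : V ≅ W) : End V →ₐ[k] End W where
  toFun f := i.inv ≫ f ≫ i.hom
  map_one' := by
    change i.inv ≫ 𝟙 V ≫ i.hom = 𝟙 W
    simp
  map_mul' f g := by
    change i.inv ≫ (g ≫ f) ≫ i.hom = (i.inv ≫ g ≫ i.hom) ≫ i.inv ≫ f ≫ i.hom
    simp
  map_zero' := by simp
  map_add' f g := (congrArg (i.inv ≫ ·) (Preadditive.add_comp _ _ _ f g i.hom)).trans
    (Preadditive.comp_add ..)
  commutes' r := by
    change i.inv ≫ (r • 𝟙 V) ≫ i.hom = r • 𝟙 W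
    simp

/-! ### The Hopf algebra structure -/

namespace FusFib

variable {k : Type u} [Field k] (X : FusFib k)
  {A : Type*} [Ring A] [Algebra k A] (e : A ≃ₐ[k] End X.fib)

instance (c d : X.Cat) [ExactPairing c d] : ExactPairing (X.fib.obj c) (X.fib.obj d) :=
  ExactPairing.map X.fib c d

theorem evaluation_fib (c d : X.Cat) [ExactPairing c d] : ε_ (X.fib.obj c) (X.fib.obj d) =
    μ X.fib d c ≫ X.fib.map (ε_ c d) ≫ Functor.OplaxMonoidal.η X.fib := rfl

theorem coevaluation_fib (c d : X.Cat) [ExactPairing c d] : η_ (X.fib.obj c) (X.fib.obj d) =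
    ε X.fib ≫ X.fib.map (η_ c d) ≫ Functor.OplaxMonoidal.δ X.fib c d := rfl

theorem mate_natural {c c' d d' : X.Cat} [ExactPairing c d] [ExactPairing c' d'] (f : c ⟶ c')
    (a : A) {s : X.fib.obj c ⟶ X.fib.obj c} {s' : X.fib.obj c' ⟶ X.fib.obj c'}
    (hs : X.fib.obj d ◁ s ≫ ε_ _ _ = ev e d a ▷ X.fib.obj c ≫ ε_ (X.fib.obj c) (X.fib.obj d))
    (hs' : X.fib.obj d' ◁ s' ≫ ε_ _ _ =
      ev e d' a ▷ X.fib.obj c' ≫ ε_ (X.fib.obj c') (X.fib.obj d')) :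
    s ≫ X.fib.map f = X.fib.map f ≫ s' := by
  obtain ⟨g, hg⟩ := ExactPairing.exists_dual (W := d) (W' := d') f
  have hg' : X.fib.map g ▷ X.fib.obj c ≫ ε_ (X.fib.obj c) (X.fib.obj d) =
      X.fib.obj d' ◁ X.fib.map f ≫ ε_ (X.fib.obj c') (X.fib.obj d') := by
    rw [evaluation_fib, evaluation_fib, μ_natural_left_assoc, μ_natural_right_assoc,
      ← X.fib.map_comp_assoc, ← X.fib.map_comp_assoc, hg]
  refine ExactPairing.whiskerLeft_evaluation_injective (W := X.fib.obj d') ?_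
  rw [MonoidalCategory.whiskerLeft_comp, MonoidalCategory.whiskerLeft_comp, Category.assoc,
    Category.assoc, hs', ← hg', whisker_exchange_assoc, hs, whisker_exchange_assoc, ← hg',
    ← comp_whiskerRight_assoc, ← comp_whiskerRight_assoc, ev_natural]

theorem exists_antipode : ∃ S : A →ₗ[k] A, ∀ (a : A) (c d : X.Cat) [ExactPairing c d],
    X.fib.obj d ◁ ev e c (S a) ≫ ε_ _ _ =
      ev e d a ▷ X.fib.obj c ≫ ε_ (X.fib.obj c) (X.fib.obj d) := by
  have hd : ∀ c : X.Cat, ∃ d, Nonempty (ExactPairing c d) := fun c => by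
    obtain ⟨h⟩ := X.property.1.hasRightDual c
    exact ⟨h.rightDual, ⟨h.exact⟩⟩
  choose d hd using hd
  have inst := fun c => (hd c).some
  choose s hs hs' using fun (a : A) (c : X.Cat) =>
    ExactPairing.exists_mate (X.fib.obj c) (X.fib.obj (d c)) (ev e (d c) a)
  have hn : ∀ a, ∃ b, ∀ c, ev e c b = s a c := fun a =>
    ⟨e.symm
        { app := s a
          naturality := fun c c' f => (X.mate_natural e f a (hs a c) (hs a c')).symm },
      fun c => ev_symm e _ c⟩
  choose S hS using hn
  have hS' : ∀ (a : A) (c d : X.Cat) [ExactPairing c d],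
      X.fib.obj d ◁ ev e c (S a) ≫ ε_ _ _ =
        ev e d a ▷ X.fib.obj c ≫ ε_ (X.fib.obj c) (X.fib.obj d) := by
    intro a c d' _
    obtain ⟨s', h₁, -⟩ := ExactPairing.exists_mate (X.fib.obj c) (X.fib.obj d') (ev e d' a)
    have := X.mate_natural e (𝟙 c) a (hs a c) h₁
    rw [CategoryTheory.Functor.map_id, Category.id_comp, Category.comp_id] at this
    rw [hS, this, h₁]
  refine ⟨{ toFun := S, map_add' := fun a b => ev_ext e fun c => ?_,
            map_smul' := fun r a => ev_ext e fun c => ?_ }, hS'⟩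
  · refine ExactPairing.whiskerLeft_evaluation_injective (W := X.fib.obj (d c)) ?_
    rw [hS', map_add, map_add]
    refine (congrArg (· ≫ _) (MonoidalPreadditive.add_whiskerRight _ _)).trans ?_
    refine Eq.trans ?_ (congrArg (· ≫ _) (MonoidalPreadditive.whiskerLeft_add _ _)).symm
    rw [Preadditive.add_comp, Preadditive.add_comp, hS', hS']
  · refine ExactPairing.whiskerLeft_evaluation_injective (W := X.fib.obj (d c)) ?_
    rw [hS', map_smul, map_smul]
    refine (congrArg (· ≫ _) (MonoidalLinear.smul_whiskerRight _ _ _)).trans ?_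
    refine Eq.trans ?_ (congrArg (· ≫ _) (MonoidalLinear.whiskerLeft_smul _ _ _)).symm
    rw [Linear.smul_comp, Linear.smul_comp, hS']
    rfl

/-- The antipode of the endomorphism algebra. -/
def antipodeMap : A →ₗ[k] A := (X.exists_antipode e).choose

theorem antipodeMap_evaluation (a : A) (c d : X.Cat) [ExactPairing c d] :
    X.fib.obj d ◁ ev e c (X.antipodeMap e a) ≫ ε_ _ _ =
      ev e d a ▷ X.fib.obj c ≫ ε_ (X.fib.obj c) (X.fib.obj d) :=
  (X.exists_antipode e).choose_spec a c d

theorem antipodeMap_coevaluation (a : A) (c d : X.Cat) [ExactPairing c d] :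
    η_ (X.fib.obj c) (X.fib.obj d) ≫ ev e c (X.antipodeMap e a) ▷ X.fib.obj d =
      η_ _ _ ≫ X.fib.obj c ◁ ev e d a := by
  obtain ⟨s, h₁, h₂⟩ := ExactPairing.exists_mate (X.fib.obj c) (X.fib.obj d) (ev e d a)
  have : ev e c (X.antipodeMap e a) = s :=
    ExactPairing.whiskerLeft_evaluation_injective (W := X.fib.obj d)
      ((X.antipodeMap_evaluation e a c d).trans h₁.symm)
  rw [this, h₂]

theorem exists_counit : ∃ φ : A →ₐ[k] k, ∀ a,
    ε X.fib ≫ ev e (𝟙_ X.Cat) a = φ a • ε X.fib := by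
  have : Nontrivial (End (𝟙_ (FGModuleCat.{u} k))) :=
    (FGModuleCat.endEquiv (𝟙_ (FGModuleCat.{u} k))).toEquiv.nontrivial
  obtain ⟨φ, hφ⟩ := AlgHom.exists_factor
    (j := Algebra.ofId k (End (𝟙_ (FGModuleCat.{u} k))))
    (FaithfulSMul.algebraMap_injective k (End (𝟙_ (FGModuleCat.{u} k))))
    ((conjEnd k (Functor.Monoidal.εIso X.fib).symm).comp (ev e (𝟙_ X.Cat)))
    fun a => by
      obtain ⟨r, hr⟩ := FGModuleCat.end_unit_eq_smul
        (ε X.fib ≫ ev e (𝟙_ X.Cat) a ≫ Functor.OplaxMonoidal.η X.fib)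
      exact ⟨r, hr.symm⟩
  refine ⟨φ, fun a => ?_⟩
  have h : φ a • 𝟙 (𝟙_ (FGModuleCat.{u} k)) =
      ε X.fib ≫ ev e (𝟙_ X.Cat) a ≫ Functor.OplaxMonoidal.η X.fib := hφ a
  have h' := congrArg (· ≫ ε X.fib) h
  simpa using h'.symm

/-- The counit of the endomorphism algebra. -/
def counitHom : A →ₐ[k] k := (X.exists_counit e).choose

theorem counitHom_spec (a : A) : ε X.fib ≫ ev e (𝟙_ X.Cat) a = X.counitHom e a • ε X.fib :=
  (X.exists_counit e).choose_spec a

theorem counitHom_spec' (a : A) : ev e (𝟙_ X.Cat) a ≫ Functor.OplaxMonoidal.η X.fib =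
    X.counitHom e a • Functor.OplaxMonoidal.η X.fib := by
  rw [← cancel_epi (ε X.fib), ← Category.assoc, counitHom_spec, Linear.smul_comp, Linear.comp_smul]

variable [IsAlgClosed k]

theorem tensEnd_ext {X Y : FusFib k} {B : Type*} [Ring B] [Algebra k B]
    (e : A ≃ₐ[k] End X.fib) (e' : B ≃ₐ[k] End Y.fib) {t t' : A ⊗[k] B}
    (h : ∀ c d, tensEnd (ev e c) (ev e' d) t = tensEnd (ev e c) (ev e' d) t') : t = t' := by
  obtain ⟨g, hg⟩ := X.exists_injective e
  obtain ⟨g', hg'⟩ := Y.exists_injective e'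
  exact FGModuleCat.tensEnd_injective hg hg' (h g g')

theorem exists_comul : ∃ Δ : A →ₐ[k] A ⊗[k] A, ∀ a c d,
    tensEnd (ev e c) (ev e d) (Δ a) ≫ μ X.fib c d = μ X.fib c d ≫ ev e (c ⊗ d) a := by
  obtain ⟨g, hg⟩ := X.exists_injective e
  have h : ∀ a, ∃ t : A ⊗[k] A, ∀ c d, tensEnd (ev e c) (ev e d) t =
      μ X.fib c d ≫ ev e (c ⊗ d) a ≫ Functor.OplaxMonoidal.δ X.fib c d := fun a =>
    exists_tensEnd_eq X X e e _ fun f g => by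
      simp only [Category.assoc, Functor.OplaxMonoidal.δ_natural]
      rw [Functor.LaxMonoidal.μ_natural_assoc, reassoc_of% ev_natural e (f ⊗ₘ g)]
  choose t ht using h
  obtain ⟨Δ, hΔ⟩ := AlgHom.exists_factor (FGModuleCat.tensEnd_injective hg hg)
    ((conjEnd k (Functor.Monoidal.μIso X.fib g g).symm).comp (ev e (g ⊗ g)))
    fun a => ⟨t a, ht a g g⟩
  refine ⟨Δ, fun a c d => ?_⟩
  have : Δ a = t a := FGModuleCat.tensEnd_injective hg hg ((hΔ a).trans (ht a g g).symm)
  rw [this, ht]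
  simp

/-- The comultiplication of the endomorphism algebra. -/
def comulHom : A →ₐ[k] A ⊗[k] A := (X.exists_comul e).choose

theorem comulHom_spec (a : A) (c d : X.Cat) :
    tensEnd (ev e c) (ev e d) (X.comulHom e a) ≫ μ X.fib c d = μ X.fib c d ≫ ev e (c ⊗ d) a :=
  (X.exists_comul e).choose_spec a c d

theorem tensEnd_comul_assoc (a : A) (c d f : X.Cat) :
    tensEnd (tensEnd (ev e c) (ev e d)) (ev e f)
        (Algebra.TensorProduct.map (X.comulHom e) (AlgHom.id k A) (X.comulHom e a)) ≫
        μ X.fib c d ▷ X.fib.obj f ≫ μ X.fib (c ⊗ d) f =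
      (μ X.fib c d ▷ X.fib.obj f ≫ μ X.fib (c ⊗ d) f) ≫ ev e ((c ⊗ d) ⊗ f) a := by
  rw [tensEnd_map, ← tensorHom_id, ← Category.assoc, tensEnd_natural (ρ' := ev e (c ⊗ d))
    (σ' := ev e f) _ _ (fun a => X.comulHom_spec e a c d) fun _ => ?_, Category.assoc,
    comulHom_spec, Category.assoc]
  exact (Category.comp_id (ev e f _)).trans (Category.id_comp (ev e f _)).symm

theorem tensEnd_comul_assoc' (a : A) (c d f : X.Cat) :
    tensEnd (ev e c) (tensEnd (ev e d) (ev e f))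
        (Algebra.TensorProduct.map (AlgHom.id k A) (X.comulHom e) (X.comulHom e a)) ≫
        X.fib.obj c ◁ μ X.fib d f ≫ μ X.fib c (d ⊗ f) =
      (X.fib.obj c ◁ μ X.fib d f ≫ μ X.fib c (d ⊗ f)) ≫ ev e (c ⊗ d ⊗ f) a := by
  rw [tensEnd_map, ← id_tensorHom, ← Category.assoc, tensEnd_natural (ρ' := ev e c)
    (σ' := ev e (d ⊗ f)) _ _ (fun _ => ?_) fun a => X.comulHom_spec e a d f, Category.assoc,
    comulHom_spec, Category.assoc]
  exact (Category.comp_id (ev e c _)).trans (Category.id_comp (ev e c _)).symm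

theorem comulHom_coassoc : (Algebra.TensorProduct.assoc k k k A A A).toAlgHom.comp
      ((Algebra.TensorProduct.map (X.comulHom e) (.id k A)).comp (X.comulHom e)) =
    (Algebra.TensorProduct.map (.id k A) (X.comulHom e)).comp (X.comulHom e) := by
  ext a
  obtain ⟨g, hg⟩ := X.exists_injective e
  refine FGModuleCat.tensEnd_injective hg (FGModuleCat.tensEnd_injective hg hg) ?_
  have h₁ := tensEnd_assoc (ev e g) (ev e g) (ev e g)
    (Algebra.TensorProduct.map (X.comulHom e) (AlgHom.id k A) (X.comulHom e a))
  have h₂ := X.tensEnd_comul_assoc e a g g g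
  have h₃ := X.tensEnd_comul_assoc' e a g g g
  have h₄ := associativity X.fib g g g
  rw [← cancel_epi (α_ (X.fib.obj g) (X.fib.obj g) (X.fib.obj g)).hom,
    ← cancel_mono (X.fib.obj g ◁ μ X.fib g g ≫ μ X.fib g (g ⊗ g))]
  refine (congrArg (· ≫ _) h₁.symm).trans ?_
  refine Eq.trans ?_ ((Category.assoc _ _ _).trans (congrArg (_ ≫ ·) h₃)).symm
  rw [Category.assoc, ← h₄, ← Category.assoc (α_ _ _ _).hom, ← h₄]
  simp only [Category.assoc] at h₂ ⊢
  rw [reassoc_of% h₂, ev_natural]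

theorem comulHom_counit_left : (Algebra.TensorProduct.map (X.counitHom e) (.id k A)).comp
    (X.comulHom e) = (Algebra.TensorProduct.lid k A).symm := by
  ext a
  obtain ⟨g, hg⟩ := X.exists_injective e
  change Algebra.TensorProduct.map (X.counitHom e) (.id k A) (X.comulHom e a) = 1 ⊗ₜ a
  refine (Algebra.TensorProduct.lid k A).injective (hg ?_)
  have key : ∀ t : A ⊗[k] A, ev e g (Algebra.TensorProduct.lid k A
      (Algebra.TensorProduct.map (X.counitHom e) (.id k A) t)) =
      (λ_ _).inv ≫ ε X.fib ▷ X.fib.obj g ≫ tensEnd (ev e (𝟙_ _)) (ev e g) t ≫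
        Functor.OplaxMonoidal.η X.fib ▷ X.fib.obj g ≫ (λ_ _).hom := fun t => by
    induction t with
    | zero =>
      simp only [map_zero]
      exact (by simp : (0 : X.fib.obj g ⟶ X.fib.obj g) = (λ_ _).inv ≫ ε X.fib ▷ X.fib.obj g ≫ 0 ≫
        Functor.OplaxMonoidal.η X.fib ▷ X.fib.obj g ≫ (λ_ _).hom)
    | add x y hx hy =>
      simp only [map_add, hx, hy]
      exact (by simp : ∀ f g', (λ_ _).inv ≫ ε X.fib ▷ X.fib.obj g ≫ f ≫
          Functor.OplaxMonoidal.η X.fib ▷ X.fib.obj g ≫ (λ_ _).hom + (λ_ _).inv ≫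
          ε X.fib ▷ X.fib.obj g ≫ g' ≫ Functor.OplaxMonoidal.η X.fib ▷ X.fib.obj g ≫ (λ_ _).hom =
        (λ_ _).inv ≫ ε X.fib ▷ X.fib.obj g ≫ (f + g') ≫
          Functor.OplaxMonoidal.η X.fib ▷ X.fib.obj g ≫ (λ_ _).hom) _ _
    | tmul x y =>
      rw [tensEnd_tmul, Algebra.TensorProduct.map_tmul, Algebra.TensorProduct.lid_tmul, map_smul,
        MonoidalCategory.tensorHom_def, Category.assoc, ← comp_whiskerRight_assoc, counitHom_spec,
        MonoidalLinear.smul_whiskerRight, whisker_exchange_assoc]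
      simp only [Linear.smul_comp, Linear.comp_smul, ← comp_whiskerRight_assoc,
        Functor.Monoidal.ε_η, id_whiskerRight, Category.id_comp, leftUnitor_naturality,
        Iso.inv_hom_id_assoc]
      rfl
  rw [key, Algebra.TensorProduct.lid_tmul, one_smul]
  have h₁ := X.comulHom_spec e a (𝟙_ _) g
  have h₂ := left_unitality X.fib g
  have h₃ : Functor.OplaxMonoidal.η X.fib ▷ X.fib.obj g ≫ (λ_ _).hom =
      μ X.fib (𝟙_ _) g ≫ X.fib.map (λ_ g).hom := by
    rw [h₂, ← comp_whiskerRight_assoc]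
    simp
  rw [h₃, reassoc_of% h₁, ev_natural, ← Category.assoc (μ _ _ _), ← Category.assoc (ε _ ▷ _), ← h₂]
  exact (λ_ _).inv_hom_id_assoc _

theorem comulHom_counit_right : (Algebra.TensorProduct.map (.id k A) (X.counitHom e)).comp
    (X.comulHom e) = (Algebra.TensorProduct.rid k k A).symm := by
  ext a
  obtain ⟨g, hg⟩ := X.exists_injective e
  change Algebra.TensorProduct.map (.id k A) (X.counitHom e) (X.comulHom e a) = a ⊗ₜ 1
  refine (Algebra.TensorProduct.rid k k A).injective (hg ?_)
  have key : ∀ t : A ⊗[k] A, ev e g (Algebra.TensorProduct.rid k k A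
      (Algebra.TensorProduct.map (.id k A) (X.counitHom e) t)) =
      (ρ_ _).inv ≫ X.fib.obj g ◁ ε X.fib ≫ tensEnd (ev e g) (ev e (𝟙_ _)) t ≫
        X.fib.obj g ◁ Functor.OplaxMonoidal.η X.fib ≫ (ρ_ _).hom := fun t => by
    induction t with
    | zero =>
      simp only [map_zero]
      exact (by simp : (0 : X.fib.obj g ⟶ X.fib.obj g) = (ρ_ _).inv ≫ X.fib.obj g ◁ ε X.fib ≫ 0 ≫
        X.fib.obj g ◁ Functor.OplaxMonoidal.η X.fib ≫ (ρ_ _).hom)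
    | add x y hx hy =>
      simp only [map_add, hx, hy]
      exact (by simp : ∀ f g', (ρ_ _).inv ≫ X.fib.obj g ◁ ε X.fib ≫ f ≫
          X.fib.obj g ◁ Functor.OplaxMonoidal.η X.fib ≫ (ρ_ _).hom + (ρ_ _).inv ≫
          X.fib.obj g ◁ ε X.fib ≫ g' ≫ X.fib.obj g ◁ Functor.OplaxMonoidal.η X.fib ≫ (ρ_ _).hom =
        (ρ_ _).inv ≫ X.fib.obj g ◁ ε X.fib ≫ (f + g') ≫
          X.fib.obj g ◁ Functor.OplaxMonoidal.η X.fib ≫ (ρ_ _).hom) _ _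
    | tmul x y =>
      rw [tensEnd_tmul, Algebra.TensorProduct.map_tmul, Algebra.TensorProduct.rid_tmul, map_smul,
        MonoidalCategory.tensorHom_def', Category.assoc, ← MonoidalCategory.whiskerLeft_comp_assoc,
        counitHom_spec, MonoidalLinear.whiskerLeft_smul, ← whisker_exchange_assoc]
      simp only [Linear.smul_comp, Linear.comp_smul, ← MonoidalCategory.whiskerLeft_comp_assoc,
        Functor.Monoidal.ε_η, MonoidalCategory.whiskerLeft_id, Category.id_comp,
        rightUnitor_naturality, Iso.inv_hom_id_assoc]
      rfl
  rw [key, Algebra.TensorProduct.rid_tmul, one_smul]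
  have h₁ := X.comulHom_spec e a g (𝟙_ _)
  have h₂ := right_unitality X.fib g
  have h₃ : X.fib.obj g ◁ Functor.OplaxMonoidal.η X.fib ≫ (ρ_ _).hom =
      μ X.fib g (𝟙_ _) ≫ X.fib.map (ρ_ g).hom := by
    rw [h₂, ← MonoidalCategory.whiskerLeft_comp_assoc]
    simp
  rw [h₃, reassoc_of% h₁, ev_natural, ← Category.assoc (μ _ _ _), ← Category.assoc (_ ◁ ε _), ← h₂]
  exact (ρ_ _).inv_hom_id_assoc _

theorem mul_antipodeMap_left (a : A) : LinearMap.mul' k A ((X.antipodeMap e).rTensor A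
    (X.comulHom e a)) = algebraMap k A (X.counitHom e a) := by
  refine ev_ext e fun c => ?_
  obtain ⟨⟨d⟩⟩ := X.property.1.hasRightDual c
  refine ExactPairing.whiskerLeft_evaluation_injective (W := X.fib.obj d) ?_
  have key : ∀ t : A ⊗[k] A, X.fib.obj d ◁ ev e c (LinearMap.mul' k A
      ((X.antipodeMap e).rTensor A t)) ≫ ε_ _ _ =
      tensEnd (ev e d) (ev e c) t ≫ ε_ (X.fib.obj c) (X.fib.obj d) := fun t => by
    induction t with
    | zero =>
      simp only [map_zero]
      exact (by simp : X.fib.obj d ◁ (0 : X.fib.obj c ⟶ X.fib.obj c) ≫ ε_ _ _ =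
        0 ≫ ε_ (X.fib.obj c) (X.fib.obj d))
    | add x y hx hy =>
      simp only [map_add]
      refine Eq.trans (by
        exact (by simp : ∀ f g : X.fib.obj c ⟶ X.fib.obj c, X.fib.obj d ◁ (f + g) ≫ ε_ _ _ =
          X.fib.obj d ◁ f ≫ ε_ _ _ + X.fib.obj d ◁ g ≫ ε_ (X.fib.obj c) (X.fib.obj d)) _ _) ?_
      rw [hx, hy]
      exact (Preadditive.add_comp ..).symm
    | tmul x y =>
      rw [LinearMap.rTensor_tmul, LinearMap.mul'_apply, map_mul, tensEnd_tmul]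
      refine (congrArg (· ≫ _) (MonoidalCategory.whiskerLeft_comp _ _ _)).trans ?_
      rw [Category.assoc, antipodeMap_evaluation, whisker_exchange_assoc,
        MonoidalCategory.tensorHom_def, Category.assoc]
  rw [key, evaluation_fib, ← Category.assoc, comulHom_spec, Category.assoc,
    reassoc_of% ev_natural, AlgHom.commutes]
  rw [counitHom_spec', Algebra.algebraMap_eq_smul_one]
  have h₁ : (1 : End (X.fib.obj c)) = 𝟙 (X.fib.obj c) := rfl
  rw [h₁, MonoidalLinear.whiskerLeft_smul]
  simp

theorem mul_antipodeMap_right (a : A) : LinearMap.mul' k A ((X.antipodeMap e).lTensor A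
    (X.comulHom e a)) = algebraMap k A (X.counitHom e a) := by
  refine ev_ext e fun c => ?_
  obtain ⟨⟨d⟩⟩ := X.property.1.hasRightDual c
  refine ExactPairing.coevaluation_whiskerRight_injective (W := X.fib.obj d) ?_
  have key : ∀ t : A ⊗[k] A, η_ _ _ ≫ ev e c (LinearMap.mul' k A
      ((X.antipodeMap e).lTensor A t)) ▷ X.fib.obj d =
      η_ (X.fib.obj c) (X.fib.obj d) ≫ tensEnd (ev e c) (ev e d) t := fun t => by
    induction t with
    | zero =>
      simp only [map_zero]
      exact (by simp : η_ _ _ ≫ (0 : X.fib.obj c ⟶ X.fib.obj c) ▷ X.fib.obj d =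
        η_ (X.fib.obj c) (X.fib.obj d) ≫ 0)
    | add x y hx hy =>
      simp only [map_add]
      refine Eq.trans (by
        exact (by simp : ∀ f g : X.fib.obj c ⟶ X.fib.obj c, η_ _ _ ≫ (f + g) ▷ X.fib.obj d =
          η_ _ _ ≫ f ▷ X.fib.obj d + η_ (X.fib.obj c) (X.fib.obj d) ≫ g ▷ X.fib.obj d) _ _) ?_
      rw [hx, hy]
      exact (Preadditive.comp_add ..).symm
    | tmul x y =>
      rw [LinearMap.lTensor_tmul, LinearMap.mul'_apply, map_mul, tensEnd_tmul]
      refine (congrArg (_ ≫ ·) (comp_whiskerRight _ _ _)).trans ?_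
      rw [← Category.assoc, antipodeMap_coevaluation, Category.assoc,
        MonoidalCategory.tensorHom_def']
  have h₀ := X.comulHom_spec e a c d
  have h₁ : tensEnd (ev e c) (ev e d) (X.comulHom e a) = μ X.fib c d ≫ ev e (c ⊗ d) a ≫
      Functor.OplaxMonoidal.δ X.fib c d := by
    rw [← reassoc_of% h₀]
    simp
  have h₂ : X.fib.map (η_ c d) ≫ ev e (c ⊗ d) a = ev e _ a ≫ X.fib.map (η_ c d) :=
    (ev_natural e (η_ c d) a).symm
  rw [key, coevaluation_fib, h₁, AlgHom.commutes]
  simp only [Category.assoc, Functor.Monoidal.δ_μ_assoc]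
  rw [reassoc_of% h₂, ← Category.assoc, counitHom_spec, Algebra.algebraMap_eq_smul_one]
  have h₁ : (1 : End (X.fib.obj c)) = 𝟙 (X.fib.obj c) := rfl
  rw [h₁, MonoidalLinear.smul_whiskerRight]
  simp

instance : Bialgebra k X.EndAlg :=
  Bialgebra.ofAlgHom (X.comulHom X.endAlgEquiv) (X.counitHom X.endAlgEquiv)
    (X.comulHom_coassoc _) (X.comulHom_counit_left _) (X.comulHom_counit_right _)

instance : HopfAlgebra k X.EndAlg where
  antipode := X.antipodeMap X.endAlgEquiv
  mul_antipode_rTensor_comul := LinearMap.ext fun a => X.mul_antipodeMap_left _ a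
  mul_antipode_lTensor_comul := LinearMap.ext fun a => X.mul_antipodeMap_right _ a

/-- The Hopf algebra of endomorphisms of the fiber functor. -/
def endHopf : SSHopf k := ⟨HopfAlgCat.of k X.EndAlg,
  inferInstanceAs (Module.Finite k X.EndAlg), inferInstanceAs (IsSemisimpleRing X.EndAlg)⟩

/-- The identification of the Hopf algebra with the natural endomorphisms. -/
def endHopfIso : EndIso X X.endHopf.obj where
  iso := X.endAlgEquiv
  comul a _ s l r h c d := by
    have h₁ := X.comulHom_spec X.endAlgEquiv a c d
    have h₂ : X.comulHom X.endAlgEquiv a = ∑ i ∈ s, l i ⊗ₜ[k] r i := h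
    refine h₁.symm.trans (congrArg (· ≫ _) ((congrArg _ h₂).trans ((map_sum (tensEnd
      (ev X.endAlgEquiv c) (ev X.endAlgEquiv d)) (fun i => (l i : X.EndAlg) ⊗ₜ[k] (r i : X.EndAlg))
      s).trans (Finset.sum_congr rfl fun i _ => ?_))))
    exact tensEnd_tmul _ _ _ _
  counit a := X.counitHom_spec X.endAlgEquiv a
  antipode a c d _ := by
    have := X.antipodeMap_evaluation X.endAlgEquiv a c d
    rw [evaluation_fib] at this
    rw [← cancel_mono (Functor.OplaxMonoidal.η X.fib)]
    simp only [Category.assoc]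
    exact this.symm

end FusFib

/-! ### Bijectivity of the antipode -/

namespace HopfAlgebra

variable {k A : Type*} [Field k] [Ring A] [HopfAlgebra k A]

/-- A linear map which commutes with multiplication by antipodes commutes with multiplication. -/
theorem map_mul_of_map_antipode_mul {p : A →ₗ[k] A}
    (hp : ∀ a x, p (antipode k a * x) = antipode k a * p x) (a x : A) : p (a * x) = a * p x := by
  let L : A ⊗[k] A →ₗ[k] A := p ∘ₗ LinearMap.mulRight k x ∘ₗ LinearMap.mul' k A ∘ₗ
    (antipode k).rTensor A
  let R : A →ₗ[k] A := p ∘ₗ LinearMap.mulRight k x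
  have hL : ∀ b : A, L (Coalgebra.comul b) = Coalgebra.counit (R := k) b • p x := fun b => by
    simp only [L, LinearMap.comp_apply, mul_antipode_rTensor_comul_apply, LinearMap.mulRight_apply]
    rw [Algebra.algebraMap_eq_smul_one, smul_mul_assoc, one_mul, map_smul]
  have h₁ : LinearMap.mul' k A (L.lTensor A ((Coalgebra.comul (R := k) (A := A)).lTensor A
      (Coalgebra.comul a))) = a * p x := by
    rw [← LinearMap.comp_apply (L.lTensor A), ← LinearMap.lTensor_comp]
    have : L ∘ₗ Coalgebra.comul = (LinearMap.toSpanSingleton k A (p x)) ∘ₗ Coalgebra.counit :=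
      LinearMap.ext hL
    rw [this, LinearMap.lTensor_comp, LinearMap.comp_apply, Coalgebra.lTensor_counit_comul]
    simp
  have h₂ : ∀ t : (A ⊗[k] A) ⊗[k] A,
      LinearMap.mul' k A (L.lTensor A (TensorProduct.assoc k A A A t)) =
        LinearMap.mul' k A (TensorProduct.map (LinearMap.mul' k A ∘ₗ (antipode k).lTensor A)
          R t) := by
    intro t
    induction t with
    | zero => simp
    | add x y hx hy => simp only [map_add, hx, hy]
    | tmul t w =>
      induction t with
      | zero => simp
      | add x y hx hy => simp only [TensorProduct.add_tmul, map_add, hx, hy]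
      | tmul u v =>
        simp [L, R, mul_assoc, hp]
  rw [← h₁, ← Coalgebra.coassoc_apply, h₂, LinearMap.rTensor,
    ← LinearMap.comp_apply (TensorProduct.map _ _), ← TensorProduct.map_comp, LinearMap.comp_assoc,
    mul_antipode_lTensor_comul, LinearMap.comp_id]
  have h₃ : TensorProduct.map (Algebra.linearMap k A ∘ₗ Coalgebra.counit) R =
      TensorProduct.map (Algebra.linearMap k A) R ∘ₗ
        (Coalgebra.counit (R := k) (A := A)).rTensor A := by
    rw [LinearMap.rTensor, ← TensorProduct.map_comp, LinearMap.comp_id]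
  rw [h₃, LinearMap.comp_apply, Coalgebra.rTensor_counit_comul]
  simp [R]

theorem antipode_surjective [IsSemisimpleRing A] : Function.Surjective (antipode k (A := A)) := by
  let f : Aᵐᵒᵖ →+* A :=
    { toFun := fun x => antipode k x.unop
      map_one' := antipode_one
      map_mul' := fun x y => antipode_mul_antidistrib _ _
      map_zero' := map_zero _
      map_add' := fun _ _ => map_add _ _ _ }
  have : IsSemisimpleRing f.range := f.rangeRestrict.isSemisimpleRing_of_surjective
    f.rangeRestrict_surjective
  let N : Submodule f.range A := LinearMap.range (LinearMap.toSpanSingleton f.range A 1)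
  have hN : ∀ x ∈ N, ∃ a, antipode k a = x := by
    rintro _ ⟨⟨_, ⟨a, rfl⟩⟩, rfl⟩
    refine ⟨a.unop, ?_⟩
    change f a = f a * 1
    rw [mul_one]
  have h1 : (1 : A) ∈ N := ⟨1, one_smul _ _⟩
  obtain ⟨N', hN'⟩ := exists_isCompl N
  let q : A →ₗ[f.range] A := N.subtype ∘ₗ N.projectionOnto N' hN'
  have hq : ∀ a x, q (antipode k a * x) = antipode k a * q x := fun a x =>
    q.map_smul (⟨antipode k a, MulOpposite.op a, rfl⟩ : f.range) x
  let p : A →ₗ[k] A :=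
    { toFun := q
      map_add' := map_add q
      map_smul' := fun r x => by
        have := hq (algebraMap k A r) x
        have h : antipode k (algebraMap k A r) = algebraMap k A r := by
          rw [Algebra.algebraMap_eq_smul_one, map_smul, antipode_one]
        rw [h, ← Algebra.smul_def, ← Algebra.smul_def] at this
        exact this }
  intro a
  refine hN a ?_
  have h₁ : q 1 = 1 := congrArg Subtype.val (Submodule.projectionOnto_apply_left hN' ⟨1, h1⟩)
  have h₂ : q (a * 1) = a * q 1 := map_mul_of_map_antipode_mul (p := p) hq a 1
  rw [h₁, mul_one] at h₂
  rw [← h₂]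
  exact Subtype.property _

variable (k A) in
/-- A linear map which is inverse to the antipode. -/
theorem exists_antipode_inverse [IsSemisimpleRing A] [Module.Finite k A] :
    ∃ T : A →ₗ[k] A, (∀ a, T (antipode k a) = a) ∧ (∀ a, antipode k (T a) = a) :=
  have hs := antipode_surjective (k := k) (A := A)
  let e := LinearEquiv.ofBijective (antipode k (A := A))
    ⟨LinearMap.injective_iff_surjective.mpr hs, hs⟩
  ⟨e.symm.toLinearMap, e.symm_apply_apply, e.apply_symm_apply⟩

end HopfAlgebra

/-! ### Modules over a semisimple algebra -/

namespace FDMod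

variable {k : Type u} [Field k] {A : Type u} [Ring A] [Algebra k A]

/-- The action of `A` in terms of endomorphisms in the category of vector spaces. -/
def act (M : FDMod k A) : A →ₐ[k] End M.V := (FGModuleCat.endEquiv M.V).symm.toAlgHom.comp M.ρ

/-- A module given by endomorphisms in the category of vector spaces. -/
def ofAct (V : FGModuleCat.{u} k) (ρ : A →ₐ[k] End V) : FDMod k A :=
  ⟨V, (FGModuleCat.endEquiv V).toAlgHom.comp ρ⟩

/-- A linear map commuting with the actions is a morphism of modules. -/
def homMk {M N : FDMod k A} (f : M.V ⟶ N.V) (h : ∀ a, M.act a ≫ f = f ≫ N.act a) : M ⟶ N :=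
  ⟨f, fun a => congrArg (fun g => g.hom.hom) (h a)⟩

/-- An isomorphism commuting with the actions is an isomorphism of modules. -/
def isoMk {M N : FDMod k A} (f : M.V ≅ N.V) (h : ∀ a, M.act a ≫ f.hom = f.hom ≫ N.act a) : M ≅ N :=
  mkIso f fun a => congrArg (fun g => g.hom.hom) (h a)

theorem hom_act {M N : FDMod k A} (f : M ⟶ N) (a : A) : M.act a ≫ f.hom = f.hom ≫ N.act a :=
  FGModuleCat.hom_ext (f.comm a)

/-- The module given by an unbundled one. -/
abbrev of (k : Type u) [Field k] (A : Type u) [Ring A] [Algebra k A] (N : Type u) [AddCommGroup N]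
    [Module k N] [Module A N] [IsScalarTower k A N] [Module.Finite k N] : FDMod k A :=
  ⟨FGModuleCat.of k N, Algebra.lsmul k k N⟩

/-- The underlying type of a module. -/
def carrier (M : FDMod k A) : Type u := M.V

instance (M : FDMod k A) : AddCommGroup M.carrier := inferInstanceAs (AddCommGroup M.V)
instance (M : FDMod k A) : Module k M.carrier := inferInstanceAs (Module k M.V)
instance (M : FDMod k A) : Module.Finite k M.carrier := inferInstanceAs (Module.Finite k M.V)
instance (M : FDMod k A) : Module A M.carrier := Module.compHom M.V M.ρ.toRingHom

theorem smul_def (M : FDMod k A) (a : A) (x : M.carrier) : a • x = M.ρ a x := rfl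

instance (M : FDMod k A) : IsScalarTower k A M.carrier where
  smul_assoc r a x := by
    rw [smul_def, map_smul]
    rfl

instance (M : FDMod k A) : Module.Finite A M.carrier :=
  Module.Finite.of_restrictScalars_finite k A _

/-- A linear map over `A` is a morphism of modules. -/
def homOf {M N : FDMod k A} (f : M.carrier →ₗ[A] N.carrier) : M ⟶ N where
  hom := FGModuleCat.ofHom (f.restrictScalars k : M.V →ₗ[k] N.V)
  comm a := LinearMap.ext fun x => f.map_smul a x

/-- A morphism of modules is a linear map over `A`. -/
def toLinear {M N : FDMod k A} (f : M ⟶ N) : M.carrier →ₗ[A] N.carrier where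
  toFun := f.hom.hom.hom
  map_add' := map_add f.hom.hom.hom
  map_smul' a x := LinearMap.congr_fun (f.comm a) x

theorem ext_toLinear {M N : FDMod k A} {f g : M ⟶ N}
    (h : ∀ x : M.carrier, toLinear f x = toLinear g x) : f = g :=
  hom_ext (FGModuleCat.hom_ext (LinearMap.ext h))

variable (k A) in
/-- Modules as objects of Mathlib's category of finitely generated modules. -/
def toFG : FDMod k A ⥤ FGModuleCat.{u} A where
  obj M := FGModuleCat.of A M.carrier
  map {M N} f := FGModuleCat.ofHom (V := M.carrier) (W := N.carrier) (toLinear f)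

instance : (toFG k A).Faithful where
  map_injective {M N} _ _ h := ext_toLinear fun x => LinearMap.congr_fun
    (congrArg (fun g : (toFG k A).obj M ⟶ (toFG k A).obj N => g.hom.hom) h) x

instance : (toFG k A).Full where
  map_surjective f := ⟨homOf f.hom.hom, rfl⟩

instance [Module.Finite k A] : (toFG k A).EssSurj where
  mem_essImage N := by
    let _ : Module k N := Module.compHom N (algebraMap k A)
    have : IsScalarTower k A N := ⟨fun r a x => by
      rw [Algebra.smul_def, mul_smul]
      rfl⟩
    have : Module.Finite k N := Module.Finite.trans A N
    let e : (of k A N).carrier ≃ₗ[A] N :=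
      { toFun := fun x => x
        invFun := fun x => x
        map_add' := fun _ _ => rfl
        map_smul' := fun _ _ => rfl
        left_inv := fun _ => rfl
        right_inv := fun _ => rfl }
    exact ⟨of k A N, ⟨e.toFGModuleCatIso⟩⟩

instance [Module.Finite k A] : (toFG k A).IsEquivalence where

theorem _root_.hasKernels_of_exists_abelian {C : Type w} [Category.{v} C] [P : Preadditive C]
    (h : ∃ a : Abelian C, a.toPreadditive = P) : Limits.HasKernels C := by
  obtain ⟨a, rfl⟩ := h
  infer_instance

variable (k A) in
theorem exists_abelian [Module.Finite k A] :
    ∃ a : Abelian (FDMod k A), a.toPreadditive = instPreadditive := by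
  have : IsNoetherianRing A := IsNoetherianRing.of_finite k A
  have : Limits.HasFiniteProducts (FDMod k A) :=
    ⟨fun n => Adjunction.hasLimitsOfShape_of_equivalence (toFG k A)⟩
  exact ⟨abelianOfEquivalence (toFG k A), rfl⟩

instance (M N : FDMod k A) : Module.Finite k (M ⟶ N) :=
  Module.Finite.of_injective
    ({ toFun := fun f => f.hom, map_add' := fun _ _ => rfl, map_smul' := fun _ _ => rfl } :
      (M ⟶ N) →ₗ[k] (M.V ⟶ N.V)) fun _ _ h => hom_ext h

instance (M : FDMod k A) (W : Submodule A M.carrier) : Module.Finite k W :=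
  Module.Finite.of_injective (W.subtype.restrictScalars k) W.subtype_injective

/-- The submodule given by an invariant subspace. -/
def sub (M : FDMod k A) (W : Submodule A M.carrier) : FDMod k A := of k A W

/-- A linear map to an invariant subspace. -/
def toSub {M N : FDMod k A} {W : Submodule A N.carrier} (f : M.carrier →ₗ[A] W) : M ⟶ N.sub W where
  hom := FGModuleCat.ofHom (f.restrictScalars k : M.V →ₗ[k] (N.sub W).V)
  comm a := LinearMap.ext fun x => f.map_smul a x

/-- A linear map from an invariant subspace. -/
def ofSub {M N : FDMod k A} {W : Submodule A M.carrier} (f : W →ₗ[A] N.carrier) : M.sub W ⟶ N where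
  hom := FGModuleCat.ofHom (f.restrictScalars k : (M.sub W).V →ₗ[k] N.V)
  comm a := LinearMap.ext fun x => f.map_smul a x

theorem injective_of_mono {M N : FDMod k A} (f : M ⟶ N) [Mono f] :
    Function.Injective (toLinear f) := by
  rw [← LinearMap.ker_eq_bot]
  let i : M.sub (LinearMap.ker (toLinear f)) ⟶ M := ofSub (LinearMap.ker (toLinear f)).subtype
  have hi : i ≫ f = 0 ≫ f := by
    rw [Limits.zero_comp]
    exact ext_toLinear fun x => Subtype.property (p := (· ∈ LinearMap.ker (toLinear f))) x
  have h0 : i = 0 := (cancel_mono f).mp hi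
  refine (Submodule.eq_bot_iff _).mpr fun x hx => ?_
  exact LinearMap.congr_fun (congrArg (fun g => g.hom.hom.hom) h0)
    (⟨x, hx⟩ : LinearMap.ker (toLinear f))

theorem isIso_of_bijective {M N : FDMod k A} (f : M ⟶ N)
    (h : Function.Bijective (toLinear f)) : IsIso f := by
  let e : M.V ≃ₗ[k] N.V := LinearEquiv.ofBijective f.hom.hom.hom h
  exact (mkIso e.toFGModuleCatIso f.comm).isIso_hom

theorem simple_of_submodule {M : FDMod k A} (hM : Nontrivial M.carrier)
    (h : ∀ W : Submodule A M.carrier, W = ⊥ ∨ W = ⊤) : Simple M where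
  mono_isIso_iff_nonzero {N} f _ := by
    constructor
    · rintro hf rfl
      obtain ⟨x, hx⟩ := exists_ne (0 : M.carrier)
      have : 𝟙 M = 0 := by
        rw [← IsIso.inv_hom_id (0 : N ⟶ M), Limits.comp_zero]
      exact hx (LinearMap.congr_fun (congrArg (fun g => g.hom.hom.hom) this) x)
    · intro hf
      refine isIso_of_bijective f ⟨injective_of_mono f, ?_⟩
      rw [← LinearMap.range_eq_top]
      refine (h _).resolve_left fun h0 => hf ?_
      rw [LinearMap.range_eq_bot] at h0
      exact hom_ext (FGModuleCat.hom_ext (LinearMap.ext fun x => LinearMap.congr_fun h0 x))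

theorem simple_sub (M : FDMod k A) (W : Submodule A M.carrier) [IsSimpleModule A W] :
    Simple (M.sub W) :=
  simple_of_submodule (IsSimpleModule.nontrivial A W)
    fun W' => IsSimpleOrder.eq_bot_or_eq_top (α := Submodule A W) W'

theorem exists_decomposition [IsSemisimpleRing A] (M : FDMod k A) :
    ∃ (n : ℕ) (s : Fin n → FDMod k A), (∀ i, Simple (s i)) ∧ Nonempty (Decomposition s M) := by
  obtain ⟨n, S, e₀, hS⟩ := IsSemisimpleModule.exists_linearEquiv_fin_dfinsupp A M.carrier
  let e := e₀.trans (DFinsupp.linearEquivFunOnFintype (R := A))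
  refine ⟨n, fun i => M.sub (S i), fun i => M.simple_sub (S i), ⟨?_⟩⟩
  exact
    { n := n
      φ := id
      p := fun t => toSub ((LinearMap.proj t).comp e.toLinearMap)
      i := fun t => ofSub (e.symm.toLinearMap.comp (LinearMap.single A (fun i => S i) t))
      i_p := fun t => ext_toLinear fun x => by
        change e (e.symm (Pi.single t x)) t = x
        exact (congrFun (e.apply_symm_apply _) t).trans (Pi.single_eq_same (M := fun i => S i) t x)
      i_p_ne := fun t u h => ext_toLinear fun x => by
        change e (e.symm (Pi.single t x)) u = 0
        exact (congrFun (e.apply_symm_apply _) u).trans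
          (Pi.single_eq_of_ne (M := fun i => S i) h.symm x)
      total := ext_toLinear fun x => by
        let F : (M ⟶ M) →+ (M.carrier →+ M.carrier) :=
          { toFun := fun f => (toLinear f).toAddMonoidHom
            map_zero' := rfl
            map_add' := fun _ _ => rfl }
        change F (∑ t, _) x = x
        refine (congrFun (congrArg DFunLike.coe (map_sum F _ _)) x).trans ?_
        rw [AddMonoidHom.finsetSum_apply]
        change ∑ t, e.symm (Pi.single t (e x t)) = x
        rw [← map_sum, Finset.univ_sum_single, e.symm_apply_apply] }

variable (k A) in
theorem isFiniteSemisimple [IsSemisimpleRing A] [Module.Finite k A] :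
    IsFiniteSemisimple k (FDMod k A) where
  abelian := exists_abelian k A
  finite_hom _ _ := inferInstance
  sum_of_simples M := by
    obtain ⟨n, s, hs, ⟨D⟩⟩ := M.exists_decomposition
    exact ⟨D.n, _, D.bicone, fun i => hs _, ⟨D.isBilimit⟩, ⟨Iso.refl M⟩⟩
  finite_simples := by
    obtain ⟨n, s, hs, ⟨D⟩⟩ := (of k A A).exists_decomposition
    refine ⟨n, s, fun X hX => ?_⟩
    obtain ⟨x, hx⟩ : ∃ x : X.carrier, x ≠ 0 := by
      by_contra! h
      exact id_nonzero X (hom_ext (FGModuleCat.hom_ext (LinearMap.ext h)))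
    let f : of k A A ⟶ X := homOf (M := of k A A) (LinearMap.toSpanSingleton A X.carrier x)
    have hf : f ≠ 0 := fun h => hx <| by
      have : (1 : A) • x = 0 := LinearMap.congr_fun (congrArg (fun g => g.hom.hom.hom) h) (1 : A)
      rwa [one_smul] at this
    obtain ⟨t, ht⟩ : ∃ t, D.i t ≫ f ≠ 0 := by
      by_contra! h
      refine hf ?_
      rw [← Category.id_comp f, ← D.total, Preadditive.sum_comp]
      exact Finset.sum_eq_zero fun t _ => by rw [Category.assoc, h, Limits.comp_zero]
    have : Limits.HasKernels (FDMod k A) := hasKernels_of_exists_abelian (exists_abelian k A)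
    have := hs (D.φ t)
    have := isIso_of_hom_simple ht
    exact ⟨D.φ t, ⟨(asIso (D.i t ≫ f)).symm⟩⟩

end FDMod

theorem CategoryTheory.ExactPairing.evaluation_whiskerRight_injective {C : Type*} [Category C]
    [MonoidalCategory C] {V W Z : C} [ExactPairing V W] {f g : Z ⟶ W}
    (h : f ▷ V ≫ ε_ V W = g ▷ V ≫ ε_ V W) : f = g := by
  have key : ∀ f : Z ⟶ W, f = (ρ_ Z).inv ≫ Z ◁ η_ V W ≫ (α_ Z V W).inv ≫
      (f ▷ V ≫ ε_ V W) ▷ W ≫ (λ_ W).hom := fun f => by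
    have := coevaluation_evaluation V W
    calc f = (ρ_ Z).inv ≫ (f ▷ 𝟙_ C) ≫ (W ◁ η_ V W ≫ (α_ W V W).inv ≫ ε_ V W ▷ W) ≫ (λ_ W).hom := by
          rw [this]; simp
      _ = _ := by
          simp only [comp_whiskerRight, Category.assoc]
          rw [← whisker_exchange_assoc]
          simp
  rw [key f, key g, h]

section Mates

variable {k : Type*} [Field k] {C : Type*} [Category C] [Preadditive C] [Linear k C]
  [MonoidalCategory C] [MonoidalPreadditive C] [MonoidalLinear k C] {A : Type*} [Ring A]
  [Algebra k A] {V W : C} [ExactPairing V W]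

variable (k) in
/-- Passing to mates is an algebra anti-isomorphism. -/
theorem CategoryTheory.ExactPairing.exists_mate_equiv : ∃ m : (End V)ᵐᵒᵖ ≃ₐ[k] End W,
    ∀ f : End V, MonoidalCategoryStruct.whiskerLeft (C := C) W f ≫ ε_ V W =
      MonoidalCategoryStruct.whiskerRight (C := C) (m (.op f)) V ≫ ε_ V W := by
  choose m hm using fun f : V ⟶ V => ExactPairing.exists_dual (W := W) (W' := W) f
  choose m' hm' using fun g : W ⟶ W => ExactPairing.exists_mate V W g
  have hinj : ∀ f g : W ⟶ W, f ▷ V ≫ ε_ V W = g ▷ V ≫ ε_ V W → f = g :=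
    fun _ _ => ExactPairing.evaluation_whiskerRight_injective
  let M : (End V)ᵐᵒᵖ →ₗ[k] End W :=
    { toFun := fun f => m f.unop
      map_add' := fun f g => hinj _ _ <| by
        rw [hm]
        refine Eq.trans ?_ (congrArg (· ≫ _) (MonoidalPreadditive.add_whiskerRight _ _)).symm
        refine (congrArg (· ≫ _) (MonoidalPreadditive.whiskerLeft_add _ _)).trans ?_
        rw [Preadditive.add_comp, Preadditive.add_comp, hm, hm]
      map_smul' := fun r f => hinj _ _ <| by
        rw [hm]
        refine Eq.trans ?_ (congrArg (· ≫ _) (MonoidalLinear.smul_whiskerRight _ _ _)).symm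
        refine (congrArg (· ≫ _) (MonoidalLinear.whiskerLeft_smul _ _ _)).trans ?_
        rw [Linear.smul_comp, Linear.smul_comp, hm]
        rfl }
  let M' : (End V)ᵐᵒᵖ →ₐ[k] End W := AlgHom.ofLinearMap M
    (hinj _ _ <| (hm _).trans <| by
      change W ◁ 𝟙 V ≫ _ = 𝟙 W ▷ V ≫ _
      simp)
    fun f g => hinj _ _ <| (hm _).trans <| by
      change W ◁ (f.unop ≫ g.unop) ≫ _ = (m g.unop ≫ m f.unop) ▷ V ≫ _
      rw [MonoidalCategory.whiskerLeft_comp, comp_whiskerRight, Category.assoc, Category.assoc,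
        hm, ← whisker_exchange_assoc, hm]
  refine ⟨AlgEquiv.ofBijective M' ⟨fun f g h => ?_, fun g => ?_⟩, fun f => (hm f).symm⟩
  · refine MulOpposite.unop_injective (ExactPairing.whiskerLeft_evaluation_injective (W := W) ?_)
    rw [← hm, ← hm]
    exact congrArg (fun g : W ⟶ W => g ▷ V ≫ ε_ V W) h
  · exact ⟨.op (m' g), hinj _ _ ((hm _).trans (hm' g).1)⟩

theorem CategoryTheory.ExactPairing.exists_dual_action (ρ : A →ₐ[k] End V) (S : A →ₗ[k] A)
    (h1 : S 1 = 1)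
    (hS : ∀ a b, S (a * b) = S b * S a) : ∃ σ : A →ₐ[k] End W, ∀ a,
      MonoidalCategoryStruct.whiskerLeft (C := C) W (ρ (S a)) ≫ ε_ V W =
      MonoidalCategoryStruct.whiskerRight (C := C) (σ a) V ≫ ε_ V W := by
  obtain ⟨m, hm⟩ := ExactPairing.exists_mate_equiv k (V := V) (W := W)
  let S' : A →ₐ[k] Aᵐᵒᵖ := AlgHom.ofLinearMap ((MulOpposite.opLinearEquiv k).toLinearMap ∘ₗ S)
    (congrArg MulOpposite.op h1) fun a b => congrArg MulOpposite.op (hS a b)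
  exact ⟨m.toAlgHom.comp ((AlgHom.op ρ).comp S'), fun a => hm _⟩

theorem CategoryTheory.ExactPairing.exists_dual_action' (ρ : A →ₐ[k] End W) (S : A →ₗ[k] A)
    (h1 : S 1 = 1)
    (hS : ∀ a b, S (a * b) = S b * S a) : ∃ σ : A →ₐ[k] End V, ∀ a,
      MonoidalCategoryStruct.whiskerLeft (C := C) W (σ a) ≫ ε_ V W =
      MonoidalCategoryStruct.whiskerRight (C := C) (ρ (S a)) V ≫ ε_ V W := by
  obtain ⟨m, hm⟩ := ExactPairing.exists_mate_equiv k (V := V) (W := W)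
  let S' : Aᵐᵒᵖ →ₐ[k] A := AlgHom.ofLinearMap
    (S ∘ₗ (MulOpposite.opLinearEquiv k).symm.toLinearMap) h1 fun a b => hS b.unop a.unop
  refine ⟨AlgHom.unop ((m.symm.toAlgHom.comp ρ).comp S'), fun a => (hm _).trans ?_⟩
  exact congrArg (fun g : W ⟶ W => g ▷ V ≫ ε_ V W) (m.apply_symm_apply (ρ (S a)))

end Mates

/-! ### Modules over a semisimple Hopf algebra form a fusion category -/

namespace FDMod

variable {k : Type u} [Field k]

section Bialgebra

variable {A : Type u} [Ring A] [Bialgebra k A]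

instance : MonoidalPreadditive (FDMod k A) where
  whiskerLeft_zero {M _ _} := hom_ext (MonoidalPreadditive.whiskerLeft_zero (X := M.V))
  zero_whiskerRight {M _ _} := hom_ext (MonoidalPreadditive.zero_whiskerRight (X := M.V))
  whiskerLeft_add f g := hom_ext (MonoidalPreadditive.whiskerLeft_add f.hom g.hom)
  add_whiskerRight f g := hom_ext (MonoidalPreadditive.add_whiskerRight f.hom g.hom)

instance : MonoidalLinear k (FDMod k A) where
  whiskerLeft_smul M _ _ r f := hom_ext (MonoidalLinear.whiskerLeft_smul M.V r f.hom)
  smul_whiskerRight r _ _ f M := hom_ext (MonoidalLinear.smul_whiskerRight r f.hom M.V)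

theorem tensor_act (M N : FDMod k A) (a : A) :
    (M ⊗ N).act a = tensEnd M.act N.act (Coalgebra.comul (R := k) a) := by
  have h : ∀ t : A ⊗[k] A, (FGModuleCat.endEquiv (M.V ⊗ N.V)).symm
      (Module.endTensorEndAlgHom (R := k) (S := k) (A := k) (M := M.V) (N := N.V)
        (TensorProduct.map M.ρ.toLinearMap N.ρ.toLinearMap t)) = tensEnd M.act N.act t :=
      fun t => by
    induction t with
    | zero => simp only [map_zero]
    | add x y hx hy =>
      simp only [map_add]
      exact congrArg₂ (· + ·) hx hy
    | tmul x y =>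
      rw [tensEnd_tmul]
      rfl
  exact h _

theorem unit_act (a : A) : (𝟙_ (FDMod k A)).act a =
    Coalgebra.counit (R := k) a • 𝟙 (𝟙_ (FGModuleCat.{u} k)) := rfl

/-- Equivariant duality of the underlying vector spaces is duality of modules. -/
theorem nonempty_exactPairing (M N : FDMod k A) [ExactPairing M.V N.V]
    (hη : ∀ a, η_ M.V N.V ≫ tensEnd M.act N.act (Coalgebra.comul (R := k) a) =
      Coalgebra.counit (R := k) a • η_ M.V N.V)
    (hε : ∀ a, tensEnd N.act M.act (Coalgebra.comul (R := k) a) ≫ ε_ M.V N.V =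
      Coalgebra.counit (R := k) a • ε_ M.V N.V) : Nonempty (ExactPairing M N) :=
  ⟨{ coevaluation' := homMk (M := 𝟙_ (FDMod k A)) (N := M ⊗ N) (η_ M.V N.V) fun a => by
      rw [unit_act, tensor_act, hη]
      exact (Linear.smul_comp ..).trans (congrArg _ (Category.id_comp _))
     evaluation' := homMk (M := N ⊗ M) (N := 𝟙_ (FDMod k A)) (ε_ M.V N.V) fun a => by
      rw [unit_act, tensor_act, hε]
      exact ((Linear.comp_smul ..).trans (congrArg _ (Category.comp_id _))).symm
     coevaluation_evaluation' := hom_ext (ExactPairing.coevaluation_evaluation M.V N.V)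
     evaluation_coevaluation' := hom_ext (ExactPairing.evaluation_coevaluation M.V N.V) }⟩

theorem simple_unit : Simple (𝟙_ (FDMod k A)) := by
  refine simple_of_submodule (inferInstanceAs (Nontrivial k)) fun W => ?_
  exact eq_bot_or_eq_top (α := Submodule k k) (W.restrictScalars k) |>.imp
    (fun h => Submodule.restrictScalars_injective k A _ h)
    (fun h => Submodule.restrictScalars_injective k A _ h)

end Bialgebra

section Hopf

variable {A : Type u} [Ring A] [HopfAlgebra k A]

theorem tensEnd_evaluation {V W : FGModuleCat.{u} k} [ExactPairing V W] (ρ : A →ₐ[k] End V)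
    (σ : A →ₐ[k] End W) (S : A →ₗ[k] A)
    (hσ : ∀ a, W ◁ ρ (S a) ≫ ε_ V W = σ a ▷ V ≫ ε_ V W) (t : A ⊗[k] A) :
    tensEnd σ ρ t ≫ ε_ V W = W ◁ ρ (LinearMap.mul' k A (S.rTensor A t)) ≫ ε_ V W := by
  induction t with
  | zero =>
    simp only [map_zero]
    exact (by simp : 0 ≫ ε_ V W = W ◁ (0 : V ⟶ V) ≫ ε_ V W)
  | add x y hx hy =>
    simp only [map_add]
    refine ((Preadditive.add_comp ..).trans (congrArg₂ (· + ·) hx hy)).trans ?_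
    exact (by simp : ∀ f g : V ⟶ V, W ◁ f ≫ ε_ V W + W ◁ g ≫ ε_ V W =
      W ◁ (f + g) ≫ ε_ V W) _ _
  | tmul x y =>
    rw [LinearMap.rTensor_tmul, LinearMap.mul'_apply, map_mul, tensEnd_tmul]
    refine Eq.trans ?_ (congrArg (· ≫ _) (MonoidalCategory.whiskerLeft_comp _ _ _)).symm
    rw [Category.assoc, hσ, whisker_exchange_assoc, MonoidalCategory.tensorHom_def, Category.assoc]

theorem coevaluation_tensEnd {V W : FGModuleCat.{u} k} [ExactPairing V W] (ρ : A →ₐ[k] End V)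
    (σ : A →ₐ[k] End W) (S : A →ₗ[k] A)
    (hσ : ∀ a, η_ V W ≫ ρ (S a) ▷ W = η_ V W ≫ V ◁ σ a) (t : A ⊗[k] A) :
    η_ V W ≫ tensEnd ρ σ t = η_ V W ≫ ρ (LinearMap.mul' k A (S.lTensor A t)) ▷ W := by
  induction t with
  | zero =>
    simp only [map_zero]
    exact (by simp : η_ V W ≫ 0 = η_ V W ≫ (0 : V ⟶ V) ▷ W)
  | add x y hx hy =>
    simp only [map_add]
    refine ((Preadditive.comp_add ..).trans (congrArg₂ (· + ·) hx hy)).trans ?_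
    exact (by simp : ∀ f g : V ⟶ V, η_ V W ≫ f ▷ W + η_ V W ≫ g ▷ W =
      η_ V W ≫ (f + g) ▷ W) _ _
  | tmul x y =>
    rw [LinearMap.lTensor_tmul, LinearMap.mul'_apply, map_mul, tensEnd_tmul]
    refine Eq.trans ?_ (congrArg (_ ≫ ·) (comp_whiskerRight _ _ _)).symm
    rw [← Category.assoc (η_ V W), hσ, Category.assoc, MonoidalCategory.tensorHom_def']

theorem nonempty_exactPairing_of_antipode (M N : FDMod k A) [ExactPairing M.V N.V]
    (h : ∀ a, N.V ◁ M.act (HopfAlgebra.antipode k a) ≫ ε_ M.V N.V = N.act a ▷ M.V ≫ ε_ M.V N.V) :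
    Nonempty (ExactPairing M N) := by
  refine nonempty_exactPairing M N (fun a => ?_) fun a => ?_
  · rw [coevaluation_tensEnd M.act N.act (HopfAlgebra.antipode k) (fun a => ?_),
      HopfAlgebra.mul_antipode_lTensor_comul_apply, AlgHom.commutes]
    · refine (congrArg (_ ≫ ·) (MonoidalLinear.smul_whiskerRight (C := FGModuleCat.{u} k) _
        (𝟙 M.V) N.V)).trans ?_
      rw [id_whiskerRight, Linear.comp_smul, Category.comp_id]
    · obtain ⟨s, h₁, h₂⟩ := ExactPairing.exists_mate M.V N.V (N.act a)
      rw [← h₂, ExactPairing.whiskerLeft_evaluation_injective (W := N.V) ((h a).trans h₁.symm)]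
  · rw [tensEnd_evaluation M.act N.act (HopfAlgebra.antipode k) h,
      HopfAlgebra.mul_antipode_rTensor_comul_apply, AlgHom.commutes]
    refine (congrArg (· ≫ _) (MonoidalLinear.whiskerLeft_smul (C := FGModuleCat.{u} k) N.V _
      (𝟙 M.V))).trans ?_
    rw [MonoidalCategory.whiskerLeft_id, Linear.smul_comp, Category.id_comp]

end Hopf

theorem hasRightDual {A : Type u} [Ring A] [HopfAlgebra k A] (M : FDMod k A) :
    Nonempty (HasRightDual M) := by
  obtain ⟨W, ⟨hW⟩⟩ : ∃ W, Nonempty (ExactPairing M.V W) :=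
    ⟨FGModuleCat.FGModuleCatDual k M.V, ⟨inferInstance⟩⟩
  obtain ⟨σ, hσ⟩ := CategoryTheory.ExactPairing.exists_dual_action (W := W) M.act
    (HopfAlgebra.antipode k) HopfAlgebra.antipode_one
    fun a b => HopfAlgebra.antipode_mul_antidistrib a b
  obtain ⟨h⟩ := @nonempty_exactPairing_of_antipode _ _ _ _ _ M (ofAct W σ) hW hσ
  exact ⟨⟨ofAct W σ⟩⟩

theorem hasLeftDual {A : Type u} [Ring A] [HopfAlgebra k A] [IsSemisimpleRing A]
    [Module.Finite k A] (M : FDMod k A) : Nonempty (HasLeftDual M) := by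
  obtain ⟨T, hT, hT'⟩ := HopfAlgebra.exists_antipode_inverse k A
  obtain ⟨V, ⟨hV⟩⟩ : ∃ V, Nonempty (ExactPairing V M.V) :=
    ⟨FGModuleCat.FGModuleCatDual k M.V, ⟨BraidedCategory.exactPairing_swap M.V _⟩⟩
  obtain ⟨σ, hσ⟩ := CategoryTheory.ExactPairing.exists_dual_action' (V := V) M.act T
    ((congrArg T HopfAlgebra.antipode_one.symm).trans (hT 1)) fun a b => by
      rw [← hT (T b * T a), HopfAlgebra.antipode_mul_antidistrib, hT', hT']
  obtain ⟨h⟩ := @nonempty_exactPairing_of_antipode _ _ _ _ _ (ofAct V σ) M hV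
    fun a => (hσ _).trans (by rw [hT]; rfl)
  exact ⟨⟨ofAct V σ⟩⟩

theorem isFusion (A : Type u) [Ring A] [HopfAlgebra k A] [IsSemisimpleRing A]
    [Module.Finite k A] : IsFusion k (FDMod k A) where
  semisimple := isFiniteSemisimple k A
  preadditive := inferInstance
  linear := inferInstance
  hasLeftDual := hasLeftDual
  hasRightDual := hasRightDual
  simple_unit := simple_unit

end FDMod

theorem modFib_isFusion {k : Type u} [Field k] (A : SSHopf k) :
    FibCat.isFusion k (modFib k A.obj) :=
  have := A.property.1
  have := A.property.2
  ⟨FDMod.isFusion A.obj, inferInstance⟩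

/-! ### Simple families -/

/-- Replacing the members of the family by isomorphic objects. -/
def Decomposition.changeFamily {C : Type*} [Category C] [Preadditive C] {ι κ : Type*} {s : ι → C}
    {s' : κ → C} {c : C} (D : Decomposition s c) (ψ : ι → κ) (e : ∀ i, s i ≅ s' (ψ i)) :
    Decomposition s' c :=
  Decomposition.ofBicone (fun t => ψ (D.φ t)) (fun t => e (D.φ t)) D.bicone D.isBilimit

section

variable {k : Type u} [Field k] {C : Type*} [Category C] [Preadditive C] [Linear k C] {ι : Type*}
  {s : ι → C} {E : Type*} [Category E] [Preadditive E] [Linear k E] (K : C ⥤ E)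
  [K.Additive] [K.Linear k]

include k in
theorem IsSimpleFamily.full (hs : ∀ c, Nonempty (Decomposition s c))
    (h : IsSimpleFamily k fun i => K.obj (s i)) : K.Full where
  map_surjective {c d} f := by
    obtain ⟨P⟩ := hs c
    obtain ⟨Q⟩ := hs d
    have key : ∀ i j (g : K.obj (s i) ⟶ K.obj (s j)), ∃ g', K.map g' = g := fun i j g => by
      by_cases hij : i = j
      · subst hij
        obtain ⟨r, rfl⟩ := h.end_scalar i g
        exact ⟨r • 𝟙 _, by simp⟩
      · exact ⟨0, by rw [h.hom_eq_zero i j hij g, K.map_zero]⟩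
    choose g hg using key
    refine ⟨∑ t, ∑ u, P.p t ≫ g _ _ (K.map (P.i t) ≫ f ≫ K.map (Q.p u)) ≫ Q.i u, ?_⟩
    calc _ = (∑ t, K.map (P.p t) ≫ K.map (P.i t)) ≫ f ≫ ∑ u, K.map (Q.p u) ≫ K.map (Q.i u) := by
          simp only [K.map_sum, K.map_comp, hg, Preadditive.sum_comp, Preadditive.comp_sum,
            Category.assoc]
          exact Finset.sum_comm
      _ = f := by rw [P.total_map, Q.total_map, Category.id_comp, Category.comp_id]

omit [Linear k E] [Linear k C] [K.Linear k] in
theorem Decomposition.essSurj [Limits.HasFiniteBiproducts C]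
    (h : ∀ N, Nonempty (Decomposition (fun i => K.obj (s i)) N)) : K.EssSurj where
  mem_essImage N := by
    obtain ⟨D⟩ := h N
    refine ⟨⨁ fun t => s (D.φ t), ⟨?_⟩⟩
    refine
      { hom := ∑ t, K.map (Limits.biproduct.π _ t) ≫ D.i t
        inv := ∑ t, D.p t ≫ K.map (Limits.biproduct.ι (fun t => s (D.φ t)) t)
        hom_inv_id := ?_
        inv_hom_id := ?_ }
    · simp only [Preadditive.sum_comp, Preadditive.comp_sum, Category.assoc]
      calc _ = ∑ t, K.map (Limits.biproduct.π (fun t => s (D.φ t)) t) ≫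
              K.map (Limits.biproduct.ι (fun t => s (D.φ t)) t) := by
            refine Finset.sum_congr rfl fun t _ => ?_
            rw [Finset.sum_eq_single t, reassoc_of% D.i_p t]
            · intro u _ hu
              rw [reassoc_of% D.i_p_ne u t hu]
              simp
            · simp
        _ = 𝟙 _ := by
            simp only [← K.map_comp, ← K.map_sum, Limits.biproduct.total, K.map_id]
    · simp only [Preadditive.sum_comp, Preadditive.comp_sum, Category.assoc]
      refine Eq.trans ?_ D.total
      refine Finset.sum_congr rfl fun t _ => ?_
      rw [Finset.sum_eq_single t, ← K.map_comp_assoc, Limits.biproduct.ι_π_self, K.map_id,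
        Category.id_comp]
      · intro u _ hu
        rw [← K.map_comp_assoc, Limits.biproduct.ι_π_ne _ hu]
        simp
      · simp

end

namespace FDMod

variable {k : Type u} [Field k] {A : Type u} [Ring A] [Algebra k A] {ι : Type*} {M : ι → FDMod k A}

/-- The simultaneous action on a family of modules. -/
def actPi (M : ι → FDMod k A) : A →ₐ[k] ∀ i, Module.End k (M i).V :=
  AlgHom.pi fun i => (M i).ρ

theorem actPi_bijective (hM : Function.Bijective fun (a : A) (i : ι) => (M i).act a) :
    Function.Bijective (actPi M) := by
  have : ⇑(actPi M) = (Equiv.piCongrRight fun i => (FGModuleCat.endEquiv (M i).V).toEquiv) ∘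
    fun (a : A) (i : ι) => (M i).act a := rfl
  rw [this]
  exact (Equiv.bijective _).comp hM

theorem _root_.Module.End.exists_apply_eq {V : Type*} [AddCommGroup V] [Module k V] {x : V}
    (hx : x ≠ 0) (y : V) : ∃ f : Module.End k V, f x = y := by
  obtain ⟨φ, hφ⟩ := not_forall.mp (mt (Module.forall_dual_apply_eq_zero_iff k x).mp hx)
  exact ⟨(φ x)⁻¹ • φ.smulRight y, by simp [smul_smul, hφ]⟩

variable (hM : Function.Bijective (actPi M))

include hM

theorem simple_of_bijective {i : ι} (hi : Nontrivial (M i).carrier) : Simple (M i) := by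
  classical
  refine simple_of_submodule hi fun W => or_iff_not_imp_left.mpr fun hW => ?_
  obtain ⟨x, hx, hx0⟩ := (Submodule.ne_bot_iff _).mp hW
  refine eq_top_iff.mpr fun y _ => ?_
  obtain ⟨f, hf⟩ := Module.End.exists_apply_eq (k := k) (V := (M i).V) hx0 y
  obtain ⟨a, ha⟩ := hM.2 (Pi.single i f)
  have hy : a • x = y := by
    rw [smul_def, ← hf]
    exact LinearMap.congr_fun ((congrFun ha i).trans
      (Pi.single_eq_same (M := fun i => Module.End k (M i).V) i f)) x
  rw [← hy]
  exact W.smul_mem a hx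

theorem exists_ne_zero_of_bijective [Finite ι] {S : FDMod k A} {x : S.carrier} (hx : x ≠ 0) :
    ∃ (i : ι) (f : M i ⟶ S), f ≠ 0 := by
  classical
  have := Fintype.ofFinite ι
  let E : A ≃ₐ[k] ∀ i, Module.End k (M i).V := AlgEquiv.ofBijective _ hM
  let Φ : ∀ i, Module.End k (M i).V →ₗ[k] A := fun i =>
    E.symm.toLinearMap ∘ₗ LinearMap.single k (fun i => Module.End k (M i).V) i
  have hΦ : ∀ i a f, Φ i ((M i).ρ a * f) = a * Φ i f := fun i a f => E.injective <| by
    refine Eq.trans ?_ (map_mul E a (Φ i f)).symm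
    change E (E.symm (Pi.single i _)) = E a * E (E.symm (Pi.single i _))
    rw [E.apply_symm_apply, E.apply_symm_apply]
    refine funext fun j => ?_
    by_cases hj : j = i
    · subst hj
      rw [Pi.mul_apply, Pi.single_eq_same, Pi.single_eq_same]
      rfl
    · rw [Pi.mul_apply, Pi.single_eq_of_ne hj, Pi.single_eq_of_ne hj, mul_zero]
  have hone : ∑ i, Φ i 1 = 1 := E.injective <| by
    change E (∑ i, E.symm (Pi.single i (1 : Module.End k (M i).V))) = _
    rw [map_sum, map_one]
    simp only [E.apply_symm_apply]
    exact Finset.univ_sum_single (1 : ∀ i, Module.End k (M i).V)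
  obtain ⟨i, hi⟩ : ∃ i, Φ i 1 • x ≠ 0 := by
    by_contra! h
    rw [← one_smul A x, ← hone, Finset.sum_smul] at hx
    exact hx (Finset.sum_eq_zero fun i _ => h i)
  let L : Module.Dual k (M i).V → (M i).carrier →ₗ[A] S.carrier := fun l =>
    { toFun := fun v => Φ i (LinearMap.smulRightₗ l (v : (M i).V)) • x
      map_add' := fun v w => by
        refine Eq.trans ?_ (add_smul (R := A) _ _ x)
        exact congrArg (· • x) (map_add (Φ i ∘ₗ LinearMap.smulRightₗ l) (v : (M i).V) w)
      map_smul' := fun a v => by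
        rw [RingHom.id_apply, ← mul_smul, ← hΦ]
        congr 2
        refine LinearMap.ext fun w => ?_
        exact (map_smul ((M i).ρ a) (l w) v).symm }
  refine ⟨i, ?_⟩
  by_contra! h
  refine hi ?_
  let b := Module.finBasis k (M i).V
  have hb : (1 : Module.End k (M i).V) = ∑ j, LinearMap.smulRightₗ (b.coord j) (b j) :=
    LinearMap.ext fun v => by
      rw [LinearMap.sum_apply]
      exact (b.sum_repr v).symm
  rw [hb, map_sum, Finset.sum_smul]
  exact Finset.sum_eq_zero fun j _ => LinearMap.congr_fun (f := L (b.coord j))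
    (congrArg toLinear (h (homOf (L (b.coord j))))) (b j)

/-- If `A` acts on a family of modules as the product of their endomorphism algebras, then these are
the simple modules. -/
theorem isSimpleFamily_of_bijective [Finite ι] [IsSemisimpleRing A] [Module.Finite k A] :
    IsSimpleFamily k M where
  end_scalar i f := by
    classical
    have hf : f.hom.hom.hom ∈ Subalgebra.center k (Module.End k (M i).V) := by
      rw [Subalgebra.mem_center_iff]
      intro g
      obtain ⟨a, ha⟩ := hM.2 (Pi.single i g)
      have ha' : (M i).ρ a = g := (congrFun ha i).trans
        (Pi.single_eq_same (M := fun i => Module.End k (M i).V) i g)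
      rw [← ha']
      exact (f.comm a).symm
    rw [Algebra.IsCentral.center_eq_bot] at hf
    obtain ⟨r, hr⟩ := Algebra.mem_bot.mp hf
    exact ⟨r, hom_ext (FGModuleCat.hom_ext hr.symm)⟩
  hom_eq_zero i j hij f := by
    classical
    obtain ⟨a, ha⟩ := hM.2 (Pi.single i 1)
    have h₁ : (M i).ρ a = 1 := (congrFun ha i).trans
        (Pi.single_eq_same (M := fun i => Module.End k (M i).V) i 1)
    have h₂ : (M j).ρ a = 0 := (congrFun ha j).trans
        (Pi.single_eq_of_ne (M := fun i => Module.End k (M i).V) hij.symm 1)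
    refine hom_ext (FGModuleCat.hom_ext ?_)
    have := f.comm a
    rw [h₁, h₂, LinearMap.zero_comp] at this
    exact this
  decomp N := by
    obtain ⟨n, s, hs, ⟨D⟩⟩ := N.exists_decomposition
    have : Limits.HasKernels (FDMod k A) := hasKernels_of_exists_abelian (exists_abelian k A)
    have key : ∀ t, ∃ i, Nonempty (s t ≅ M i) := fun t => by
      have := hs t
      obtain ⟨x, hx⟩ : ∃ x : (s t).carrier, x ≠ 0 := by
        by_contra! h
        exact id_nonzero (s t) (ext_toLinear h)
      obtain ⟨i, f, hf⟩ := exists_ne_zero_of_bijective hM hx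
      have : Simple (M i) := simple_of_bijective hM <| by
        by_contra hi
        rw [not_nontrivial_iff_subsingleton] at hi
        refine hf (ext_toLinear fun x => ?_)
        rw [Subsingleton.elim x 0, map_zero, map_zero]
      have := isIso_of_hom_simple hf
      exact ⟨i, ⟨(asIso f).symm⟩⟩
    choose ψ e using key
    exact ⟨D.changeFamily ψ fun t => (e t).some⟩

end FDMod

/-! ### Functoriality of the endomorphism algebra -/

namespace FusFib

variable {k : Type u} [Field k]

/-- The coalgebra structure of `A` is that of `End F`. -/
structure IsBialgEnd (X : FusFib k) {A : Type*} [Ring A] [Bialgebra k A]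
    (e : A ≃ₐ[k] End X.fib) : Prop where
  comul : ∀ (a : A) (c d : X.Cat),
    tensEnd (ev e c) (ev e d) (Coalgebra.comul (R := k) a) ≫ μ X.fib c d =
      μ X.fib c d ≫ ev e (c ⊗ d) a
  counit : ∀ a : A, ε X.fib ≫ ev e (𝟙_ X.Cat) a = Coalgebra.counit (R := k) a • ε X.fib

theorem _root_.EndIso.isBialgEnd {X : FusFib k} {A : HopfAlgCat.{u} k} (e : EndIso X A) :
    IsBialgEnd X e.iso where
  comul a c d := by
    obtain ⟨s, hs⟩ := TensorProduct.exists_finset (Coalgebra.comul (R := k) a)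
    refine Eq.trans ?_ (e.comul a s _ _ hs c d).symm
    rw [hs, map_sum]
    exact congrArg (· ≫ _) (Finset.sum_congr rfl fun i _ => tensEnd_tmul _ _ _ _)
  counit := e.counit

section

variable {X Y Z : FusFib k} {A B D : Type*} [Ring A] [Algebra k A] [Ring B] [Algebra k B] [Ring D]
  [Algebra k D] (e : A ≃ₐ[k] End X.fib) (e' : B ≃ₐ[k] End Y.fib) (m : FibCat.Mor X.obj Y.obj)

/-- The algebra homomorphism `η ↦ τ⁻¹ ∘ (η T) ∘ τ`. -/
def endPull : End Y.fib →ₐ[k] End X.fib where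
  toFun η := m.τ.hom ≫ Functor.whiskerLeft m.T η ≫ m.τ.inv
  map_one' := NatTrans.ext <| funext fun c => by
    change m.τ.hom.app c ≫ 𝟙 _ ≫ m.τ.inv.app c = 𝟙 _
    simp
  map_mul' η θ := NatTrans.ext <| funext fun c => by
    change m.τ.hom.app c ≫ (NatTrans.app θ _ ≫ NatTrans.app η _) ≫ m.τ.inv.app c =
      (m.τ.hom.app c ≫ NatTrans.app θ _ ≫ m.τ.inv.app c) ≫
        m.τ.hom.app c ≫ NatTrans.app η _ ≫ m.τ.inv.app c
    simp
  map_zero' := NatTrans.ext <| funext fun c => by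
    change m.τ.hom.app c ≫ 0 ≫ m.τ.inv.app c = 0
    simp
  map_add' η θ := NatTrans.ext <| funext fun c => by
    change m.τ.hom.app c ≫ (NatTrans.app η _ + NatTrans.app θ _) ≫ m.τ.inv.app c =
      m.τ.hom.app c ≫ NatTrans.app η _ ≫ m.τ.inv.app c +
        m.τ.hom.app c ≫ NatTrans.app θ _ ≫ m.τ.inv.app c
    rw [Preadditive.add_comp, Preadditive.comp_add]
  commutes' r := NatTrans.ext <| funext fun c => by
    change m.τ.hom.app c ≫ (r • 𝟙 _) ≫ m.τ.inv.app c = r • 𝟙 _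
    simp

/-- The homomorphism `η ↦ τ⁻¹ ∘ (η T) ∘ τ` of small models of the endomorphism algebras. -/
def endMap : B →ₐ[k] A := e.symm.toAlgHom.comp ((endPull m).comp e'.toAlgHom)

theorem ev_endMap (b : B) (c : X.Cat) : ev e c (endMap e e' m b) =
    m.τ.hom.app c ≫ ev e' (m.T.obj c) b ≫ m.τ.inv.app c := ev_symm e _ c

theorem ev_endMap_comp (b : B) (c : X.Cat) : ev e c (endMap e e' m b) ≫ m.τ.hom.app c =
    m.τ.hom.app c ≫ ev e' (m.T.obj c) b := by
  rw [ev_endMap]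
  simp

theorem endMap_eq_of_equiv {m m' : FibCat.Mor X.obj Y.obj} (h : (FibCat.Mor.setoid _ _).r m m') :
    endMap e e' m = endMap e e' m' := by
  obtain ⟨s, -⟩ := h
  refine AlgHom.ext fun b => ev_ext e fun c => ?_
  have h := NatTrans.congr_app s.comm c
  rw [← cancel_mono (m'.τ.hom.app c), ev_endMap_comp, ← h]
  change ev e c _ ≫ m.τ.hom.app c ≫ Y.fib.map (s.σ.app c) =
    (m.τ.hom.app c ≫ Y.fib.map (s.σ.app c)) ≫ ev e' _ b
  rw [← Category.assoc, ev_endMap_comp, Category.assoc, Category.assoc, ev_natural]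

end

section

variable [IsAlgClosed k] {X Y Z : FusFib k} {A B : Type*} [Ring A] [Bialgebra k A]
  [Ring B] [Bialgebra k B]
  {e : A ≃ₐ[k] End X.fib} {e' : B ≃ₐ[k] End Y.fib} (he : IsBialgEnd X e) (he' : IsBialgEnd Y e')
  (m : FibCat.Mor X.obj Y.obj)

include he he'

omit [IsAlgClosed k] in
theorem counit_endMap (b : B) : Coalgebra.counit (R := k) (endMap e e' m b) =
    Coalgebra.counit (R := k) b := by
  have h₁ := NatTrans.IsMonoidal.unit (τ := m.τ.hom)
  rw [Functor.LaxMonoidal.comp_ε] at h₁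
  have h₂ := congrArg (· ≫ m.τ.hom.app (𝟙_ _)) (he.counit (endMap e e' m b))
  have h₃ : ε X.fib ≫ m.τ.hom.app (𝟙_ _) ≫ ev e' (m.T.obj (𝟙_ _)) b =
      Coalgebra.counit (R := k) b • (ε X.fib ≫ m.τ.hom.app (𝟙_ _)) := by
    rw [reassoc_of% h₁, h₁, ← ev_natural, ← Category.assoc, he'.counit, Linear.smul_comp]
  simp only [Category.assoc, ev_endMap_comp, h₃, Linear.smul_comp] at h₂
  refine (smul_left_injective k
    (m := ε X.fib ≫ m.τ.hom.app (𝟙_ X.Cat)) (fun h => ?_) h₂).symm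
  have h₀ : (𝟙 (𝟙_ (FGModuleCat.{u} k))) = 0 := by
    have := congrArg (· ≫ m.τ.inv.app (𝟙_ X.Cat) ≫ Functor.OplaxMonoidal.η X.fib) h
    have h' : Functor.OplaxMonoidal.η X.fib = 0 := by simpa using this
    rw [← Functor.Monoidal.ε_η X.fib, h', Limits.comp_zero]
  exact one_ne_zero (α := k) (LinearMap.congr_fun (congrArg (fun f => f.hom.hom) h₀) (1 : k))

/-- The bialgebra homomorphism `η ↦ τ⁻¹ ∘ (η T) ∘ τ`. -/
def endBialgHom : B →ₐc[k] A :=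
  BialgHom.ofAlgHom (endMap e e' m) (AlgHom.ext (counit_endMap he he' m)) <| by
    ext b
    change Algebra.TensorProduct.map (endMap e e' m) (endMap e e' m) (Coalgebra.comul (R := k) b) =
      Coalgebra.comul (R := k) (endMap e e' m b)
    refine tensEnd_ext e e fun c d => ?_
    have h₁ := NatTrans.IsMonoidal.tensor (τ := m.τ.hom) c d
    rw [Functor.LaxMonoidal.comp_μ] at h₁
    have h₂ := tensEnd_natural (ρ := (ev e c).comp (endMap e e' m))
      (σ := (ev e d).comp (endMap e e' m)) (ρ' := ev e' (m.T.obj c)) (σ' := ev e' (m.T.obj d))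
      (m.τ.hom.app c) (m.τ.hom.app d)
      (fun b => ev_endMap_comp e e' m b c) (fun b => ev_endMap_comp e e' m b d)
      (Coalgebra.comul (R := k) b)
    have h₃ := he'.comul b (m.T.obj c) (m.T.obj d)
    rw [← cancel_mono (μ X.fib c d), he.comul, ← cancel_mono (m.τ.hom.app (c ⊗ d)),
      Category.assoc, Category.assoc, ev_endMap_comp, reassoc_of% h₁, h₁, tensEnd_map,
      ← Category.assoc]
    refine (congrArg (· ≫ _) h₂).trans ?_
    simp only [Category.assoc]
    rw [reassoc_of% h₃, ev_natural]

end

theorem isBialgEnd_endAlgEquiv [IsAlgClosed k] (X : FusFib k) : IsBialgEnd X X.endAlgEquiv :=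
  X.endHopfIso.isBialgEnd

/-- The functor `(C, F) ↦ End F`. -/
def endFunctor (k : Type u) [Field k] [IsAlgClosed k] : (FusFib k)ᵒᵖ ⥤ SSHopf k where
  obj X := X.unop.endHopf
  map {X Y} f := ObjectProperty.homMk <| HopfAlgCat.ofHom <|
    Quotient.lift (fun m => endBialgHom Y.unop.isBialgEnd_endAlgEquiv
      X.unop.isBialgEnd_endAlgEquiv m)
      (fun _ _ h => DFunLike.ext _ _ fun b => DFunLike.congr_fun (endMap_eq_of_equiv
        Y.unop.endAlgEquiv X.unop.endAlgEquiv h) b) f.unop.hom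
  map_id X := by
    refine ObjectProperty.hom_ext _ (HopfAlgCat.hom_ext _ _ (DFunLike.ext _ _ fun b => ?_))
    refine ev_ext X.unop.endAlgEquiv fun c => (ev_endMap _ _ (FibCat.Mor.id _) b c).trans ?_
    exact (Category.id_comp _).trans (Category.comp_id _)
  map_comp {X Y Z} f g := by
    obtain ⟨⟨⟨f⟩⟩⟩ := f
    obtain ⟨⟨⟨g⟩⟩⟩ := g
    refine ObjectProperty.hom_ext _ (HopfAlgCat.hom_ext _ _ (DFunLike.ext _ _ fun b => ?_))
    refine ev_ext Z.unop.endAlgEquiv fun c => ?_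
    refine (ev_endMap _ _ (FibCat.Mor.comp g f) b c).trans ?_
    refine Eq.trans ?_ (ev_endMap Z.unop.endAlgEquiv Y.unop.endAlgEquiv g _ c).symm
    refine Eq.trans ?_ (congrArg (g.τ.hom.app c ≫ · ≫ g.τ.inv.app c)
      (ev_endMap Y.unop.endAlgEquiv X.unop.endAlgEquiv f b (g.T.obj c))).symm
    simp
    rfl

theorem ev_endFunctor_map [IsAlgClosed k] {X Y : FusFib k} (f : X ⟶ Y) (m : FibCat.Mor X.obj Y.obj)
    (h : Represents m f) (a : Y.EndAlg) (c : X.Cat) :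
    ev X.endAlgEquiv c (((endFunctor k).map f.op).hom.toBialgHom a) =
      m.τ.hom.app c ≫ ev Y.endAlgEquiv (m.T.obj c) a ≫ m.τ.inv.app c := by
  obtain ⟨f⟩ := f
  obtain rfl : _ = f := h
  exact ev_endMap _ _ m a c

end FusFib

/-! ### The Hopf algebra of endomorphisms of a forgetful functor -/

namespace FDMod

variable {k : Type u} [Field k] {A : Type u} [Ring A] [Algebra k A]

/-- The action of `A` on the forgetful functor. -/
def actHom : A →ₐ[k] End (forget k A) where
  toFun a := { app := fun M => M.act a, naturality := fun _ _ f => (hom_act f a).symm }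
  map_one' := NatTrans.ext <| funext fun M => map_one M.act
  map_mul' a b := NatTrans.ext <| funext fun M => map_mul M.act a b
  map_zero' := NatTrans.ext <| funext fun M => map_zero M.act
  map_add' a b := NatTrans.ext <| funext fun M => map_add M.act a b
  commutes' r := NatTrans.ext <| funext fun M => M.act.commutes r

theorem actHom_bijective [Module.Finite k A] : Function.Bijective (actHom (k := k) (A := A)) := by
  refine ⟨fun a b h => ?_, fun η => ?_⟩
  · have := LinearMap.congr_fun (congrArg (fun f => f.hom.hom)
      (NatTrans.congr_app h (of k A A))) (1 : A)
    exact (mul_one a).symm.trans (Eq.trans this (mul_one b))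
  · let x : A := (NatTrans.app η (of k A A)).hom.hom (1 : A)
    refine ⟨x, NatTrans.ext <| funext fun M => FGModuleCat.hom_ext <| LinearMap.ext fun v => ?_⟩
    let f : of k A A ⟶ M := homOf (M := of k A A) (LinearMap.toSpanSingleton A M.carrier v)
    have h := LinearMap.congr_fun (congrArg (fun f => f.hom.hom) (NatTrans.naturality η f)) (1 : A)
    let w : M.carrier := v
    have h₁ : toLinear f (1 : A) = w := one_smul A w
    exact ((congrArg (NatTrans.app η M).hom.hom h₁).symm.trans h).symm

/-- `A` is the algebra of endomorphisms of its forgetful functor. -/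
def actEquiv [Module.Finite k A] : A ≃ₐ[k] End (forget k A) :=
  AlgEquiv.ofBijective actHom actHom_bijective

end FDMod

/-- The module category of a finite-dimensional semisimple Hopf algebra. -/
abbrev SSHopf.modFus {k : Type u} [Field k] (A : SSHopf k) : FusFib k :=
  ⟨modFib k A.obj, modFib_isFusion A⟩

instance {k : Type u} [Field k] (A : SSHopf k) : Module.Finite k A.obj := A.property.1
instance {k : Type u} [Field k] (A : SSHopf k) : IsSemisimpleRing A.obj := A.property.2

namespace SSHopf

variable {k : Type u} [Field k] (A : SSHopf k)

/-- The identification of `A` with the endomorphisms of its forgetful functor. -/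
def actEquiv : A.obj ≃ₐ[k] End A.modFus.fib := FDMod.actEquiv

theorem isBialgEnd_actEquiv : FusFib.IsBialgEnd A.modFus A.actEquiv where
  comul a M N := by
    refine (Category.comp_id _).trans ?_
    refine Eq.trans ?_ (Category.id_comp _).symm
    exact (FDMod.tensor_act M N a).symm
  counit a := by
    refine (Category.id_comp _).trans ?_
    rfl

end SSHopf

namespace SSHopf

variable {k : Type u} [Field k] [IsAlgClosed k] (A : SSHopf k)

/-- The isomorphism `A ≅ End (Forget_A)`. -/
def isoEnd : A ≅ A.modFus.endHopf where
  hom := ObjectProperty.homMk <| HopfAlgCat.ofHom <|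
    FusFib.endBialgHom A.modFus.isBialgEnd_endAlgEquiv A.isBialgEnd_actEquiv (FibCat.Mor.id _)
  inv := ObjectProperty.homMk <| HopfAlgCat.ofHom <|
    FusFib.endBialgHom A.isBialgEnd_actEquiv A.modFus.isBialgEnd_endAlgEquiv (FibCat.Mor.id _)
  hom_inv_id := by
    refine ObjectProperty.hom_ext _ (HopfAlgCat.hom_ext _ _ (DFunLike.ext _ _ fun b => ?_))
    refine ev_ext A.actEquiv fun c => ?_
    refine (FusFib.ev_endMap _ A.modFus.endAlgEquiv (FibCat.Mor.id _) _ c).trans ?_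
    refine ((Category.id_comp _).trans (Category.comp_id _)).trans ?_
    refine (FusFib.ev_endMap _ A.actEquiv (FibCat.Mor.id _) _ c).trans ?_
    exact (Category.id_comp _).trans (Category.comp_id _)
  inv_hom_id := by
    refine ObjectProperty.hom_ext _ (HopfAlgCat.hom_ext _ _ (DFunLike.ext _ _ fun b => ?_))
    refine ev_ext A.modFus.endAlgEquiv fun c => ?_
    refine (FusFib.ev_endMap _ A.actEquiv (FibCat.Mor.id _) _ c).trans ?_
    refine ((Category.id_comp _).trans (Category.comp_id _)).trans ?_
    refine (FusFib.ev_endMap _ A.modFus.endAlgEquiv (FibCat.Mor.id _) _ c).trans ?_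
    exact (Category.id_comp _).trans (Category.comp_id _)

theorem ev_isoEnd (a : A.obj) (M : FDMod k A.obj) :
    ev A.modFus.endAlgEquiv M (A.isoEnd.hom.hom.toBialgHom a) = M.act a :=
  (FusFib.ev_endMap _ A.actEquiv (FibCat.Mor.id _) _ M).trans
    ((Category.id_comp _).trans (Category.comp_id _))

end SSHopf

/-- The natural isomorphism `A ≅ End (Forget_A)`. -/
def unitNatIso (k : Type u) [Field k] [IsAlgClosed k] :
    𝟭 (SSHopf k) ≅ modSS k modFib_isFusion ⋙ FusFib.endFunctor k :=
  NatIso.ofComponents (fun A => A.isoEnd) fun {A B} f => by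
    refine ObjectProperty.hom_ext _ (HopfAlgCat.hom_ext _ _ (DFunLike.ext _ _ fun a => ?_))
    refine ev_ext B.modFus.endAlgEquiv fun M => ?_
    refine (B.ev_isoEnd _ M).trans ?_
    refine Eq.trans ?_ (FusFib.ev_endMap B.modFus.endAlgEquiv A.modFus.endAlgEquiv
      (modRestrict f.hom) _ M).symm
    refine Eq.trans ?_ ((Category.id_comp _).trans (Category.comp_id _)).symm
    exact (A.ev_isoEnd a ((modRestrict f.hom).T.obj M)).symm

/-! ### Isomorphisms over vector spaces -/

namespace FibCat

variable {k : Type u} [Field k] {X Y : FibCat k}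

theorem isMonoidal_of_inverseMonoidal {C D : Type*} [Category C] [Category D] [MonoidalCategory C]
    [MonoidalCategory D] (e : C ≌ D) [e.functor.Monoidal] :
    letI := e.inverseMonoidal
    e.IsMonoidal :=
  letI := e.toAdjunction.rightAdjointLaxMonoidal
  inferInstanceAs e.toAdjunction.IsMonoidal

/-- The inverse of an equivalence over vector spaces. -/
def Mor.inverse (m : Mor X Y) [m.T.IsEquivalence] : Mor Y X :=
  let e := m.T.asEquivalence
  have : e.functor.Additive := m.additive
  have : e.functor.Linear k := m.linear
  let _ : e.functor.Monoidal := m.monoidal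
  let _ : e.inverse.Monoidal := e.inverseMonoidal
  have : e.IsMonoidal := isMonoidal_of_inverseMonoidal e
  have : NatTrans.IsMonoidal e.counitIso.hom := inferInstanceAs (NatTrans.IsMonoidal e.counit)
  have : NatTrans.IsMonoidal (F₁ := e.functor ⋙ Y.F) m.τ.inv :=
    inferInstanceAs (NatTrans.IsMonoidal m.τ.inv)
  have : NatTrans.IsMonoidal (F₁ := e.inverse ⋙ e.functor ⋙ Y.F)
    (Functor.whiskerLeft e.inverse m.τ.inv) := NatTrans.IsMonoidal.whiskerLeft _
  { T := e.inverse
    τ := Y.F.leftUnitor.symm ≪≫ Functor.isoWhiskerRight e.counitIso.symm Y.F ≪≫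
      Functor.associator e.inverse e.functor Y.F ≪≫ Functor.isoWhiskerLeft e.inverse m.τ.symm
    isMonoidal := inferInstanceAs (NatTrans.IsMonoidal (Y.F.leftUnitor.inv ≫
      Functor.whiskerRight e.counitIso.inv Y.F ≫ (Functor.associator e.inverse e.functor Y.F).hom ≫
        Functor.whiskerLeft e.inverse m.τ.inv)) }

theorem Mor.isIso (m : Mor X Y) [m.T.IsEquivalence] [X.F.Faithful] [Y.F.Faithful] :
    @IsIso (FibCat k) _ X Y (Quotient.mk _ m) := by
  refine ⟨Quotient.mk _ m.inverse, ?_, ?_⟩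
  · refine Mor.sound (Mor.comp m m.inverse) (Mor.id X) m.T.asEquivalence.unitIso.symm fun c => ?_
    have h₁ := m.τ.inv.naturality (m.T.asEquivalence.unitIso.inv.app c)
    have h₂ : m.T.asEquivalence.counitIso.inv.app (m.T.obj c) ≫
        m.T.map (m.T.asEquivalence.unitIso.inv.app c) = 𝟙 _ :=
      m.T.asEquivalence.counitInv_functor_comp c
    have h₁' : m.τ.inv.app _ ≫ X.F.map (m.T.asEquivalence.unitIso.inv.app c) =
      Y.F.map (m.T.map (m.T.asEquivalence.unitIso.inv.app c)) ≫ m.τ.inv.app c := h₁.symm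
    have aux : ∀ {P Q R S : FGModuleCat.{u} k} {t : P ⟶ Q} {v : Q ⟶ R} {w : R ⟶ S} {x : S ⟶ P}
        {v' : R ⟶ Q} {w' : Q ⟶ P} (_ : w ≫ x = v' ≫ w') (_ : v ≫ v' = 𝟙 Q) (_ : t ≫ w' = 𝟙 P),
        (t ≫ (𝟙 Q ≫ v ≫ 𝟙 R ≫ w) ≫ 𝟙 S) ≫ x = 𝟙 P := fun h h' h'' => by
      simp [h, reassoc_of% h', h'']
    exact aux h₁' ((Y.F.map_comp _ _).symm.trans ((congrArg Y.F.map h₂).trans (Y.F.map_id _)))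
      (Iso.hom_inv_id_app m.τ c)
  · refine Mor.sound (Mor.comp m.inverse m) (Mor.id Y) m.T.asEquivalence.counitIso fun c => ?_
    have aux : ∀ {P Q R : FGModuleCat.{u} k} {v : P ⟶ Q} {w : Q ⟶ R} {w' : R ⟶ Q} {x : Q ⟶ P}
        (_ : w ≫ w' = 𝟙 Q) (_ : v ≫ x = 𝟙 P),
        ((𝟙 P ≫ v ≫ 𝟙 Q ≫ w) ≫ w' ≫ 𝟙 Q) ≫ x = 𝟙 P := fun h h' => by
      simp [reassoc_of% h, h']
    exact aux (Iso.inv_hom_id_app m.τ _) ((Y.F.map_comp _ _).symm.trans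
      ((congrArg Y.F.map (m.T.asEquivalence.counitIso.inv_hom_id_app c)).trans (Y.F.map_id _)))

end FibCat

/-! ### The reconstruction functor -/

namespace EndIso

variable {k : Type u} [Field k] {X : FusFib k} {A : HopfAlgCat.{u} k} (e : EndIso X A)

instance : e.functor.Faithful where
  map_injective h := X.fib.map_injective (congrArg FDMod.Hom.hom h)

instance : e.functor.Additive where
  map_add {_ _ f g} := FDMod.hom_ext (X.fib.map_add (f := f) (g := g))

instance : e.functor.Linear k where
  map_smul f r := FDMod.hom_ext (Functor.Linear.map_smul (F := X.fib) f r)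

instance : e.functor.Monoidal :=
  Functor.CoreMonoidal.toMonoidal
    { εIso := FDMod.isoMk (M := 𝟙_ (FDMod k A)) (N := e.functor.obj (𝟙_ _))
        (Functor.Monoidal.εIso X.fib) fun a => by
          rw [FDMod.unit_act]
          refine (Linear.smul_comp ..).trans ?_
          exact (congrArg _ (Category.id_comp _)).trans (e.isBialgEnd.counit a).symm
      μIso := fun c d => FDMod.isoMk (M := e.functor.obj c ⊗ e.functor.obj d)
        (N := e.functor.obj (c ⊗ d)) (Functor.Monoidal.μIso X.fib c d) fun a => by
          rw [FDMod.tensor_act]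
          exact e.isBialgEnd.comul a c d
      μIso_hom_natural_left := fun f c => FDMod.hom_ext (μ_natural_left X.fib f c)
      μIso_hom_natural_right := fun c f => FDMod.hom_ext (μ_natural_right X.fib c f)
      associativity := fun c d f => FDMod.hom_ext (associativity X.fib c d f)
      left_unitality := fun c => FDMod.hom_ext (left_unitality X.fib c)
      right_unitality := fun c => FDMod.hom_ext (right_unitality X.fib c) }

/-- The functor to modules over the endomorphism algebra, as a morphism over vector spaces. -/
def mor : FibCat.Mor X.obj (modFib k A) where
  T := e.functor
  τ := NatIso.ofComponents (fun c => Iso.refl _) fun f =>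
    (Category.comp_id _).trans (Category.id_comp _).symm
  isMonoidal :=
    { unit := by
        refine (Category.comp_id _).trans ?_
        exact (Category.id_comp (ε X.fib)).symm
      tensor := fun c d => by
        refine (Category.comp_id _).trans ?_
        refine Eq.trans ?_ (congrArg (· ≫ _) (MonoidalCategory.id_tensorHom_id _ _)).symm
        exact ((Category.id_comp _).trans (Category.id_comp (μ X.fib c d))).symm }

variable [IsAlgClosed k]

theorem isSimpleFamily [Module.Finite k A] [IsSemisimpleRing A] :
    IsSimpleFamily k fun i => e.functor.obj (X.simples i) := by
  refine FDMod.isSimpleFamily_of_bijective (FDMod.actPi_bijective ?_)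
  exact ((X.isSimpleFamily.endEquiv X.fib).symm.bijective).comp e.iso.bijective

theorem isEquivalence [Module.Finite k A] [IsSemisimpleRing A] : e.functor.IsEquivalence where
  full := IsSimpleFamily.full e.functor X.isSimpleFamily.decomp e.isSimpleFamily
  essSurj :=
    have := X.property.1.semisimple.hasFiniteBiproducts
    Decomposition.essSurj e.functor e.isSimpleFamily.decomp

end EndIso

namespace FusFib

variable {k : Type u} [Field k] [IsAlgClosed k]

/-- The isomorphism between `(C, F)` and modules over `End F`. -/
def isoMod (X : FusFib k) : X ≅ X.endHopf.modFus :=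
  have := X.endHopfIso.isEquivalence
  have : X.endHopfIso.mor.T.IsEquivalence := this
  have h := FibCat.Mor.isIso X.endHopfIso.mor
  (FibCat.isFusion k).isoMk (@asIso (FibCat k) _ _ _ (Quotient.mk _ X.endHopfIso.mor) h)

end FusFib

/-- The natural isomorphism `(C, F) ≅ (Mod (End F), Forget)`. -/
def counitNatIso (k : Type u) [Field k] [IsAlgClosed k] :
    FusFib.endFunctor k ⋙ modSS k modFib_isFusion ≅ 𝟭 (FusFib k)ᵒᵖ :=
  NatIso.ofComponents (fun X => X.unop.isoMod.op) fun {X Y} f => by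
    obtain ⟨⟨⟨m⟩⟩⟩ := f
    refine Quiver.Hom.unop_inj (ObjectProperty.hom_ext _ ?_)
    refine FibCat.Mor.sound (FibCat.Mor.comp Y.unop.endHopfIso.mor (modRestrict _))
      (FibCat.Mor.comp m X.unop.endHopfIso.mor) (NatIso.ofComponents (fun c =>
        FDMod.isoMk (M := (FDMod.restrict _).obj (Y.unop.endHopfIso.functor.obj c))
          (N := X.unop.endHopfIso.functor.obj (m.T.obj c)) (m.τ.app c) fun a =>
            FusFib.ev_endMap_comp Y.unop.endAlgEquiv X.unop.endAlgEquiv m a c)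
        fun f => FDMod.hom_ext (m.τ.hom.naturality f)) fun c => ?_
    have aux : ∀ {P Q : FGModuleCat.{u} k} (t : P ⟶ Q),
        (𝟙 P ≫ 𝟙 P ≫ 𝟙 P) ≫ t = t ≫ 𝟙 Q ≫ 𝟙 Q := fun t => by simp
    exact aux (m.τ.hom.app c)

/-- Reconstruction of semisimple Hopf algebras. -/
def reconstruction (k : Type u) [Field k] [IsAlgClosed k] : Reconstruction k where
  fusion := modFib_isFusion
  Q := FusFib.endFunctor k
  endIso X := X.endHopfIso
  endIso_map f m h a c := FusFib.ev_endFunctor_map f m h a c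
  γ := unitNatIso k
  γ_apply A a M := congrArg (fun f => f.hom.hom) (A.ev_isoEnd a M)
  ζ := counitNatIso k
  ζ_represents X m h := by
    obtain ⟨s, hs⟩ := Quotient.exact h
    refine ⟨@asIso _ _ _ _ s.σ hs, fun c => ?_⟩
    have := NatTrans.congr_app s.comm c
    exact this
  triangle A := by
    refine Quiver.Hom.unop_inj (ObjectProperty.hom_ext _ ?_)
    refine FibCat.Mor.sound (FibCat.Mor.comp A.modFus.endHopfIso.mor (modRestrict A.isoEnd.hom.hom))
      (FibCat.Mor.id _) (NatIso.ofComponents (fun M =>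
        FDMod.isoMk (M := (FDMod.restrict _).obj (A.modFus.endHopfIso.functor.obj M))
          (N := M) (Iso.refl _) fun a => by
            refine (Category.comp_id _).trans (Eq.trans ?_ (Category.id_comp _).symm)
            exact A.ev_isoEnd a M)
        fun f => FDMod.hom_ext ((Category.comp_id _).trans (Category.id_comp _).symm)) fun c => ?_
    have aux : ∀ {P : FGModuleCat.{u} k}, (𝟙 P ≫ 𝟙 P ≫ 𝟙 P) ≫ 𝟙 P = 𝟙 P := by simp
    exact aux

/-! ### Rigidity of the slice category -/

theorem balanced_of_exists_abelian {C : Type w} [Category.{v} C] [P : Preadditive C]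
    (h : ∃ a : Abelian C, a.toPreadditive = P) : Balanced C := by
  obtain ⟨a, rfl⟩ := h
  infer_instance

namespace FusFib

variable {k : Type u} [Field k] {X Y : FusFib k} {m m' : FibCat.Mor X.obj Y.obj}

theorem twoMor_ext (s t : FibCat.TwoMor m m') : s.σ = t.σ := by
  ext c
  refine Y.fib.map_injective ((cancel_epi (m.τ.hom.app c)).mp ?_)
  exact (NatTrans.congr_app s.comm c).trans (NatTrans.congr_app t.comm c).symm

theorem isIso_twoMor (s : FibCat.TwoMor m m') : IsIso s.σ := by
  have := balanced_of_exists_abelian Y.property.1.semisimple.abelian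
  have : ∀ c, IsIso (s.σ.app c) := fun c => by
    have h : m.τ.hom.app c ≫ Y.fib.map (s.σ.app c) = m'.τ.hom.app c := NatTrans.congr_app s.comm c
    have : Y.fib.map (s.σ.app c) = inv (m.τ.hom.app c) ≫ m'.τ.hom.app c := by
      rw [← h, IsIso.inv_hom_id_assoc]
    have : IsIso (Y.fib.map (s.σ.app c)) := by
      rw [this]
      infer_instance
    exact isIso_of_reflects_iso (s.σ.app c) Y.fib
  exact NatIso.isIso_of_isIso_app s.σ

end FusFib

/-! ### Bilinear bifunctors and simple families -/

section Bilinear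

variable {k : Type u} [Field k] {C D E : Type (u + 1)} [Category.{u} C] [Category.{u} D]
  [Category.{u} E] [Preadditive C] [Preadditive D] [Preadditive E] [Linear k C] [Linear k D]
  [Linear k E]

theorem IsBilinear.curry_additive {G : C × D ⥤ E} (hG : IsBilinear k G) :
    (Functor.curry.obj G).Additive where
  map_add {_ _ f g} := NatTrans.ext <| funext fun d =>
    (hG.additive_left d).map_add (f := f) (g := g)

theorem IsBilinear.curry_linear {G : C × D ⥤ E} (hG : IsBilinear k G) :
    (Functor.curry.obj G).Linear k where
  map_smul f r := NatTrans.ext <| funext fun d => (hG.linear_left d).map_smul f r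

theorem IsBilinear.comp {M : Type (u + 1)} [Category.{u} M] [Preadditive M] [Linear k M]
    {G : C × D ⥤ M} (hG : IsBilinear k G) (H : M ⥤ E) [H.Additive] [H.Linear k] :
    IsBilinear k (G ⋙ H) where
  additive_left d :=
    have := hG.additive_left d
    inferInstanceAs ((Functor.curry.obj G).flip.obj d ⋙ H).Additive
  linear_left d :=
    have := hG.linear_left d
    inferInstanceAs (((Functor.curry.obj G).flip.obj d ⋙ H).Linear k)
  additive_right c :=
    have := hG.additive_right c
    inferInstanceAs ((Functor.curry.obj G).obj c ⋙ H).Additive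
  linear_right c :=
    have := hG.linear_right c
    inferInstanceAs (((Functor.curry.obj G).obj c ⋙ H).Linear k)

variable {ι κ : Type*} {s : ι → C} {s' : κ → D}

theorem IsBilinear.natTrans_ext {G G' : C × D ⥤ E} (hG : IsBilinear k G)
    (hs : ∀ c, Nonempty (Decomposition s c)) (hs' : ∀ d, Nonempty (Decomposition s' d))
    {α β : G ⟶ G'} (h : ∀ i j, α.app (s i, s' j) = β.app (s i, s' j)) : α = β := by
  have := hG.curry_additive
  have h' : Functor.curry.map α = Functor.curry.map β :=
    Decomposition.natTrans_ext hs fun i =>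
      have := hG.additive_right (s i)
      Decomposition.natTrans_ext hs' fun j => h i j
  ext x
  exact NatTrans.congr_app (NatTrans.congr_app h' x.1) x.2

theorem IsBilinear.exists_natTrans {G G' : C × D ⥤ E} (hG : IsBilinear k G) (hG' : IsBilinear k G')
    (hs : IsSimpleFamily k s) (hs' : IsSimpleFamily k s')
    (θ : ∀ i j, G.obj (s i, s' j) ⟶ G'.obj (s i, s' j)) :
    ∃ α : G ⟶ G', ∀ i j, α.app (s i, s' j) = θ i j := by
  have := hG.curry_additive
  have := hG'.curry_additive
  have := hG.curry_linear
  have := hG'.curry_linear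
  have := hG.additive_right
  have := hG'.additive_right
  have := hG.linear_right
  have := hG'.linear_right
  let θ' : ∀ i, (Functor.curry.obj G).obj (s i) ⟶ (Functor.curry.obj G').obj (s i) := fun i =>
    Decomposition.extendNat hs'.decomp _ _ (θ i)
      (hs'.comm ((Functor.curry.obj G).obj (s i)) ((Functor.curry.obj G').obj (s i)) (θ i))
  let α' : Functor.curry.obj G ⟶ Functor.curry.obj G' :=
    Decomposition.extendNat hs.decomp _ _ θ' (hs.comm _ _ θ')
  have hα' : ∀ i, α'.app (s i) = θ' i := Decomposition.extendNat_app hs.decomp _ _ θ' _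
  have hθ' : ∀ i j, (θ' i).app (s' j) = θ i j := fun i j =>
    Decomposition.extendNat_app hs'.decomp ((Functor.curry.obj G).obj (s i))
      ((Functor.curry.obj G').obj (s i)) (θ i) _ j
  refine ⟨{ app := fun x => (α'.app x.1).app x.2, naturality := fun x y f => ?_ }, fun i j =>
    (NatTrans.congr_app (hα' i) (s' j)).trans (hθ' i j)⟩
  have h₁ := NatTrans.congr_app (α'.naturality f.1) y.2
  have h₂ := (α'.app x.1).naturality f.2
  have h₃ : ∀ G : C × D ⥤ E, G.map f = G.map ((𝟙 x.1, f.2) : x ⟶ (x.1, y.2)) ≫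
      G.map ((f.1, 𝟙 y.2) : (x.1, y.2) ⟶ y) := fun G => by
    rw [← G.map_comp]
    congr 1
    ext <;> simp
  rw [h₃ G, h₃ G', Category.assoc]
  refine (congrArg (_ ≫ ·) h₁).trans ?_
  exact (Category.assoc _ _ _).symm.trans ((congrArg (· ≫ _) h₂).trans (Category.assoc _ _ _))

theorem IsBilinear.nonempty_iso {G G' : C × D ⥤ E} (hG : IsBilinear k G) (hG' : IsBilinear k G')
    (hs : IsSimpleFamily k s) (hs' : IsSimpleFamily k s')
    (θ : ∀ i j, G.obj (s i, s' j) ≅ G'.obj (s i, s' j)) : Nonempty (G ≅ G') := by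
  obtain ⟨α, hα⟩ := hG.exists_natTrans hG' hs hs' fun i j => (θ i j).hom
  obtain ⟨β, hβ⟩ := hG'.exists_natTrans hG hs hs' fun i j => (θ i j).inv
  exact ⟨⟨α, β, hG.natTrans_ext hs.decomp hs'.decomp fun i j => by simp [hα, hβ],
    hG'.natTrans_ext hs.decomp hs'.decomp fun i j => by simp [hα, hβ]⟩⟩

end Bilinear

/-! ### Linear functors with given values on the simple objects -/

namespace IsSimpleFamily

variable {k : Type u} [Field k] {M : Type*} [Category M] [Preadditive M] [Linear k M] {ι : Type*}
  {σ : ι → M} (h : IsSimpleFamily k σ) (h0 : ∀ i, 𝟙 (σ i) ≠ 0)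

/-- The scalar given by an endomorphism of a simple object. -/
def coeff (i : ι) (f : σ i ⟶ σ i) : k := (h.end_scalar i f).choose

theorem coeff_smul (i : ι) (f : σ i ⟶ σ i) : h.coeff i f • 𝟙 (σ i) = f :=
  (h.end_scalar i f).choose_spec.symm

include h0 in
theorem coeff_eq {i : ι} {f : σ i ⟶ σ i} {r : k} (hr : f = r • 𝟙 (σ i)) : h.coeff i f = r :=
  smul_left_injective k (h0 i) ((h.coeff_smul i f).trans hr)

variable {E : Type*} [Category E] [Preadditive E] [Linear k E] (e : ι → E)

open Classical in
/-- The action of a functor with `σ i ↦ e i` on morphisms. -/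
def mapSimple (i j : ι) (f : σ i ⟶ σ j) : e i ⟶ e j :=
  if hij : i = j then h.coeff i (f ≫ eqToHom (by rw [hij])) • eqToHom (by rw [hij]) else 0

theorem mapSimple_self (i : ι) (f : σ i ⟶ σ i) : h.mapSimple e i i f = h.coeff i f • 𝟙 (e i) := by
  simp [mapSimple]

theorem mapSimple_ne {i j : ι} (hij : i ≠ j) (f : σ i ⟶ σ j) : h.mapSimple e i j f = 0 := by
  simp [mapSimple, hij]

include h h0

theorem mapSimple_id (i : ι) : h.mapSimple e i i (𝟙 _) = 𝟙 _ := by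
  rw [mapSimple_self, h.coeff_eq h0 (one_smul k _).symm, one_smul]

theorem mapSimple_add (i j : ι) (f g : σ i ⟶ σ j) :
    h.mapSimple e i j (f + g) = h.mapSimple e i j f + h.mapSimple e i j g := by
  by_cases hij : i = j
  · subst hij
    rw [mapSimple_self, mapSimple_self, mapSimple_self, ← add_smul,
      h.coeff_eq h0 (r := h.coeff i f + h.coeff i g)]
    rw [add_smul, coeff_smul, coeff_smul]
  · simp [h.mapSimple_ne e hij]

theorem mapSimple_smul (i j : ι) (r : k) (f : σ i ⟶ σ j) :
    h.mapSimple e i j (r • f) = r • h.mapSimple e i j f := by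
  by_cases hij : i = j
  · subst hij
    rw [mapSimple_self, mapSimple_self, smul_smul, h.coeff_eq h0 (r := r * h.coeff i f)]
    rw [mul_smul, coeff_smul]
  · simp [h.mapSimple_ne e hij]

theorem mapSimple_comp (i j l : ι) (f : σ i ⟶ σ j) (g : σ j ⟶ σ l) :
    h.mapSimple e i l (f ≫ g) = h.mapSimple e i j f ≫ h.mapSimple e j l g := by
  by_cases hij : i = j
  · subst hij
    by_cases hil : i = l
    · subst hil
      rw [mapSimple_self, mapSimple_self, mapSimple_self,
        h.coeff_eq h0 (r := h.coeff i f * h.coeff i g)]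
      · simp [smul_smul, mul_comm]
      · calc f ≫ g = (h.coeff i f • 𝟙 _) ≫ (h.coeff i g • 𝟙 _) := by rw [coeff_smul, coeff_smul]
          _ = _ := by simp [smul_smul, mul_comm]
    · simp [h.mapSimple_ne e hil]
  · have h₀ : h.mapSimple e i l 0 = 0 := by
      have := h.mapSimple_smul h0 e i l (0 : k) 0
      simpa using this
    rw [h.hom_eq_zero i j hij f, Limits.zero_comp, h₀, h.mapSimple_ne e hij, Limits.zero_comp]

theorem mapSimple_sum {n : ℕ} (i j : ι) (f : Fin n → (σ i ⟶ σ j)) :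
    h.mapSimple e i j (∑ t, f t) = ∑ t, h.mapSimple e i j (f t) :=
  map_sum (AddMonoidHom.mk' (h.mapSimple e i j) (h.mapSimple_add h0 e i j)) f _

variable [Limits.HasFiniteBiproducts E]

/-- There is a linear functor with given values on the simple objects. -/
theorem exists_functor : ∃ H : M ⥤ E, H.Additive ∧ H.Linear k ∧
    ∀ i, Nonempty (H.obj (σ i) ≅ e i) := by
  let D : ∀ m, Decomposition σ m := fun m => (h.decomp m).some
  let L := h.mapSimple e
  let N : ∀ {m m' : M} (f : m ⟶ m') (t : Fin (D m).n) (v : Fin (D m').n),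
      e ((D m).φ t) ⟶ e ((D m').φ v) := fun f t v => L _ _ ((D _).i t ≫ f ≫ (D _).p v)
  have hN1 : ∀ m (t v : Fin (D m).n), t ≠ v → N (𝟙 m) t v = 0 := fun m t v htv => by
    have := h.mapSimple_smul h0 e ((D m).φ t) ((D m).φ v) (0 : k) 0
    simp only [N, L, Category.id_comp, (D m).i_p_ne t v htv]
    simpa using this
  have hN1' : ∀ m (t : Fin (D m).n), N (𝟙 m) t t = 𝟙 _ := fun m t => by
    simp only [N, L, Category.id_comp, (D m).i_p t]
    exact h.mapSimple_id h0 e _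
  have hNc : ∀ {m m' m'' : M} (f : m ⟶ m') (g : m' ⟶ m'') t v,
      ∑ w, N f t w ≫ N g w v = N (f ≫ g) t v := fun {m m' m''} f g t v => by
    simp only [N, L, ← h.mapSimple_comp h0 e, ← h.mapSimple_sum h0 e]
    congr 1
    calc _ = (D m).i t ≫ f ≫ (∑ w, (D m').p w ≫ (D m').i w) ≫ g ≫ (D m'').p v := by
          simp only [Preadditive.sum_comp, Preadditive.comp_sum, Category.assoc]
      _ = _ := by rw [(D m').total]; simp
  let H : M ⥤ E :=
    { obj := fun m => ⨁ fun t => e ((D m).φ t)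
      map := fun f => Limits.biproduct.matrix (N f)
      map_id := fun m => by
        refine Limits.biproduct.hom_ext _ _ fun v => Limits.biproduct.hom_ext' _ _ fun t => ?_
        by_cases htv : t = v
        · subst htv
          simp [hN1']
        · simp [hN1 m t v htv, Limits.biproduct.ι_π_ne _ htv]
      map_comp := fun f g => by
        refine Limits.biproduct.hom_ext _ _ fun v => Limits.biproduct.hom_ext' _ _ fun t => ?_
        rw [Limits.biproduct.matrix_π, Limits.biproduct.ι_desc, Category.assoc,
          Limits.biproduct.ι_matrix_assoc, Limits.biproduct.lift_matrix_assoc,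
          Limits.biproduct.lift_π, hNc] }
  have hL : ∀ i (t v : Fin (D (σ i)).n), L _ _ ((D (σ i)).i t) ≫ L _ _ ((D (σ i)).p v) =
      N (𝟙 (σ i)) t v := fun i t v => by
    simp only [N, L, ← h.mapSimple_comp h0 e, Category.id_comp]
  refine ⟨H, ⟨fun {m m' f g} => ?_⟩, ⟨fun {m m'} f r => ?_⟩, fun i => ⟨?_⟩⟩
  · refine Limits.biproduct.hom_ext _ _ fun v => Limits.biproduct.hom_ext' _ _ fun t => ?_
    simp [H, N, L, h.mapSimple_add h0]
  · refine Limits.biproduct.hom_ext _ _ fun v => Limits.biproduct.hom_ext' _ _ fun t => ?_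
    simp [H, N, L, h.mapSimple_smul h0]
  · exact
      { hom := Limits.biproduct.desc fun t => L _ _ ((D (σ i)).i t)
        inv := Limits.biproduct.lift fun t => L _ _ ((D (σ i)).p t)
        hom_inv_id := by
          refine Limits.biproduct.hom_ext _ _ fun v => Limits.biproduct.hom_ext' _ _ fun t => ?_
          simp only [Category.assoc]
          rw [Limits.biproduct.ι_desc_assoc, Limits.biproduct.lift_π, hL]
          by_cases htv : t = v
          · subst htv
            simp [H, hN1']
          · simp [H, hN1 _ t v htv, Limits.biproduct.ι_π_ne _ htv]
        inv_hom_id := by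
          rw [Limits.biproduct.lift_desc]
          simp only [L, ← h.mapSimple_comp h0 e, ← h.mapSimple_sum h0 e, (D (σ i)).total,
            h.mapSimple_id h0 e] }

end IsSimpleFamily

section Deligne

variable {k : Type u} [Field k] {C D M : Type (u + 1)} [Category.{u} C] [Category.{u} D]
  [Category.{u} M] [Preadditive C] [Preadditive D] [Preadditive M] [Linear k C] [Linear k D]
  [Linear k M]

/-- A bilinear bifunctor which is a bijection on simple objects is a Deligne product. -/
theorem IsBilinear.isDeligneProduct {B : C × D ⥤ M} (hB : IsBilinear k B) {ι κ : Type*} {s : ι → C}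
    {s' : κ → D} (hs : IsSimpleFamily k s) (hs' : IsSimpleFamily k s')
    (h : IsSimpleFamily k fun x : ι × κ => B.obj (s x.1, s' x.2))
    (h0 : ∀ i j, 𝟙 (B.obj (s i, s' j)) ≠ 0) : IsDeligneProduct k B where
  bilinear := hB
  exists_lift E _ _ _ hE G hG := by
    have := hE.hasFiniteBiproducts
    obtain ⟨H, hH, hH', e⟩ := h.exists_functor (fun x => h0 x.1 x.2)
      fun x : ι × κ => G.obj (s x.1, s' x.2)
    exact ⟨H, hH, hH', (hB.comp H).nonempty_iso hG hs hs' fun i j =>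
      (e (i, j)).some⟩
  whisker_bijective E _ _ _ hE H H' _ _ _ _ := by
    refine ⟨fun t t' htt => Decomposition.natTrans_ext h.decomp fun x =>
      NatTrans.congr_app htt (s x.1, s' x.2), fun β => ?_⟩
    refine ⟨Decomposition.extendNat h.decomp H H' (fun x => β.app (s x.1, s' x.2))
      (h.comm H H' _), (hB.comp H).natTrans_ext hs.decomp hs'.decomp fun i j => ?_⟩
    change (Decomposition.extendNat h.decomp H H' (fun x => β.app (s x.1, s' x.2))
      (h.comm H H' _)).app (B.obj (s i, s' j)) = β.app (s i, s' j)
    exact Decomposition.extendNat_app h.decomp H H' (fun x => β.app (s x.1, s' x.2)) _ (i, j)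

end Deligne

/-! ### Actions on tensor products and the interchange of factors -/

section

variable {k : Type u} [Field k] {C : Type w} [Category.{v} C] [Preadditive C] [Linear k C]
  [MonoidalCategory C] [MonoidalPreadditive C] [MonoidalLinear k C] [BraidedCategory C]
  {A B A' B' : Type*} [Ring A] [Algebra k A] [Ring B] [Algebra k B] [Ring A'] [Algebra k A']
  [Ring B'] [Algebra k B']

theorem tensEnd_tensorμ {V W V' W' : C} (ρ : A →ₐ[k] End V) (σ : B →ₐ[k] End W)
    (ρ' : A' →ₐ[k] End V') (σ' : B' →ₐ[k] End W') (t : (A ⊗[k] A') ⊗[k] (B ⊗[k] B')) :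
    tensEnd (tensEnd ρ σ) (tensEnd ρ' σ') (TensorProduct.tensorTensorTensorComm k A A' B B' t) ≫
        tensorμ V W V' W' =
      tensorμ V W V' W' ≫ tensEnd (tensEnd ρ ρ') (tensEnd σ σ') t := by
  induction t with
  | zero =>
    simp only [map_zero]
    exact Limits.zero_comp.trans Limits.comp_zero.symm
  | add x y hx hy =>
    simp only [map_add]
    exact (Preadditive.add_comp ..).trans ((congrArg₂ (· + ·) hx hy).trans
      (Preadditive.comp_add ..).symm)
  | tmul x y =>
    induction x with
    | zero =>
      simp only [TensorProduct.zero_tmul, map_zero]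
      exact Limits.zero_comp.trans Limits.comp_zero.symm
    | add x y hx hy =>
      simp only [TensorProduct.add_tmul, map_add]
      exact (Preadditive.add_comp ..).trans ((congrArg₂ (· + ·) hx hy).trans
        (Preadditive.comp_add ..).symm)
    | tmul a a' =>
      induction y with
      | zero =>
        simp only [TensorProduct.tmul_zero, map_zero]
        exact Limits.zero_comp.trans Limits.comp_zero.symm
      | add x y hx hy =>
        simp only [TensorProduct.tmul_add, map_add]
        exact (Preadditive.add_comp ..).trans ((congrArg₂ (· + ·) hx hy).trans
          (Preadditive.comp_add ..).symm)
      | tmul b b' =>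
        simp only [TensorProduct.tensorTensorTensorComm_tmul, tensEnd_tmul]
        exact tensorμ_natural _ _ _ _

end

namespace FusFib

variable {k : Type u} [Field k]

/-- The functor `F ⊗ F'` on pairs of objects. -/
abbrev fib₂ (X Y : FusFib k) : X.Cat × Y.Cat ⥤ FGModuleCat.{u} k :=
  X.fib.prod Y.fib ⋙ tensor (FGModuleCat.{u} k)

section

variable {X Y : FusFib k} {A B : Type*} [Ring A] [Bialgebra k A] [Ring B] [Bialgebra k B]
  {e : A ≃ₐ[k] End X.fib} {e' : B ≃ₐ[k] End Y.fib}

theorem fib₂_μ (c c' : X.Cat) (d d' : Y.Cat) : μ (X.fib₂ Y) (c, d) (c', d') =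
    tensorμ _ _ _ _ ≫ (μ X.fib c c' ⊗ₘ μ Y.fib d d') := rfl

theorem fib₂_ε : ε (X.fib₂ Y) = (λ_ (𝟙_ (FGModuleCat.{u} k))).inv ≫ (ε X.fib ⊗ₘ ε Y.fib) := rfl

theorem tensEnd_comul (he : IsBialgEnd X e) (he' : IsBialgEnd Y e') (t : A ⊗[k] B) (c c' : X.Cat)
    (d d' : Y.Cat) :
    tensEnd (tensEnd (ev e c) (ev e' d)) (tensEnd (ev e c') (ev e' d'))
        (Coalgebra.comul (R := k) t) ≫ μ (X.fib₂ Y) (c, d) (c', d') =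
      μ (X.fib₂ Y) (c, d) (c', d') ≫ tensEnd (ev e (c ⊗ c')) (ev e' (d ⊗ d')) t := by
  have h₁ := tensEnd_tensorμ (ev e c) (ev e' d) (ev e c') (ev e' d')
    (Algebra.TensorProduct.map (Bialgebra.comulAlgHom k A) (Bialgebra.comulAlgHom k B) t)
  have h₂ := tensEnd_natural (ρ := (tensEnd (ev e c) (ev e c')).comp (Bialgebra.comulAlgHom k A))
    (σ := (tensEnd (ev e' d) (ev e' d')).comp (Bialgebra.comulAlgHom k B))
    (ρ' := ev e (c ⊗ c')) (σ' := ev e' (d ⊗ d')) (μ X.fib c c') (μ Y.fib d d')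
    (fun a => he.comul a c c') (fun b => he'.comul b d d') t
  rw [tensEnd_map] at h₁
  rw [fib₂_μ, Category.assoc, ← h₂, ← Category.assoc]
  exact (congrArg (· ≫ _) h₁).trans (Category.assoc _ _ _)

theorem tensEnd_counit (he : IsBialgEnd X e) (he' : IsBialgEnd Y e') (t : A ⊗[k] B) :
    ε (X.fib₂ Y) ≫ tensEnd (ev e (𝟙_ X.Cat)) (ev e' (𝟙_ Y.Cat)) t =
      Coalgebra.counit (R := k) t • ε (X.fib₂ Y) := by
  induction t with
  | zero =>
    simp only [map_zero, zero_smul]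
    exact Limits.comp_zero
  | add x y hx hy =>
    simp only [map_add, add_smul, ← hx, ← hy]
    exact Preadditive.comp_add ..
  | tmul a b =>
    rw [tensEnd_tmul, TensorProduct.counit_tmul, fib₂_ε, Category.assoc]
    refine (congrArg (_ ≫ ·) (tensorHom_comp_tensorHom _ _ _ _)).trans ?_
    rw [he.counit, he'.counit, MonoidalCategory.tensorHom_def, MonoidalLinear.smul_whiskerRight,
      MonoidalLinear.whiskerLeft_smul, Linear.smul_comp, Linear.comp_smul, Linear.comp_smul,
      Linear.comp_smul, smul_smul, smul_eq_mul, mul_comm, ← MonoidalCategory.tensorHom_def]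

end

section

variable [IsAlgClosed k] {X Y : FusFib k} {A B : Type*} [Ring A] [Algebra k A]
  [Ring B] [Algebra k B]
  (e : A ≃ₐ[k] End X.fib) (e' : B ≃ₐ[k] End Y.fib)

omit [IsAlgClosed k] in
/-- The action of `End F ⊗ End F'` on `F ⊗ F'`. -/
def tensEv : A ⊗[k] B →ₐ[k] End (X.fib₂ Y) where
  toFun t :=
    { app := fun x => tensEnd (ev e x.1) (ev e' x.2) t
      naturality := fun _ _ f => (tensEnd_ev_natural e e' f.1 f.2 t).symm }
  map_one' := NatTrans.ext <| funext fun x => map_one (tensEnd (ev e x.1) (ev e' x.2))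
  map_mul' a b := NatTrans.ext <| funext fun x => map_mul (tensEnd (ev e x.1) (ev e' x.2)) a b
  map_zero' := NatTrans.ext <| funext fun x => map_zero (tensEnd (ev e x.1) (ev e' x.2))
  map_add' a b := NatTrans.ext <| funext fun x => map_add (tensEnd (ev e x.1) (ev e' x.2)) a b
  commutes' r := NatTrans.ext <| funext fun x => (tensEnd (ev e x.1) (ev e' x.2)).commutes r

theorem tensEv_bijective : Function.Bijective (tensEv e e') := by
  refine ⟨fun t t' h => tensEnd_ext e e' fun c d => NatTrans.congr_app h (c, d), fun η => ?_⟩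
  obtain ⟨t, ht⟩ := exists_tensEnd_eq X Y e e' (fun c d => η.app (c, d))
    fun {c c' d d'} f g => (η.naturality ((f, g) : (c, d) ⟶ (c', d'))).symm
  exact ⟨t, NatTrans.ext <| funext fun x => ht x.1 x.2⟩

end

end FusFib

/-! ### Vector spaces as modules over the ground field -/

namespace FDMod

variable (k : Type u) [Field k]

/-- Vector spaces as modules over the ground field. -/
def ofVec : FGModuleCat.{u} k ⥤ FDMod k k where
  obj V := ⟨V, Algebra.ofId k _⟩
  map f := ⟨f, fun a => LinearMap.ext fun v => f.hom.hom.map_smul a v⟩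

instance : (ofVec k).Additive where
instance : (ofVec k).Linear k where

theorem comm_ground {M N : FDMod k k} (f : M.V ⟶ N.V) (a : k) :
    f.hom.hom ∘ₗ M.ρ a = N.ρ a ∘ₗ f.hom.hom := by
  have h : ∀ (M : FDMod k k), M.ρ a = a • 1 := fun M =>
    (M.ρ.commutes a).trans (Algebra.algebraMap_eq_smul_one a)
  rw [h, h]
  ext v
  exact f.hom.hom.map_smul a v

instance : (forget k k).Full where
  map_surjective f := ⟨⟨f, comm_ground k f⟩, rfl⟩

instance : (forget k k).EssSurj where
  mem_essImage V := ⟨(ofVec k).obj V, ⟨Iso.refl _⟩⟩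

instance : (forget k k).IsEquivalence where

end FDMod

theorem IsDeligneProduct.whisker_bijective_vec {k : Type u} [Field k] {C D M : Type (u + 1)}
    [Category.{u} C] [Category.{u} D] [Category.{u} M] [Preadditive C] [Preadditive D]
    [Preadditive M] [Linear k C] [Linear k D] [Linear k M] {B : C × D ⥤ M}
    (hB : IsDeligneProduct k B) (H H' : M ⥤ FGModuleCat.{u} k) [H.Additive] [H.Linear k]
    [H'.Additive] [H'.Linear k] :
    Function.Bijective fun t : H ⟶ H' => Functor.whiskerLeft B t := by
  have h := hB.whisker_bijective (FDMod k k) (FDMod.isFiniteSemisimple k k) (H ⋙ FDMod.ofVec k)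
    (H' ⋙ FDMod.ofVec k)
  refine ⟨fun t t' htt => ?_, fun β => ?_⟩
  · have : Functor.whiskerRight t (FDMod.ofVec k) = Functor.whiskerRight t' (FDMod.ofVec k) :=
      h.1 (congrArg (fun β => Functor.whiskerRight β (FDMod.ofVec k)) htt)
    exact NatTrans.ext <| funext fun m => congrArg FDMod.Hom.hom (NatTrans.congr_app this m)
  · obtain ⟨t, ht⟩ := h.2 (Functor.whiskerRight β (FDMod.ofVec k))
    refine ⟨{ app := fun m => (t.app m).hom
              naturality := fun _ _ f => congrArg FDMod.Hom.hom (t.naturality f) },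
      NatTrans.ext <| funext fun x => congrArg FDMod.Hom.hom (NatTrans.congr_app ht x)⟩

/-- The forgetful functor, as a morphism over vector spaces. -/
def forgetMor (k : Type u) [Field k] :
    FibCat.Mor (modFib k (HopfAlgCat.of k k)) (FibCat.vec k) where
  T := FDMod.forget k k
  τ := (FDMod.forget k k).rightUnitor.symm
  isMonoidal := inferInstanceAs (NatTrans.IsMonoidal (FDMod.forget k k).rightUnitor.inv)

theorem isIso_forgetMor (k : Type u) [Field k] :
    @IsIso (FibCat k) _ _ _ (Quotient.mk _ (forgetMor k)) :=
  have : (forgetMor k).T.IsEquivalence := inferInstanceAs (FDMod.forget k k).IsEquivalence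
  have : (modFib k (HopfAlgCat.of k k)).F.Faithful := inferInstanceAs (FDMod.forget k k).Faithful
  have : (FibCat.vec k).F.Faithful := inferInstanceAs (𝟭 (FGModuleCat.{u} k)).Faithful
  FibCat.Mor.isIso (forgetMor k)

/-! ### The endomorphism algebra of a Deligne product -/

namespace FusFib

variable {k : Type u} [Field k] [IsAlgClosed k]

/-- Hopf algebras which are both identified with the endomorphisms of the same fiber functor are
isomorphic. -/
def hopfIso (X : FusFib k) {A B : SSHopf k} {e : A.obj ≃ₐ[k] End X.fib} {e' : B.obj ≃ₐ[k] End X.fib}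
    (he : IsBialgEnd X e) (he' : IsBialgEnd X e') : A ≅ B where
  hom := ObjectProperty.homMk <| HopfAlgCat.ofHom <| endBialgHom he' he (FibCat.Mor.id _)
  inv := ObjectProperty.homMk <| HopfAlgCat.ofHom <| endBialgHom he he' (FibCat.Mor.id _)
  hom_inv_id := by
    refine ObjectProperty.hom_ext _ (HopfAlgCat.hom_ext _ _ (DFunLike.ext _ _ fun b => ?_))
    refine ev_ext e fun c => ?_
    refine (ev_endMap _ e' (FibCat.Mor.id _) _ c).trans ?_
    refine ((Category.id_comp _).trans (Category.comp_id _)).trans ?_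
    refine (ev_endMap _ e (FibCat.Mor.id _) _ c).trans ?_
    exact (Category.id_comp _).trans (Category.comp_id _)
  inv_hom_id := by
    refine ObjectProperty.hom_ext _ (HopfAlgCat.hom_ext _ _ (DFunLike.ext _ _ fun b => ?_))
    refine ev_ext e' fun c => ?_
    refine (ev_endMap _ e (FibCat.Mor.id _) _ c).trans ?_
    refine ((Category.id_comp _).trans (Category.comp_id _)).trans ?_
    refine (ev_endMap _ e' (FibCat.Mor.id _) _ c).trans ?_
    exact (Category.id_comp _).trans (Category.comp_id _)

theorem ev_hopfIso_hom (X : FusFib k) {A B : SSHopf k} {e : A.obj ≃ₐ[k] End X.fib}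
    {e' : B.obj ≃ₐ[k] End X.fib} (he : IsBialgEnd X e) (he' : IsBialgEnd X e') (a : A.obj)
    (c : X.Cat) : ev e' c ((X.hopfIso he he').hom.hom.toBialgHom a) = ev e c a :=
  (ev_endMap e' e (FibCat.Mor.id _) a c).trans ((Category.id_comp _).trans (Category.comp_id _))

end FusFib

namespace DeligneProduct

attribute [instance] DeligneProduct.monoidal DeligneProduct.isMonoidal

variable {k : Type u} [Field k] {X Y Z : FusFib k} (P : DeligneProduct X Y Z)

/-- Restriction of endomorphisms of the fiber functor along the universal bifunctor. -/
def pull : End Z.fib →ₐ[k] End (X.fib₂ Y) where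
  toFun η := P.fibIso.inv ≫ Functor.whiskerLeft P.box η ≫ P.fibIso.hom
  map_one' := NatTrans.ext <| funext fun c => by
    change P.fibIso.inv.app c ≫ 𝟙 _ ≫ P.fibIso.hom.app c = 𝟙 _
    simp
  map_mul' η θ := NatTrans.ext <| funext fun c => by
    change P.fibIso.inv.app c ≫ (NatTrans.app θ _ ≫ NatTrans.app η _) ≫ P.fibIso.hom.app c =
      (P.fibIso.inv.app c ≫ NatTrans.app θ _ ≫ P.fibIso.hom.app c) ≫
        P.fibIso.inv.app c ≫ NatTrans.app η _ ≫ P.fibIso.hom.app c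
    simp
  map_zero' := NatTrans.ext <| funext fun c => by
    change P.fibIso.inv.app c ≫ 0 ≫ P.fibIso.hom.app c = 0
    simp
  map_add' η θ := NatTrans.ext <| funext fun c => by
    change P.fibIso.inv.app c ≫ (NatTrans.app η _ + NatTrans.app θ _) ≫ P.fibIso.hom.app c =
      P.fibIso.inv.app c ≫ NatTrans.app η _ ≫ P.fibIso.hom.app c +
        P.fibIso.inv.app c ≫ NatTrans.app θ _ ≫ P.fibIso.hom.app c
    rw [Preadditive.add_comp, Preadditive.comp_add]
  commutes' r := NatTrans.ext <| funext fun c => by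
    change P.fibIso.inv.app c ≫ (r • 𝟙 _) ≫ P.fibIso.hom.app c = r • 𝟙 _
    simp

theorem pull_bijective : Function.Bijective P.pull := by
  have h := P.isDeligneProduct.whisker_bijective_vec Z.fib Z.fib
  refine ⟨fun η θ hηθ => h.1 ?_, fun η => ?_⟩
  · exact (cancel_mono P.fibIso.hom).mp ((cancel_epi P.fibIso.inv).mp hηθ)
  · obtain ⟨θ, hθ⟩ := h.2 (P.fibIso.hom ≫ η ≫ P.fibIso.inv)
    refine ⟨θ, ?_⟩
    change P.fibIso.inv ≫ Functor.whiskerLeft P.box θ ≫ P.fibIso.hom = η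
    have hθ' : Functor.whiskerLeft P.box θ = P.fibIso.hom ≫ η ≫ P.fibIso.inv := hθ
    rw [hθ']
    simp

variable [IsAlgClosed k] {A B : Type*}

section

variable [Ring A] [Algebra k A] [Ring B] [Algebra k B]
  (e : A ≃ₐ[k] End X.fib) (e' : B ≃ₐ[k] End Y.fib)

/-- The tensor product of the endomorphism algebras acts on the fiber functor of the Deligne
product. -/
def tensorEquiv : A ⊗[k] B ≃ₐ[k] End Z.fib :=
  (AlgEquiv.ofBijective (FusFib.tensEv e e') (FusFib.tensEv_bijective e e')).trans
    (AlgEquiv.ofBijective P.pull P.pull_bijective).symm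

theorem ev_tensorEquiv (t : A ⊗[k] B) (x : X.Cat) (y : Y.Cat) :
    ev (P.tensorEquiv e e') (P.obj x y) t ≫ P.fib x y =
      P.fib x y ≫ tensEnd (ev e x) (ev e' y) t := by
  have h : P.pull (P.tensorEquiv e e' t) = FusFib.tensEv e e' t :=
    (AlgEquiv.ofBijective P.pull P.pull_bijective).apply_symm_apply _
  have h' : P.fibIso.inv.app (x, y) ≫ ev (P.tensorEquiv e e') (P.obj x y) t ≫ P.fib x y =
      tensEnd (ev e x) (ev e' y) t := NatTrans.congr_app h (x, y)
  rw [← h', Iso.hom_inv_id_app_assoc]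

include e e' in
theorem injective_ev {x : X.Cat} {y : Y.Cat} (hx : Function.Injective (ev e x))
    (hy : Function.Injective (ev e' y)) {D : Type*} [Ring D] [Algebra k D] (f : D ≃ₐ[k] End Z.fib) :
    Function.Injective (ev f (P.obj x y)) := by
  have h : Function.Injective (ev (P.tensorEquiv e e') (P.obj x y)) := fun t t' h => by
    refine FGModuleCat.tensEnd_injective hx hy ((cancel_epi (P.fib x y)).mp ?_)
    rw [← ev_tensorEquiv, ← ev_tensorEquiv, h]
  have h' : ∀ d, ev f (P.obj x y) d =
      ev (P.tensorEquiv e e') (P.obj x y) ((P.tensorEquiv e e').symm (f d)) := fun d =>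
    (ev_symm (P.tensorEquiv e e') (f d) _).symm
  intro d d' hd
  rw [h', h'] at hd
  exact f.injective ((P.tensorEquiv e e').symm.injective (h hd))

end

variable [Ring A] [Bialgebra k A] [Ring B] [Bialgebra k B]
  {e : A ≃ₐ[k] End X.fib} {e' : B ≃ₐ[k] End Y.fib}

theorem isBialgEnd_tensorEquiv (he : FusFib.IsBialgEnd X e) (he' : FusFib.IsBialgEnd Y e') :
    FusFib.IsBialgEnd Z (P.tensorEquiv e e') := by
  let f := P.tensorEquiv e e'
  have hμ : ∀ c c' d d', μ Z.fib (P.obj c d) (P.obj c' d') ≫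
      Z.fib.map (μ P.box (c, d) (c', d')) ≫ P.fib (c ⊗ c') (d ⊗ d') =
      (P.fib c d ⊗ₘ P.fib c' d') ≫ μ (X.fib₂ Y) (c, d) (c', d') := fun c c' d d' => by
    have h := NatTrans.IsMonoidal.tensor (τ := P.fibIso.hom) (c, d) (c', d')
    rw [Functor.LaxMonoidal.comp_μ] at h
    exact (Category.assoc _ _ _).symm.trans h
  have hε : ε Z.fib ≫ Z.fib.map (ε P.box) ≫ P.fib (𝟙_ _) (𝟙_ _) = ε (X.fib₂ Y) := by
    have h := NatTrans.IsMonoidal.unit (τ := P.fibIso.hom)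
    rw [Functor.LaxMonoidal.comp_ε] at h
    exact (Category.assoc _ _ _).symm.trans h
  constructor
  · obtain ⟨g, hg⟩ := X.exists_injective e
    obtain ⟨g', hg'⟩ := Y.exists_injective e'
    have hinj := P.injective_ev e e' hg hg' f
    have h : ∀ t, Z.comulHom f t = Coalgebra.comul (R := k) t := fun t => by
      refine FGModuleCat.tensEnd_injective hinj hinj ?_
      rw [← cancel_mono (μ Z.fib (P.obj g g') (P.obj g g') ≫
        Z.fib.map (μ P.box (g, g') (g, g')) ≫ P.fib (g ⊗ g) (g' ⊗ g')), reassoc_of% Z.comulHom_spec,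
        hμ]
      have h₁ := tensEnd_natural (P.fib g g') (P.fib g g') (fun t => P.ev_tensorEquiv e e' t g g')
        (fun t => P.ev_tensorEquiv e e' t g g') (Coalgebra.comul (R := k) t)
      have h₂ := FusFib.tensEnd_comul he he' t g g g' g'
      rw [reassoc_of% h₁, h₂, ← reassoc_of% hμ, ← P.ev_tensorEquiv]
      simp only [← Category.assoc]
      congr 1
      simp only [Category.assoc]
      exact congrArg (_ ≫ ·) (ev_natural f (μ P.box (g, g') (g, g')) t)
    intro t c d
    rw [← h]
    exact Z.comulHom_spec f t c d
  · intro t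
    rw [← cancel_mono (Z.fib.map (ε P.box) ≫ P.fib (𝟙_ _) (𝟙_ _)), Category.assoc,
      Linear.smul_comp, hε, ← FusFib.tensEnd_counit he he', ← hε]
    simp only [Category.assoc]
    rw [← P.ev_tensorEquiv]
    exact congrArg (_ ≫ ·) ((Category.assoc _ _ _).symm.trans ((congrArg (· ≫ _)
      (ev_natural f (ε P.box) t)).trans (Category.assoc _ _ _)))

/-- The isomorphism `End F ⊗ End F' ≅ End (F ⊗ F')`. -/
def hopfIso : X.endHopf ⊗ Y.endHopf ≅ Z.endHopf :=
  Z.hopfIso (A := X.endHopf ⊗ Y.endHopf) (B := Z.endHopf)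
    (P.isBialgEnd_tensorEquiv X.isBialgEnd_endAlgEquiv Y.isBialgEnd_endAlgEquiv)
    Z.isBialgEnd_endAlgEquiv

theorem ev_hopfIso (t : X.EndAlg ⊗[k] Y.EndAlg) (x : X.Cat) (y : Y.Cat) :
    ev Z.endAlgEquiv (P.obj x y) (P.hopfIso.hom.hom.toBialgHom t) ≫ P.fib x y =
      P.fib x y ≫ tensEnd (ev X.endAlgEquiv x) (ev Y.endAlgEquiv y) t :=
  (congrArg (· ≫ _) (Z.ev_hopfIso_hom (A := X.endHopf ⊗ Y.endHopf) (B := Z.endHopf)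
    (P.isBialgEnd_tensorEquiv X.isBialgEnd_endAlgEquiv Y.isBialgEnd_endAlgEquiv)
    Z.isBialgEnd_endAlgEquiv t _)).trans (P.ev_tensorEquiv _ _ t x y)

end DeligneProduct

/-! ### Compatibility of the endomorphism algebras with Deligne products -/

namespace SSHopf

variable {k : Type u} [Field k]

theorem hom_ext {A B : SSHopf k} {f g : A ⟶ B}
    (h : ∀ a, f.hom.toBialgHom a = g.hom.toBialgHom a) : f = g :=
  ObjectProperty.hom_ext _ (HopfAlgCat.hom_ext _ _ (DFunLike.ext _ _ h))

/-- The algebra homomorphism underlying a morphism of Hopf algebras. -/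
def toAlgHom {A B : SSHopf k} (f : A ⟶ B) : A.obj →ₐ[k] B.obj :=
  (f.hom.toBialgHom : A.obj →ₐ[k] B.obj)

end SSHopf

namespace FusFib

variable {k : Type u} [Field k] [IsAlgClosed k]

omit [IsAlgClosed k] in
theorem exists_represents {X Y : FusFib k} (f : X ⟶ Y) : ∃ m, Represents m f :=
  Quotient.exists_rep f.hom

/-- The algebra homomorphism underlying `End F₂ → End F₁`. -/
def endAlgMap {X Y : FusFib k} (f : X ⟶ Y) : Y.EndAlg →ₐ[k] X.EndAlg :=
  SSHopf.toAlgHom ((endFunctor k).map f.op)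

theorem ev_endAlgMap_comp {X Y : FusFib k} {f : X ⟶ Y} {m : FibCat.Mor X.obj Y.obj}
    (h : Represents m f) (a : Y.EndAlg) (c : X.Cat) :
    ev X.endAlgEquiv c (endAlgMap f a) ≫ m.τ.hom.app c =
      m.τ.hom.app c ≫ ev Y.endAlgEquiv (m.T.obj c) a := by
  have h' : ev X.endAlgEquiv c (endAlgMap f a) = _ := ev_endFunctor_map f m h a c
  rw [h']
  simp

end FusFib

namespace DeligneProduct

open FusFib

variable {k : Type u} [Field k] [IsAlgClosed k] {X Y Z W V X' Y' Z' W' V' I : FusFib k}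

/-- The algebra homomorphism underlying `End F ⊗ End F' ≅ End (F ⊗ F')`. -/
def algHom (P : DeligneProduct X Y Z) : X.EndAlg ⊗[k] Y.EndAlg →ₐ[k] Z.EndAlg :=
  SSHopf.toAlgHom P.hopfIso.hom

theorem ev_algHom (P : DeligneProduct X Y Z) (t : X.EndAlg ⊗[k] Y.EndAlg) (x : X.Cat) (y : Y.Cat) :
    ev Z.endAlgEquiv (P.obj x y) (P.algHom t) ≫ P.fib x y =
      P.fib x y ≫ tensEnd (ev X.endAlgEquiv x) (ev Y.endAlgEquiv y) t := P.ev_hopfIso t x y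

theorem injective_ev_endAlg (P : DeligneProduct X Y Z) {x : X.Cat} {y : Y.Cat}
    (hx : Function.Injective (ev X.endAlgEquiv x)) (hy : Function.Injective (ev Y.endAlgEquiv y)) :
    Function.Injective (ev Z.endAlgEquiv (P.obj x y)) :=
  P.injective_ev X.endAlgEquiv Y.endAlgEquiv hx hy Z.endAlgEquiv

theorem algHom_map (P : DeligneProduct X Y Z) (P' : DeligneProduct X' Y' Z') {f : X ⟶ X'}
    {g : Y ⟶ Y'} {h : Z ⟶ Z'} {m : FibCat.Mor X.obj X'.obj} {n : FibCat.Mor Y.obj Y'.obj}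
    {p : FibCat.Mor Z.obj Z'.obj} (hm : Represents m f) (hn : Represents n g) (hp : Represents p h)
    (u : P.box ⋙ p.T ≅ m.T.prod n.T ⋙ P'.box)
    (hu : ∀ (x : X.Cat) (y : Y.Cat), p.τ.hom.app (P.obj x y) ≫ Z'.fib.map (u.hom.app (x, y)) ≫
      P'.fib (m.T.obj x) (n.T.obj y) = P.fib x y ≫ (m.τ.hom.app x ⊗ₘ n.τ.hom.app y))
    (t : X'.EndAlg ⊗[k] Y'.EndAlg) :
    P.algHom (Algebra.TensorProduct.map (endAlgMap f) (endAlgMap g) t) =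
      endAlgMap h (P'.algHom t) := by
  obtain ⟨x, hx⟩ := X.exists_injective X.endAlgEquiv
  obtain ⟨y, hy⟩ := Y.exists_injective Y.endAlgEquiv
  refine P.injective_ev_endAlg hx hy ?_
  rw [← cancel_mono (P.fib x y), ← cancel_mono (m.τ.hom.app x ⊗ₘ n.τ.hom.app y), ev_algHom,
    tensEnd_map, Category.assoc, Category.assoc, tensEnd_natural (ρ' := ev X'.endAlgEquiv _)
      (σ' := ev Y'.endAlgEquiv _) _ _ (fun a => ev_endAlgMap_comp hm a x)
      (fun b => ev_endAlgMap_comp hn b y), ← hu, reassoc_of% ev_endAlgMap_comp hp]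
  have h₁ : ev Z'.endAlgEquiv (p.T.obj (P.obj x y)) (P'.algHom t) ≫ Z'.fib.map (u.hom.app (x, y)) =
    Z'.fib.map (u.hom.app (x, y)) ≫ ev Z'.endAlgEquiv (P'.obj (m.T.obj x) (n.T.obj y))
      (P'.algHom t) := ev_natural _ _ _
  rw [reassoc_of% h₁, P'.ev_algHom, reassoc_of% hu]

theorem algHom_assoc (P : DeligneProduct X Y W) (P' : DeligneProduct W Z V)
    (R : DeligneProduct Y Z W') (R' : DeligneProduct X W' V') {a : V ⟶ V'}
    {m : FibCat.Mor V.obj V'.obj} (hm : Represents m a)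
    (u : P.box.prod (𝟭 Z.Cat) ⋙ P'.box ⋙ m.T ≅
      CategoryTheory.prod.associator X.Cat Y.Cat Z.Cat ⋙ (𝟭 X.Cat).prod R.box ⋙ R'.box)
    (hu : ∀ (x : X.Cat) (y : Y.Cat) (z : Z.Cat),
      m.τ.hom.app (P'.obj (P.obj x y) z) ≫ V'.fib.map (u.hom.app ((x, y), z)) ≫
          R'.fib x (R.obj y z) ≫ X.fib.obj x ◁ R.fib y z =
        P'.fib (P.obj x y) z ≫ P.fib x y ▷ Z.fib.obj z ≫
          (α_ (X.fib.obj x) (Y.fib.obj y) (Z.fib.obj z)).hom)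
    (t : (X.EndAlg ⊗[k] Y.EndAlg) ⊗[k] Z.EndAlg) :
    P'.algHom (Algebra.TensorProduct.map P.algHom (AlgHom.id k _) t) =
      endAlgMap a (R'.algHom (Algebra.TensorProduct.map (AlgHom.id k _) R.algHom
        (TensorProduct.assoc k _ _ _ t))) := by
  obtain ⟨x, hx⟩ := X.exists_injective X.endAlgEquiv
  obtain ⟨y, hy⟩ := Y.exists_injective Y.endAlgEquiv
  obtain ⟨z, hz⟩ := Z.exists_injective Z.endAlgEquiv
  refine P'.injective_ev_endAlg (P.injective_ev_endAlg hx hy) hz ?_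
  rw [← cancel_mono (P'.fib (P.obj x y) z), ← cancel_mono (P.fib x y ▷ Z.fib.obj z),
    ← cancel_mono (α_ (X.fib.obj x) (Y.fib.obj y) (Z.fib.obj z)).hom]
  simp only [Category.assoc]
  rw [reassoc_of% P'.ev_algHom, tensEnd_map]
  have h₁ := tensEnd_natural (ρ := (ev W.endAlgEquiv (P.obj x y)).comp P.algHom)
    (σ := (ev Z.endAlgEquiv z).comp (AlgHom.id k _)) (σ' := ev Z.endAlgEquiv z) (P.fib x y)
    (𝟙 (Z.fib.obj z)) (fun t => P.ev_algHom t x y)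
    (fun t => (Category.comp_id _).trans (Category.id_comp (ev Z.endAlgEquiv z t)).symm) t
  have h₂ := tensEnd_natural (ρ := (ev X.endAlgEquiv x).comp (AlgHom.id k _))
    (ρ' := ev X.endAlgEquiv x) (σ := (ev W'.endAlgEquiv (R.obj y z)).comp R.algHom)
    (𝟙 (X.fib.obj x)) (R.fib y z)
    (fun t => (Category.comp_id _).trans (Category.id_comp (ev X.endAlgEquiv x t)).symm)
    (fun t => R.ev_algHom t y z) (TensorProduct.assoc k _ _ _ t)
  have h₃ := fun s => ev_natural V'.endAlgEquiv (u.hom.app ((x, y), z)) s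
  rw [tensorHom_id] at h₁
  rw [id_tensorHom, ← tensEnd_map] at h₂
  have h₄ := R'.ev_algHom (Algebra.TensorProduct.map (AlgHom.id k _) R.algHom
        (TensorProduct.assoc k _ _ _ t)) x (R.obj y z)
  rw [reassoc_of% h₁, tensEnd_assoc, ← hu, reassoc_of% ev_endAlgMap_comp hm, ← reassoc_of% hu]
  refine congrArg (_ ≫ ·) (Eq.symm ?_)
  refine (Category.assoc _ _ _).symm.trans ((congrArg (· ≫ _) (h₃ _)).trans ?_)
  refine (Category.assoc _ _ _).trans (congrArg (_ ≫ ·) ?_)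
  refine Eq.trans ?_ ((congrArg (_ ≫ ·) h₂).trans (Category.assoc _ _ _).symm)
  exact (Category.assoc _ _ _).symm.trans ((congrArg (· ≫ _) h₄).trans (Category.assoc _ _ _))

theorem algHom_leftUnitor (P : DeligneProduct I X Z)
    (hI : Function.Injective (ev I.endAlgEquiv (𝟙_ _))) {l : Z ⟶ X} {m : FibCat.Mor Z.obj X.obj}
    (hm : Represents m l) (u : (Functor.curry.obj P.box).obj (𝟙_ _) ⋙ m.T ≅ 𝟭 X.Cat)
    (hu : ∀ x : X.Cat, m.τ.hom.app (P.obj (𝟙_ _) x) ≫ X.fib.map (u.hom.app x) =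
      P.fib (𝟙_ _) x ≫ Functor.OplaxMonoidal.η I.fib ▷ X.fib.obj x ≫ (λ_ (X.fib.obj x)).hom)
    (a : X.EndAlg) : endAlgMap l a = P.algHom (1 ⊗ₜ a) := by
  obtain ⟨x, hx⟩ := X.exists_injective X.endAlgEquiv
  refine P.injective_ev_endAlg hI hx ?_
  rw [← cancel_mono (P.fib (𝟙_ _) x), ← cancel_mono (Functor.OplaxMonoidal.η I.fib ▷ X.fib.obj x ≫
    (λ_ (X.fib.obj x)).hom), ev_algHom, Category.assoc, Category.assoc, ← hu,
    reassoc_of% ev_endAlgMap_comp hm, tensEnd_tmul, map_one]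
  have h₁ : ev X.endAlgEquiv (m.T.obj (P.obj (𝟙_ _) x)) a ≫ X.fib.map (u.hom.app x) =
    X.fib.map (u.hom.app x) ≫ ev X.endAlgEquiv x a := ev_natural _ _ _
  rw [h₁, reassoc_of% hu]
  refine congrArg (_ ≫ ·) ?_
  have h₂ := leftUnitor_naturality (ev X.endAlgEquiv x a)
  refine (congrArg (_ ≫ ·) h₂.symm).trans ?_
  rw [← whisker_exchange_assoc]
  exact congrArg (· ≫ _) (id_tensorHom _ _).symm

theorem algHom_rightUnitor (P : DeligneProduct X I Z)
    (hI : Function.Injective (ev I.endAlgEquiv (𝟙_ _))) {l : Z ⟶ X} {m : FibCat.Mor Z.obj X.obj}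
    (hm : Represents m l) (u : (Functor.curry.obj P.box).flip.obj (𝟙_ _) ⋙ m.T ≅ 𝟭 X.Cat)
    (hu : ∀ x : X.Cat, m.τ.hom.app (P.obj x (𝟙_ _)) ≫ X.fib.map (u.hom.app x) =
      P.fib x (𝟙_ _) ≫ X.fib.obj x ◁ Functor.OplaxMonoidal.η I.fib ≫ (ρ_ (X.fib.obj x)).hom)
    (a : X.EndAlg) : endAlgMap l a = P.algHom (a ⊗ₜ 1) := by
  obtain ⟨x, hx⟩ := X.exists_injective X.endAlgEquiv
  refine P.injective_ev_endAlg hx hI ?_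
  rw [← cancel_mono (P.fib x (𝟙_ _)), ← cancel_mono (X.fib.obj x ◁ Functor.OplaxMonoidal.η I.fib ≫
    (ρ_ (X.fib.obj x)).hom), ev_algHom, Category.assoc, Category.assoc, ← hu,
    reassoc_of% ev_endAlgMap_comp hm, tensEnd_tmul, map_one]
  have h₁ : ev X.endAlgEquiv (m.T.obj (P.obj x (𝟙_ _))) a ≫ X.fib.map (u.hom.app x) =
    X.fib.map (u.hom.app x) ≫ ev X.endAlgEquiv x a := ev_natural _ _ _
  rw [h₁, reassoc_of% hu]
  refine congrArg (_ ≫ ·) ?_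
  have h₂ := rightUnitor_naturality (ev X.endAlgEquiv x a)
  refine (congrArg (_ ≫ ·) h₂.symm).trans ?_
  rw [whisker_exchange_assoc]
  exact congrArg (· ≫ _) (tensorHom_id _ _).symm

end DeligneProduct

/-! ### The reconstruction equivalence is monoidal -/

section

variable {k : Type u} [Field k]

theorem AlgHom.apply_lid {A B K : Type*} [Ring A] [Algebra k A] [Ring B]
    [Algebra k B] [Ring K] [Algebra k K] (f : A →ₐ[k] B) (g : K ⊗[k] A →ₐ[k] B) (φ : k →ₐ[k] K)
    (h : ∀ a, f a = g (1 ⊗ₜ a)) (t : k ⊗[k] A) :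
    f (TensorProduct.lid k A t) = g (Algebra.TensorProduct.map φ (AlgHom.id k A) t) := by
  induction t with
  | zero => simp only [map_zero]
  | add x y hx hy => simp only [map_add, hx, hy]
  | tmul r a =>
    have : φ r = r • 1 := (φ.commutes r).trans (Algebra.algebraMap_eq_smul_one r)
    rw [TensorProduct.lid_tmul, Algebra.TensorProduct.map_tmul, map_smul, h, ← map_smul,
      TensorProduct.smul_tmul', this]
    rfl

theorem AlgHom.apply_rid {A B K : Type*} [Ring A] [Algebra k A] [Ring B]
    [Algebra k B] [Ring K] [Algebra k K] (f : A →ₐ[k] B) (g : A ⊗[k] K →ₐ[k] B) (φ : k →ₐ[k] K)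
    (h : ∀ a, f a = g (a ⊗ₜ 1)) (t : A ⊗[k] k) :
    f (TensorProduct.rid k A t) = g (Algebra.TensorProduct.map (AlgHom.id k A) φ t) := by
  induction t with
  | zero => simp only [map_zero]
  | add x y hx hy => simp only [map_add, hx, hy]
  | tmul a r =>
    have : φ r = r • 1 := (φ.commutes r).trans (Algebra.algebraMap_eq_smul_one r)
    rw [TensorProduct.rid_tmul, Algebra.TensorProduct.map_tmul, map_smul, h, ← map_smul,
      ← TensorProduct.tmul_smul, this]
    rfl

variable [IsAlgClosed k]

/-- A category which is isomorphic to vector spaces is isomorphic to modules over `k`. -/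
def FusFib.isoModUnit {I : FusFib k} (h : I.obj ≅ FibCat.vec k) : I ≅ (𝟙_ (SSHopf k)).modFus :=
  have := isIso_forgetMor k
  (FibCat.isFusion k).isoMk (X := I) (Y := (𝟙_ (SSHopf k)).modFus)
    (h ≪≫ (@asIso (FibCat k) _ _ _ (Quotient.mk _ (forgetMor k)) this).symm)

/-- The endomorphism algebra of the unit is the ground field. -/
def FusFib.unitIsoEnd {I : FusFib k} (h : I.obj ≅ FibCat.vec k) : 𝟙_ (SSHopf k) ≅ I.endHopf :=
  (𝟙_ (SSHopf k)).isoEnd ≪≫ (FusFib.endFunctor k).mapIso (FusFib.isoModUnit h).op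

theorem SSHopf.unit_hom_apply {A : SSHopf k} (f : 𝟙_ (SSHopf k) ⟶ A) (r : k) :
    f.hom.toBialgHom r = algebraMap k A.obj r :=
  (SSHopf.toAlgHom f).commutes r

theorem FusFib.injective_ev_unit {I : FusFib k} (h : I.obj ≅ FibCat.vec k) :
    Function.Injective (ev I.endAlgEquiv (𝟙_ I.Cat)) := by
  have hs : ∀ a : I.EndAlg, ∃ r : k, algebraMap k I.EndAlg r = a := fun a => by
    refine ⟨(FusFib.unitIsoEnd h).inv.hom.toBialgHom a, ?_⟩
    refine (SSHopf.unit_hom_apply (FusFib.unitIsoEnd h).hom _).symm.trans ?_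
    exact DFunLike.congr_fun (congrArg (fun f : I.endHopf ⟶ I.endHopf => f.hom.toBialgHom)
      (FusFib.unitIsoEnd h).inv_hom_id) a
  have hε : ε I.fib ≠ 0 := fun h => by
    have h₀ : 𝟙 (𝟙_ (FGModuleCat.{u} k)) = 0 := by
      rw [← Functor.Monoidal.ε_η I.fib, h, Limits.zero_comp]
    exact one_ne_zero (α := k) (LinearMap.congr_fun (congrArg (fun f => f.hom.hom) h₀) (1 : k))
  intro a b hab
  obtain ⟨r, rfl⟩ := hs a
  obtain ⟨r', rfl⟩ := hs b
  rw [AlgHom.commutes, AlgHom.commutes] at hab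
  have h' := congrArg (ε I.fib ≫ ·) hab
  have hr : ∀ r : k, ε I.fib ≫ (algebraMap k (End (I.fib.obj (𝟙_ I.Cat))) r) = r • ε I.fib :=
    fun r =>
    (Linear.comp_smul ..).trans (congrArg _ (Category.comp_id _))
  exact congrArg _ (smul_left_injective k hε ((hr r).symm.trans (Eq.trans h' (hr r'))))

namespace DeligneMonoidal

open FusFib

variable (D : DeligneMonoidal k)

theorem map_tensorHom : letI := D.monoidal; ∀ {X X' Y Y' : FusFib k} (f : X ⟶ X') (g : Y ⟶ Y'),
    ((endFunctor k).map f.op ⊗ₘ (endFunctor k).map g.op) ≫ (D.boxProd X Y).hopfIso.hom =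
      (D.boxProd X' Y').hopfIso.hom ≫ (endFunctor k).map (f ⊗ₘ g).op := by
  let := D.monoidal
  intro X X' Y Y' f g
  obtain ⟨m, hm⟩ := exists_represents f
  obtain ⟨n, hn⟩ := exists_represents g
  obtain ⟨p, hp⟩ := exists_represents (f ⊗ₘ g)
  obtain ⟨u, hu⟩ := D.tensorHom f g m n p hm hn hp
  exact SSHopf.hom_ext fun t => (D.boxProd X Y).algHom_map (D.boxProd X' Y') hm hn hp u hu t

theorem map_associator : letI := D.monoidal; ∀ X Y Z : FusFib k,
    (D.boxProd X Y).hopfIso.hom ▷ Z.endHopf ≫ (D.boxProd (X ⊗ Y) Z).hopfIso.hom =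
      (α_ X.endHopf Y.endHopf Z.endHopf).hom ≫ X.endHopf ◁ (D.boxProd Y Z).hopfIso.hom ≫
        (D.boxProd X (Y ⊗ Z)).hopfIso.hom ≫ (endFunctor k).map (α_ X Y Z).hom.op := by
  let := D.monoidal
  intro X Y Z
  obtain ⟨m, hm⟩ := exists_represents (α_ X Y Z).hom
  obtain ⟨u, hu⟩ := D.associator X Y Z m hm
  exact SSHopf.hom_ext fun t => (D.boxProd X Y).algHom_assoc (D.boxProd (X ⊗ Y) Z) (D.boxProd Y Z)
    (D.boxProd X (Y ⊗ Z)) hm u hu t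

/-- The endomorphism algebra of the unit is the ground field. -/
def unitIso : letI := D.monoidal; 𝟙_ (SSHopf k) ≅ (𝟙_ (FusFib k)).endHopf :=
  letI := D.monoidal
  FusFib.unitIsoEnd D.unit.some

theorem map_leftUnitor : letI := D.monoidal; ∀ X : FusFib k,
    (λ_ X.endHopf).hom ≫ (endFunctor k).map (λ_ X).hom.op =
      D.unitIso.hom ▷ X.endHopf ≫ (D.boxProd (𝟙_ (FusFib k)) X).hopfIso.hom := by
  let := D.monoidal
  intro X
  obtain ⟨m, hm⟩ := exists_represents (λ_ X).hom
  obtain ⟨u, hu⟩ := D.leftUnitor X m hm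
  have h := (D.boxProd (𝟙_ (FusFib k)) X).algHom_leftUnitor
    (FusFib.injective_ev_unit D.unit.some) hm u hu
  exact SSHopf.hom_ext fun t => AlgHom.apply_lid (A := X.EndAlg) _
    (D.boxProd (𝟙_ (FusFib k)) X).algHom (SSHopf.toAlgHom D.unitIso.hom) h t

theorem map_rightUnitor : letI := D.monoidal; ∀ X : FusFib k,
    (ρ_ X.endHopf).hom ≫ (endFunctor k).map (ρ_ X).hom.op =
      X.endHopf ◁ D.unitIso.hom ≫ (D.boxProd X (𝟙_ (FusFib k))).hopfIso.hom := by
  let := D.monoidal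
  intro X
  obtain ⟨m, hm⟩ := exists_represents (ρ_ X).hom
  obtain ⟨u, hu⟩ := D.rightUnitor X m hm
  have h := (D.boxProd X (𝟙_ (FusFib k))).algHom_rightUnitor
    (FusFib.injective_ev_unit D.unit.some) hm u hu
  exact SSHopf.hom_ext fun t => AlgHom.apply_rid (A := X.EndAlg) _
    (D.boxProd X (𝟙_ (FusFib k))).algHom (SSHopf.toAlgHom D.unitIso.hom) h t

/-- The functor `(C, F) ↦ End F` is monoidal. -/
def coreMonoidal : letI := D.monoidal; (endFunctor k).CoreMonoidal :=
  letI := D.monoidal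
  { εIso := D.unitIso
    μIso := fun X Y => (D.boxProd X.unop Y.unop).hopfIso
    μIso_hom_natural_left := fun f Z => by
      have h := D.map_tensorHom f.unop (𝟙 Z.unop)
      rw [op_id, CategoryTheory.Functor.map_id, tensorHom_id, tensorHom_id] at h
      exact h
    μIso_hom_natural_right := fun Z f => by
      have h := D.map_tensorHom (𝟙 Z.unop) f.unop
      rw [op_id, CategoryTheory.Functor.map_id, id_tensorHom, id_tensorHom] at h
      exact h
    associativity := fun X Y Z =>
      have aux : ∀ {A B C A' B' C' : SSHopf k} {x : A ⟶ B} {y : B ⟶ C} {a : A ⟶ A'} {b : A' ⟶ B'}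
          {c : B' ⟶ C'} {d : C' ⟶ C} {d' : C ⟶ C'} (_ : x ≫ y = a ≫ b ≫ c ≫ d)
          (_ : d ≫ d' = 𝟙 C'), x ≫ y ≫ d' = a ≫ b ≫ c := fun h h' => by
        rw [reassoc_of% h, h', Category.comp_id]
      aux (D.map_associator X.unop Y.unop Z.unop)
        (by rw [← Functor.map_comp]
            exact (congrArg _ (α_ X Y Z).inv_hom_id).trans (CategoryTheory.Functor.map_id _ _))
    left_unitality := fun X =>
      have aux : ∀ {A B C A' : SSHopf k} {x : A ⟶ B} {y : B ⟶ C} {a : A ⟶ A'} {d : A' ⟶ C}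
          {d' : C ⟶ A'} (_ : a ≫ d = x ≫ y) (_ : d ≫ d' = 𝟙 A'), a = x ≫ y ≫ d' := fun h h' => by
        rw [← reassoc_of% h, h', Category.comp_id]
      aux (D.map_leftUnitor X.unop)
        (by rw [← Functor.map_comp]
            exact (congrArg _ (λ_ X).inv_hom_id).trans (CategoryTheory.Functor.map_id _ _))
    right_unitality := fun X =>
      have aux : ∀ {A B C A' : SSHopf k} {x : A ⟶ B} {y : B ⟶ C} {a : A ⟶ A'} {d : A' ⟶ C}
          {d' : C ⟶ A'} (_ : a ≫ d = x ≫ y) (_ : d ≫ d' = 𝟙 A'), a = x ≫ y ≫ d' := fun h h' => by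
        rw [← reassoc_of% h, h', Category.comp_id]
      aux (D.map_rightUnitor X.unop)
        (by rw [← Functor.map_comp]
            exact (congrArg _ (ρ_ X).inv_hom_id).trans (CategoryTheory.Functor.map_id _ _)) }

theorem exists_isMonoidal : letI := D.monoidal
    ∃ (_ : (reconstruction k).equivalence.functor.Monoidal)
      (_ : (reconstruction k).equivalence.inverse.Monoidal),
      (reconstruction k).equivalence.IsMonoidal ∧
        ∀ (X Y : FusFib k) (a : ((reconstruction k).Q.obj (op X)).obj)
          (b : ((reconstruction k).Q.obj (op Y)).obj) (x : X.Cat) (y : Y.Cat),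
          NatTrans.app (((reconstruction k).endIso (X ⊗ Y)).iso
              ((μ (reconstruction k).equivalence.inverse (op X) (op Y)).hom.toBialgHom (a ⊗ₜ[k] b)))
              ((D.boxProd X Y).obj x y) ≫ (D.boxProd X Y).fib x y =
            (D.boxProd X Y).fib x y ≫ (NatTrans.app (((reconstruction k).endIso X).iso a) x ⊗ₘ
              NatTrans.app (((reconstruction k).endIso Y).iso b) y) := by
  let := D.monoidal
  let e := (reconstruction k).equivalence.symm
  let i₁ : e.functor.Monoidal := D.coreMonoidal.toMonoidal
  let i₂ : e.inverse.Monoidal := e.inverseMonoidal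
  have h : e.IsMonoidal := FibCat.isMonoidal_of_inverseMonoidal e
  refine ⟨i₂, i₁, inferInstanceAs e.symm.IsMonoidal, fun X Y a b x y => ?_⟩
  refine ((D.boxProd X Y).ev_hopfIso (a ⊗ₜ b) x y).trans ?_
  exact congrArg (_ ≫ ·) (tensEnd_tmul (ev X.endAlgEquiv x) (ev Y.endAlgEquiv y) a b)

end DeligneMonoidal

end

/-! ### Existence of Deligne products -/

namespace IsSimpleFamily

variable {k : Type u} [Field k] {C D : Type*} [Category C] [Category D] [Preadditive C]
  [Preadditive D] [Linear k C] [Linear k D] {ι : Type*} {s : ι → C}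

/-- A family whose image under a fully faithful linear functor is simple is itself simple. -/
theorem of_map (K : C ⥤ D) [K.Additive] [K.Linear k] [K.Full] [K.Faithful]
    (h : IsSimpleFamily k fun i => K.obj (s i)) : IsSimpleFamily k s where
  end_scalar i f := by
    obtain ⟨r, hr⟩ := h.end_scalar i (K.map f)
    refine ⟨r, K.map_injective ?_⟩
    rw [hr, Functor.Linear.map_smul (F := K), K.map_id]
  hom_eq_zero i j hij f := K.map_injective
    ((h.hom_eq_zero i j hij (K.map f)).trans (K.map_zero _ _).symm)
  decomp c := by
    obtain ⟨E⟩ := h.decomp (K.obj c)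
    exact ⟨{ n := E.n
             φ := E.φ
             p := fun t => K.preimage (E.p t)
             i := fun t => K.preimage (E.i t)
             i_p := fun t => K.map_injective (by simp [E.i_p])
             i_p_ne := fun t v htv => K.map_injective (by simp [E.i_p_ne t v htv])
             total := K.map_injective (by simp [K.map_sum, E.total]) }⟩

end IsSimpleFamily

theorem FGModuleCat.id_tensor_ne_zero {k : Type u} [Field k] {V W : FGModuleCat.{u} k}
    (hV : 𝟙 V ≠ 0) (hW : 𝟙 W ≠ 0) : 𝟙 (V ⊗ W) ≠ 0 := fun h => by
  have : Nontrivial (End V) := ⟨1, 0, hV⟩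
  have : Nontrivial (End W) := ⟨1, 0, hW⟩
  have h₁ := FGModuleCat.tensEnd_injective (ρ := Algebra.ofId k (End V))
    (σ := Algebra.ofId k (End W)) (FaithfulSMul.algebraMap_injective k (End V))
    (FaithfulSMul.algebraMap_injective k (End W))
  have h₂ : (1 : k ⊗[k] k) = 0 := h₁ ((map_one _).trans (Eq.trans h (map_zero _).symm))
  exact one_ne_zero h₂

namespace FusFib

variable {k : Type u} [Field k] [IsAlgClosed k] {X Y W : FusFib k}
  (ω : X.endHopf ⊗ Y.endHopf ≅ W.endHopf)

/-- The isomorphism of algebras underlying `ω`. -/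
def tensAlgEquiv : X.EndAlg ⊗[k] Y.EndAlg ≃ₐ[k] W.endHopf.obj :=
  AlgEquiv.ofAlgHom (SSHopf.toAlgHom ω.hom) (SSHopf.toAlgHom ω.inv)
    (AlgHom.ext fun a => DFunLike.congr_fun
      (congrArg (fun f : W.endHopf ⟶ W.endHopf => f.hom.toBialgHom) ω.inv_hom_id) a)
    (AlgHom.ext fun a => DFunLike.congr_fun
      (congrArg (fun f : X.endHopf ⊗ Y.endHopf ⟶ X.endHopf ⊗ Y.endHopf => f.hom.toBialgHom)
        ω.hom_inv_id) a)

/-- The inverse of `ω` as a homomorphism of bialgebras. -/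
def tensBialgHom : W.endHopf.obj →ₐc[k] X.EndAlg ⊗[k] Y.EndAlg := ω.inv.hom.toBialgHom

/-- The action of `End F'' ≅ End F ⊗ End F'` on `F x ⊗ F' y`. -/
def pairAct (x : X.Cat) (y : Y.Cat) : W.endHopf.obj →ₐ[k] End (X.fib.obj x ⊗ Y.fib.obj y) :=
  (tensEnd (ev X.endAlgEquiv x) (ev Y.endAlgEquiv y)).comp
    (tensBialgHom ω : W.endHopf.obj →ₐ[k] X.EndAlg ⊗[k] Y.EndAlg)

theorem pairAct_apply (x : X.Cat) (y : Y.Cat) (t : X.EndAlg ⊗[k] Y.EndAlg) :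
    pairAct ω x y (tensAlgEquiv ω t) = tensEnd (ev X.endAlgEquiv x) (ev Y.endAlgEquiv y) t :=
  congrArg (tensEnd (ev X.endAlgEquiv x) (ev Y.endAlgEquiv y))
    ((tensAlgEquiv ω).symm_apply_apply t)

/-- The functor which equips `F x ⊗ F' y` with its action of `End F''`. -/
def pairMod : X.Cat × Y.Cat ⥤ FDMod k W.endHopf.obj where
  obj x := FDMod.ofAct (X.fib.obj x.1 ⊗ Y.fib.obj x.2) (pairAct ω x.1 x.2)
  map {x y} f := FDMod.homMk (M := FDMod.ofAct _ (pairAct ω x.1 x.2))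
    (N := FDMod.ofAct _ (pairAct ω y.1 y.2)) (X.fib.map f.1 ⊗ₘ Y.fib.map f.2) fun _ =>
      tensEnd_ev_natural X.endAlgEquiv Y.endAlgEquiv f.1 f.2 _
  map_id x := FDMod.hom_ext ((X.fib₂ Y).map_id x)
  map_comp f g := FDMod.hom_ext ((X.fib₂ Y).map_comp f g)

theorem tensEnd_pairAct (a : W.endHopf.obj) (x x' : X.Cat) (y y' : Y.Cat) :
    tensEnd (pairAct ω x y) (pairAct ω x' y') (Coalgebra.comul (R := k) a) ≫
        μ (X.fib₂ Y) (x, y) (x', y') =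
      μ (X.fib₂ Y) (x, y) (x', y') ≫ pairAct ω (x ⊗ x') (y ⊗ y') a := by
  have h := tensEnd_comul X.isBialgEnd_endAlgEquiv Y.isBialgEnd_endAlgEquiv (tensBialgHom ω a)
    x x' y y'
  rw [← CoalgHomClass.map_comp_comul_apply] at h
  refine Eq.trans (congrArg (· ≫ _) ?_) h
  exact (tensEnd_map _ _ _ _ _).symm

theorem pairAct_unit (a : W.endHopf.obj) :
    ε (X.fib₂ Y) ≫ pairAct ω (𝟙_ X.Cat) (𝟙_ Y.Cat) a =
      Coalgebra.counit (R := k) a • ε (X.fib₂ Y) := by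
  have h := tensEnd_counit X.isBialgEnd_endAlgEquiv Y.isBialgEnd_endAlgEquiv (tensBialgHom ω a)
  rwa [CoalgHomClass.counit_comp_apply] at h

instance : (pairMod ω).Monoidal :=
  Functor.CoreMonoidal.toMonoidal
    { εIso := FDMod.isoMk (M := 𝟙_ (FDMod k W.endHopf.obj)) (N := (pairMod ω).obj (𝟙_ _))
        (Functor.Monoidal.εIso (X.fib₂ Y)) fun a => by
          rw [FDMod.unit_act]
          refine (Linear.smul_comp ..).trans ?_
          exact (congrArg _ (Category.id_comp _)).trans (pairAct_unit ω a).symm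
      μIso := fun x y => FDMod.isoMk (M := (pairMod ω).obj x ⊗ (pairMod ω).obj y)
        (N := (pairMod ω).obj (x ⊗ y)) (Functor.Monoidal.μIso (X.fib₂ Y) x y) fun a => by
          rw [FDMod.tensor_act]
          exact tensEnd_pairAct ω a x.1 y.1 x.2 y.2
      μIso_hom_natural_left := fun f c => FDMod.hom_ext (μ_natural_left (X.fib₂ Y) f c)
      μIso_hom_natural_right := fun c f => FDMod.hom_ext (μ_natural_right (X.fib₂ Y) c f)
      associativity := fun c d f => FDMod.hom_ext (associativity (X.fib₂ Y) c d f)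
      left_unitality := fun c => FDMod.hom_ext (left_unitality (X.fib₂ Y) c)
      right_unitality := fun c => FDMod.hom_ext (right_unitality (X.fib₂ Y) c) }

theorem isBilinear_pairMod : IsBilinear k (pairMod ω) where
  additive_left d := ⟨fun {c c' f g} => FDMod.hom_ext <| by
    change X.fib.map (f + g) ⊗ₘ Y.fib.map (𝟙 d) =
      (X.fib.map f ⊗ₘ Y.fib.map (𝟙 d)) + (X.fib.map g ⊗ₘ Y.fib.map (𝟙 d))
    rw [X.fib.map_add, MonoidalPreadditive.add_tensor]⟩
  linear_left d := ⟨fun {c c'} f r => FDMod.hom_ext <| by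
    change X.fib.map (r • f) ⊗ₘ Y.fib.map (𝟙 d) = r • (X.fib.map f ⊗ₘ Y.fib.map (𝟙 d))
    rw [Functor.Linear.map_smul (F := X.fib), CategoryTheory.Functor.map_id, tensorHom_id,
      tensorHom_id, MonoidalLinear.smul_whiskerRight]⟩
  additive_right c := ⟨fun {d d' f g} => FDMod.hom_ext <| by
    change X.fib.map (𝟙 c) ⊗ₘ Y.fib.map (f + g) =
      (X.fib.map (𝟙 c) ⊗ₘ Y.fib.map f) + (X.fib.map (𝟙 c) ⊗ₘ Y.fib.map g)
    rw [Y.fib.map_add, MonoidalPreadditive.tensor_add]⟩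
  linear_right c := ⟨fun {d d'} f r => FDMod.hom_ext <| by
    change X.fib.map (𝟙 c) ⊗ₘ Y.fib.map (r • f) = r • (X.fib.map (𝟙 c) ⊗ₘ Y.fib.map f)
    rw [Functor.Linear.map_smul (F := Y.fib), CategoryTheory.Functor.map_id, id_tensorHom,
      id_tensorHom, MonoidalLinear.whiskerLeft_smul]⟩

/-- The forgetful functor takes `pairMod` to `F ⊗ F'`. -/
def pairModForget : pairMod ω ⋙ FDMod.forget k W.endHopf.obj ≅ X.fib₂ Y :=
  NatIso.ofComponents (fun _ => Iso.refl _) fun f =>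
    (Category.comp_id ((X.fib₂ Y).map f)).trans (Category.id_comp ((X.fib₂ Y).map f)).symm

instance : NatTrans.IsMonoidal (pairModForget ω).hom where
  unit := by
    refine (Category.comp_id _).trans ?_
    exact Category.id_comp (ε (X.fib₂ Y))
  tensor x y := by
    refine (Category.comp_id _).trans ?_
    refine Eq.trans ?_ (congrArg (· ≫ _) (MonoidalCategory.id_tensorHom_id _ _)).symm
    exact (Category.id_comp (μ (X.fib₂ Y) x y)).trans (Category.id_comp (μ (X.fib₂ Y) x y)).symm

end FusFib

namespace FusFib

variable {k : Type u} [Field k] [IsAlgClosed k] {X Y W : FusFib k}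

instance (W : FusFib k) : W.endHopfIso.mor.T.IsEquivalence := W.endHopfIso.isEquivalence

/-- The inverse of the identification of `(C, F)` with modules over `End F`. -/
def modInverse (W : FusFib k) : FDMod k W.endHopf.obj ⥤ W.Cat := W.endHopfIso.mor.inverse.T

instance (W : FusFib k) : W.modInverse.Additive := W.endHopfIso.mor.inverse.additive
instance (W : FusFib k) : W.modInverse.Linear k := W.endHopfIso.mor.inverse.linear
instance (W : FusFib k) : W.modInverse.Monoidal := W.endHopfIso.mor.inverse.monoidal

/-- The fiber functor restricts to the forgetful functor on modules. -/
def modInverseFib (W : FusFib k) : FDMod.forget k W.endHopf.obj ≅ W.modInverse ⋙ W.fib :=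
  W.endHopfIso.mor.inverse.τ

instance (W : FusFib k) : NatTrans.IsMonoidal W.modInverseFib.hom :=
  W.endHopfIso.mor.inverse.isMonoidal

theorem modInverse_act (W : FusFib k) (M : FDMod k W.endHopf.obj) (a : W.EndAlg) :
    M.act a ≫ W.modInverseFib.hom.app M =
      W.modInverseFib.hom.app M ≫ ev W.endAlgEquiv (W.modInverse.obj M) a := by
  let E := W.endHopfIso.mor.T.asEquivalence
  have h := FDMod.hom_act (E.counitIso.inv.app M) a
  have h₁ : W.modInverseFib.hom.app M = FDMod.Hom.hom (E.counitIso.inv.app M) := by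
    have aux : ∀ {P Q : FGModuleCat.{u} k} (t : P ⟶ Q), 𝟙 P ≫ t ≫ 𝟙 Q ≫ 𝟙 Q = t := fun t => by simp
    exact aux _
  rw [h₁]
  exact h

variable (ω : X.endHopf ⊗ Y.endHopf ≅ W.endHopf)

/-- The bifunctor to the category of `F''` given by an isomorphism `End F ⊗ End F' ≅ End F''`. -/
abbrev pairBox : X.Cat × Y.Cat ⥤ W.Cat := pairMod ω ⋙ W.modInverse

/-- The fiber of the bifunctor `pairBox`. -/
def pairFib : pairBox ω ⋙ W.fib ≅ X.fib₂ Y :=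
  Functor.associator _ _ _ ≪≫ Functor.isoWhiskerLeft (pairMod ω) W.modInverseFib.symm ≪≫
    pairModForget ω

instance : NatTrans.IsMonoidal (pairFib ω).hom :=
  have : NatTrans.IsMonoidal (F₁ := pairMod ω ⋙ W.modInverse ⋙ W.fib)
    (Functor.whiskerLeft (pairMod ω) W.modInverseFib.inv) := NatTrans.IsMonoidal.whiskerLeft _
  inferInstanceAs (NatTrans.IsMonoidal ((Functor.associator (pairMod ω) W.modInverse W.fib).hom ≫
    Functor.whiskerLeft (pairMod ω) W.modInverseFib.inv ≫ (pairModForget ω).hom))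

theorem ev_pairBox (t : X.EndAlg ⊗[k] Y.EndAlg) (x : X.Cat) (y : Y.Cat) :
    ev W.endAlgEquiv ((pairBox ω).obj (x, y)) (tensAlgEquiv ω t) ≫ (pairFib ω).hom.app (x, y) =
      (pairFib ω).hom.app (x, y) ≫ tensEnd (ev X.endAlgEquiv x) (ev Y.endAlgEquiv y) t := by
  have h := W.modInverse_act ((pairMod ω).obj (x, y)) (tensAlgEquiv ω t)
  have h' : ((pairMod ω).obj (x, y)).act (tensAlgEquiv ω t) =
    tensEnd (ev X.endAlgEquiv x) (ev Y.endAlgEquiv y) t := pairAct_apply ω x y t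
  have aux : ∀ {P Q : FGModuleCat.{u} k} {t : P ≅ Q} {f : P ⟶ P} {g g' : Q ⟶ Q}
      (_ : g ≫ t.inv = t.inv ≫ f) (_ : g = g'), f ≫ 𝟙 P ≫ t.hom ≫ 𝟙 Q =
        (𝟙 P ≫ t.hom ≫ 𝟙 Q) ≫ g' := by
    rintro P Q t f g _ h rfl
    rw [Iso.eq_inv_comp] at h
    simp [← h]
  exact aux (t := (W.modInverseFib.symm.app ((pairMod ω).obj (x, y)))) h h'

theorem isSimpleFamily_pairBox : IsSimpleFamily k fun i : Fin X.rank × Fin Y.rank =>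
    (pairBox ω).obj (X.simples i.1, Y.simples i.2) := by
  have : W.endHopfIso.functor.IsEquivalence := W.endHopfIso.isEquivalence
  refine IsSimpleFamily.of_map W.endHopfIso.functor
    (FDMod.isSimpleFamily_of_bijective (FDMod.actPi_bijective ?_))
  have key : ∀ (t : X.EndAlg ⊗[k] Y.EndAlg) i j, ev W.endAlgEquiv
      ((pairBox ω).obj (X.simples i, Y.simples j)) (tensAlgEquiv ω t) =
      (pairFib ω).hom.app (X.simples i, Y.simples j) ≫
        tensEnd (ev X.endAlgEquiv (X.simples i)) (ev Y.endAlgEquiv (Y.simples j)) t ≫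
          (pairFib ω).inv.app (X.simples i, Y.simples j) := fun t i j => by
    rw [← reassoc_of% ev_pairBox, Iso.hom_inv_id_app]
    exact (Category.comp_id (ev W.endAlgEquiv _ _)).symm
  constructor
  · intro a b hab
    obtain ⟨t, rfl⟩ := (tensAlgEquiv ω).surjective a
    obtain ⟨t', rfl⟩ := (tensAlgEquiv ω).surjective b
    refine congrArg _ (tensEnd_ext X.endAlgEquiv Y.endAlgEquiv ?_)
    refine binatural_ext (θ := fun c d => tensEnd (ev X.endAlgEquiv c) (ev Y.endAlgEquiv d) t)
      (θ' := fun c d => tensEnd (ev X.endAlgEquiv c) (ev Y.endAlgEquiv d) t')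
      X.isSimpleFamily.decomp Y.isSimpleFamily.decomp
      (fun f g => tensEnd_ev_natural X.endAlgEquiv Y.endAlgEquiv f g t)
      (fun f g => tensEnd_ev_natural X.endAlgEquiv Y.endAlgEquiv f g t') fun i j => ?_
    have h := (key t i j).symm.trans ((congrFun hab (i, j)).trans (key t' i j))
    exact (cancel_mono ((pairFib ω).inv.app (X.simples i, Y.simples j))).mp
      ((cancel_epi ((pairFib ω).hom.app (X.simples i, Y.simples j))).mp h)
  · intro θ
    obtain ⟨t, ht⟩ := exists_tensEnd_ev_simples X.isSimpleFamily Y.isSimpleFamily X.endAlgEquiv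
      Y.endAlgEquiv fun i j => (pairFib ω).inv.app (X.simples i, Y.simples j) ≫ θ (i, j) ≫
        (pairFib ω).hom.app (X.simples i, Y.simples j)
    refine ⟨tensAlgEquiv ω t, funext fun i => (key t i.1 i.2).trans ?_⟩
    rw [ht]
    have aux : ∀ {P Q : FGModuleCat.{u} k} (v : P ≅ Q) (f : P ⟶ P),
        v.hom ≫ (v.inv ≫ f ≫ v.hom) ≫ v.inv = f := by simp
    exact aux ((pairFib ω).app (X.simples i.1, Y.simples i.2)) _

omit [IsAlgClosed k] in
theorem fib_id_ne_zero (X : FusFib k) {x : X.Cat} (hx : 𝟙 x ≠ 0) : 𝟙 (X.fib.obj x) ≠ 0 := fun h =>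
  hx (X.fib.map_injective ((X.fib.map_id x).trans (h.trans (X.fib.map_zero x x).symm)))

/-- An isomorphism `End F ⊗ End F' ≅ End F''` exhibits the category of `F''` as a Deligne
product. -/
def pairProduct : DeligneProduct X Y W where
  box := pairBox ω
  fibIso := pairFib ω
  isDeligneProduct := ((isBilinear_pairMod ω).comp W.modInverse).isDeligneProduct
    X.isSimpleFamily Y.isSimpleFamily (isSimpleFamily_pairBox ω) fun i j h => by
      have := X.simple_simples i
      have := Y.simple_simples j
      refine FGModuleCat.id_tensor_ne_zero (X.fib_id_ne_zero (id_nonzero (X.simples i)))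
        (Y.fib_id_ne_zero (id_nonzero (Y.simples j))) ?_
      have h' : 𝟙 (W.fib.obj ((pairBox ω).obj (X.simples i, Y.simples j))) = 0 :=
        (W.fib.map_id _).symm.trans ((congrArg W.fib.map h).trans (W.fib.map_zero _ _))
      have aux : ∀ {P Q : FGModuleCat.{u} k} (_ : P ≅ Q) (_ : 𝟙 P = 0), 𝟙 Q = 0 := fun v h => by
        rw [← v.inv_hom_id, ← Category.id_comp v.hom, h, Limits.zero_comp, Limits.comp_zero]
      exact aux ((pairFib ω).app (X.simples i, Y.simples j)) h'

theorem pairProduct_algHom (t : X.EndAlg ⊗[k] Y.EndAlg) :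
    (pairProduct ω).algHom t = tensAlgEquiv ω t := by
  obtain ⟨x, hx⟩ := X.exists_injective X.endAlgEquiv
  obtain ⟨y, hy⟩ := Y.exists_injective Y.endAlgEquiv
  refine (pairProduct ω).injective_ev_endAlg hx hy ?_
  rw [← cancel_mono ((pairProduct ω).fib x y), DeligneProduct.ev_algHom]
  exact (ev_pairBox ω t x y).symm

end FusFib

/-! ### Lifting isomorphisms of fiber functors -/

theorem AlgHom.surjective_map_id_assoc {k A B C D : Type*} [CommRing k] [Ring A] [Algebra k A]
    [Ring B] [Algebra k B] [Ring C] [Algebra k C] [Ring D] [Algebra k D] (f : B ⊗[k] C →ₐ[k] D)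
    (hf : Function.Surjective f) : Function.Surjective fun t : (A ⊗[k] B) ⊗[k] C =>
      Algebra.TensorProduct.map (AlgHom.id k A) f (TensorProduct.assoc k A B C t) := fun t => by
  obtain ⟨t, rfl⟩ := TensorProduct.map_surjective (g := LinearMap.id) (g' := f.toLinearMap)
    Function.surjective_id hf t
  obtain ⟨t, rfl⟩ := (TensorProduct.assoc k A B C).surjective t
  exact ⟨t, rfl⟩

namespace FusFib

variable {k : Type u} [Field k] [IsAlgClosed k]

theorem exists_iso_of_fib {W W' : FusFib k} {f : W ⟶ W'} {m : FibCat.Mor W.obj W'.obj}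
    (hm : Represents m f) {D : Type*} [Category D] (G : D ⥤ W.Cat) (G' : D ⥤ W'.Cat)
    (v : ∀ d, W.fib.obj (G.obj d) ≅ W'.fib.obj (G'.obj d))
    (hv : ∀ {d d'} (g : d ⟶ d'),
      W.fib.map (G.map g) ≫ (v d').hom = (v d).hom ≫ W'.fib.map (G'.map g))
    (hact : ∀ d r, ev W.endAlgEquiv (G.obj d) (endAlgMap f r) ≫ (v d).hom =
      (v d).hom ≫ ev W'.endAlgEquiv (G'.obj d) r) :
    ∃ u : G ⋙ m.T ≅ G', ∀ d,
      m.τ.hom.app (G.obj d) ≫ W'.fib.map (u.hom.app d) = (v d).hom := by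
  have : W'.endHopfIso.functor.IsEquivalence := W'.endHopfIso.isEquivalence
  let i : ∀ d, W'.endHopfIso.functor.obj (m.T.obj (G.obj d)) ≅
      W'.endHopfIso.functor.obj (G'.obj d) := fun d =>
    FDMod.isoMk (M := W'.endHopfIso.functor.obj (m.T.obj (G.obj d)))
      (N := W'.endHopfIso.functor.obj (G'.obj d)) ((m.τ.app (G.obj d)).symm ≪≫ v d) fun r => by
        have h₁ := ev_endAlgMap_comp hm r (G.obj d)
        have h₂ := hact d r
        have aux : ∀ {P Q R : FGModuleCat.{u} k} {t : P ≅ Q} {v : P ⟶ R} {a : P ⟶ P} {b : Q ⟶ Q}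
            {c : R ⟶ R} (_ : a ≫ t.hom = t.hom ≫ b) (_ : a ≫ v = v ≫ c),
            b ≫ t.inv ≫ v = (t.inv ≫ v) ≫ c := fun {P Q R t v a b c} h h' => by
          rw [Category.assoc, ← h', Iso.eq_inv_comp, ← reassoc_of% h, Iso.hom_inv_id_assoc]
        exact aux (t := m.τ.app (G.obj d)) h₁ h₂
  let j : ∀ d, m.T.obj (G.obj d) ≅ G'.obj d := fun d => W'.endHopfIso.functor.preimageIso (i d)
  have hj : ∀ d, m.τ.hom.app (G.obj d) ≫ W'.fib.map (j d).hom = (v d).hom := fun d => by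
    have h : W'.endHopfIso.functor.map (j d).hom = (i d).hom := by simp [j]
    have h' : W'.fib.map (j d).hom = m.τ.inv.app (G.obj d) ≫ (v d).hom := congrArg FDMod.Hom.hom h
    rw [h', Iso.hom_inv_id_app_assoc]
  refine ⟨NatIso.ofComponents j fun {d d'} g => W'.fib.map_injective ?_, hj⟩
  rw [← cancel_epi (m.τ.hom.app (G.obj d)), Functor.map_comp, Functor.map_comp, reassoc_of% hj,
    ← hv, ← hj]
  have h := m.τ.hom.naturality (G.map g)
  exact (Category.assoc _ _ _).symm.trans ((congrArg (· ≫ _) h.symm).trans (Category.assoc _ _ _))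

end FusFib

namespace DeligneProduct

open FusFib

variable {k : Type u} [Field k] [IsAlgClosed k] {X Y Z W V X' Y' Z' W' V' I : FusFib k}

omit [IsAlgClosed k] in
theorem fib_natural (P : DeligneProduct X Y Z) {x x' : X.Cat} {y y' : Y.Cat} (f : x ⟶ x')
    (g : y ⟶ y') : Z.fib.map (P.box.map ((f, g) : (x, y) ⟶ (x', y'))) ≫ P.fib x' y' =
      P.fib x y ≫ (X.fib.map f ⊗ₘ Y.fib.map g) :=
  P.fibIso.hom.naturality ((f, g) : (x, y) ⟶ (x', y'))

theorem algHom_surjective (P : DeligneProduct X Y Z) : Function.Surjective P.algHom := fun r =>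
  ⟨P.hopfIso.inv.hom.toBialgHom r,
    DFunLike.congr_fun (congrArg (fun f : Z.endHopf ⟶ Z.endHopf => f.hom.toBialgHom)
      P.hopfIso.inv_hom_id) r⟩

theorem exists_iso_map (P : DeligneProduct X Y Z) (P' : DeligneProduct X' Y' Z') {f : X ⟶ X'}
    {g : Y ⟶ Y'} {h : Z ⟶ Z'} {m : FibCat.Mor X.obj X'.obj} {n : FibCat.Mor Y.obj Y'.obj}
    {p : FibCat.Mor Z.obj Z'.obj} (hm : Represents m f) (hn : Represents n g) (hp : Represents p h)
    (H : ∀ t : X'.EndAlg ⊗[k] Y'.EndAlg,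
      P.algHom (Algebra.TensorProduct.map (endAlgMap f) (endAlgMap g) t) =
        endAlgMap h (P'.algHom t)) :
    ∃ u : P.box ⋙ p.T ≅ m.T.prod n.T ⋙ P'.box, ∀ (x : X.Cat) (y : Y.Cat),
      p.τ.hom.app (P.obj x y) ≫ Z'.fib.map (u.hom.app (x, y)) ≫
        P'.fib (m.T.obj x) (n.T.obj y) = P.fib x y ≫ (m.τ.hom.app x ⊗ₘ n.τ.hom.app y) := by
  let v : ∀ d : X.Cat × Y.Cat, Z.fib.obj (P.box.obj d) ≅
      Z'.fib.obj ((m.T.prod n.T ⋙ P'.box).obj d) :=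
    fun d => P.fibIso.app d ≪≫ (m.τ.app d.1 ⊗ᵢ n.τ.app d.2) ≪≫
      (P'.fibIso.app (m.T.obj d.1, n.T.obj d.2)).symm
  have hv : ∀ d, (v d).hom ≫ P'.fib (m.T.obj d.1) (n.T.obj d.2) =
      P.fib d.1 d.2 ≫ (m.τ.hom.app d.1 ⊗ₘ n.τ.hom.app d.2) := fun d => by
    have aux : ∀ {P Q R S : FGModuleCat.{u} k} (a : P ⟶ Q) (b : Q ⟶ R) (c : S ≅ R),
      (a ≫ b ≫ c.inv) ≫ c.hom = a ≫ b := by simp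
    exact aux _ _ _
  obtain ⟨u, hu⟩ := exists_iso_of_fib hp P.box (m.T.prod n.T ⋙ P'.box) v (fun {d d'} g' => by
    rw [← cancel_mono (P'.fib (m.T.obj d'.1) (n.T.obj d'.2)), Category.assoc, hv]
    have h₁ := P.fib_natural g'.1 g'.2
    have h₂ := P'.fib_natural (m.T.map g'.1) (n.T.map g'.2)
    have h₃ : (X.fib.map g'.1 ⊗ₘ Y.fib.map g'.2) ≫ (m.τ.hom.app d'.1 ⊗ₘ n.τ.hom.app d'.2) =
        (m.τ.hom.app d.1 ⊗ₘ n.τ.hom.app d.2) ≫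
          (X'.fib.map (m.T.map g'.1) ⊗ₘ Y'.fib.map (n.T.map g'.2)) := by
      have h₁ := m.τ.hom.naturality g'.1
      have h₂ := n.τ.hom.naturality g'.2
      exact (tensorHom_comp_tensorHom _ _ _ _).trans ((congrArg₂ _ h₁ h₂).trans
        (tensorHom_comp_tensorHom _ _ _ _).symm)
    refine (Category.assoc _ _ _).symm.trans ((congrArg (· ≫ _) h₁).trans
      ((Category.assoc _ _ _).trans ?_))
    rw [h₃, ← reassoc_of% hv]
    exact congrArg (_ ≫ ·) h₂.symm) fun d r => by
    obtain ⟨t, rfl⟩ := P'.algHom_surjective r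
    rw [← cancel_mono (P'.fib (m.T.obj d.1) (n.T.obj d.2)), Category.assoc, hv, ← H]
    refine (Category.assoc _ _ _).symm.trans ((congrArg (· ≫ _) (P.ev_algHom _ d.1 d.2)).trans
      ((Category.assoc _ _ _).trans ?_))
    rw [tensEnd_map, tensEnd_natural (ρ' := ev X'.endAlgEquiv _)
      (σ' := ev Y'.endAlgEquiv _) _ _ (fun a => ev_endAlgMap_comp hm a d.1)
      (fun b => ev_endAlgMap_comp hn b d.2), ← reassoc_of% hv, ← P'.ev_algHom]
    exact (Category.assoc _ _ _).symm
  refine ⟨u, fun x y => ?_⟩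
  have h := hu (x, y)
  exact (Category.assoc _ _ _).symm.trans ((congrArg (· ≫ _) h).trans (hv (x, y)))

theorem exists_iso_assoc (P : DeligneProduct X Y W) (P' : DeligneProduct W Z V)
    (R : DeligneProduct Y Z W') (R' : DeligneProduct X W' V') {a : V ⟶ V'}
    {m : FibCat.Mor V.obj V'.obj} (hm : Represents m a)
    (H : ∀ t : (X.EndAlg ⊗[k] Y.EndAlg) ⊗[k] Z.EndAlg,
      P'.algHom (Algebra.TensorProduct.map P.algHom (AlgHom.id k _) t) =
        endAlgMap a (R'.algHom (Algebra.TensorProduct.map (AlgHom.id k _) R.algHom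
          (TensorProduct.assoc k _ _ _ t)))) :
    ∃ u : P.box.prod (𝟭 Z.Cat) ⋙ P'.box ⋙ m.T ≅
      CategoryTheory.prod.associator X.Cat Y.Cat Z.Cat ⋙ (𝟭 X.Cat).prod R.box ⋙ R'.box,
      ∀ (x : X.Cat) (y : Y.Cat) (z : Z.Cat),
        m.τ.hom.app (P'.obj (P.obj x y) z) ≫ V'.fib.map (u.hom.app ((x, y), z)) ≫
            R'.fib x (R.obj y z) ≫ X.fib.obj x ◁ R.fib y z =
          P'.fib (P.obj x y) z ≫ P.fib x y ▷ Z.fib.obj z ≫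
            (α_ (X.fib.obj x) (Y.fib.obj y) (Z.fib.obj z)).hom := by
  let i : ∀ d : (X.Cat × Y.Cat) × Z.Cat, V.fib.obj (P'.obj (P.obj d.1.1 d.1.2) d.2) ≅
      X.fib.obj d.1.1 ⊗ Y.fib.obj d.1.2 ⊗ Z.fib.obj d.2 := fun d =>
    P'.fibIso.app (P.box.obj d.1, d.2) ≪≫ whiskerRightIso (P.fibIso.app d.1) (Z.fib.obj d.2) ≪≫
      α_ (X.fib.obj d.1.1) (Y.fib.obj d.1.2) (Z.fib.obj d.2)
  let j : ∀ d : (X.Cat × Y.Cat) × Z.Cat, V'.fib.obj (R'.obj d.1.1 (R.obj d.1.2 d.2)) ≅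
      X.fib.obj d.1.1 ⊗ Y.fib.obj d.1.2 ⊗ Z.fib.obj d.2 := fun d =>
    R'.fibIso.app (d.1.1, R.box.obj (d.1.2, d.2)) ≪≫
      whiskerLeftIso (X.fib.obj d.1.1) (R.fibIso.app (d.1.2, d.2))
  have aux : ∀ {A B C A' B' : FGModuleCat.{u} k} {i : A ≅ B} {j : C ≅ B} {i' : A' ≅ B'}
      {C' : FGModuleCat.{u} k} {j' : C' ≅ B'} {f : A ⟶ A'} {g : C ⟶ C'} (b : B ⟶ B')
      (_ : f ≫ i'.hom = i.hom ≫ b) (_ : g ≫ j'.hom = j.hom ≫ b),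
      f ≫ (i' ≪≫ j'.symm).hom = (i ≪≫ j.symm).hom ≫ g := by
    intro A B C A' B' i j i' C' j' f g b h h'
    rw [Iso.trans_hom, Iso.trans_hom, Iso.symm_hom, Iso.symm_hom, reassoc_of% h, Category.assoc,
      (Iso.eq_comp_inv _).2 h', Category.assoc, Iso.inv_hom_id_assoc]
  have sq : ∀ {A B C A' B' C' : FGModuleCat.{u} k} {f : A ⟶ A'} {g : B ⟶ B'} {h : C ⟶ C'}
      {p : A ⟶ B} {q : B ⟶ C} {p' : A' ⟶ B'} {q' : B' ⟶ C'} (_ : f ≫ p' = p ≫ g)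
      (_ : g ≫ q' = q ≫ h), f ≫ p' ≫ q' = (p ≫ q) ≫ h := fun h h' => by
    rw [reassoc_of% h, h', Category.assoc]
  obtain ⟨u, hu⟩ := exists_iso_of_fib hm (P.box.prod (𝟭 Z.Cat) ⋙ P'.box)
    (CategoryTheory.prod.associator X.Cat Y.Cat Z.Cat ⋙ (𝟭 X.Cat).prod R.box ⋙ R'.box)
    (fun d => i d ≪≫ (j d).symm) (fun {d d'} g => by
      refine aux (X.fib.map g.1.1 ⊗ₘ Y.fib.map g.1.2 ⊗ₘ Z.fib.map g.2) ?_ ?_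
      · refine sq (P'.fib_natural (P.box.map g.1) g.2) (sq ?_ (associator_naturality _ _ _))
        have h := congrArg₂ (· ⊗ₘ ·) (P.fib_natural g.1.1 g.1.2)
          ((Category.comp_id _).trans (Category.id_comp (Z.fib.map g.2)).symm)
        refine (congrArg (_ ≫ ·) (tensorHom_id _ _).symm).trans
          (Eq.trans ?_ (congrArg (· ≫ _) (tensorHom_id _ _)))
        exact (tensorHom_comp_tensorHom _ _ _ _).trans
          (h.trans (tensorHom_comp_tensorHom _ _ _ _).symm)
      · refine sq (R'.fib_natural g.1.1
          (R.box.map ((g.1.2, g.2) : (d.1.2, d.2) ⟶ (d'.1.2, d'.2)))) ?_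
        have h := congrArg₂ (· ⊗ₘ ·)
          ((Category.comp_id _).trans (Category.id_comp (X.fib.map g.1.1)).symm)
          (R.fib_natural g.1.2 g.2)
        refine (congrArg (_ ≫ ·) (id_tensorHom _ _).symm).trans
          (Eq.trans ?_ (congrArg (· ≫ _) (id_tensorHom _ _)))
        exact (tensorHom_comp_tensorHom _ _ _ _).trans
          (h.trans (tensorHom_comp_tensorHom _ _ _ _).symm)) fun d r => by
      obtain ⟨t, rfl⟩ := R'.algHom_surjective r
      obtain ⟨t, rfl⟩ := R.algHom.surjective_map_id_assoc R.algHom_surjective t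
      rw [← H]
      refine aux (tensEnd (ev X.endAlgEquiv d.1.1)
        (tensEnd (ev Y.endAlgEquiv d.1.2) (ev Z.endAlgEquiv d.2))
          (TensorProduct.assoc k _ _ _ t)) ?_ ?_
      · refine sq (P'.ev_algHom _ _ _) (sq ?_ (tensEnd_assoc _ _ _ t))
        have h := tensEnd_natural (ρ := (ev W.endAlgEquiv (P.obj d.1.1 d.1.2)).comp P.algHom)
          (σ := (ev Z.endAlgEquiv d.2).comp (AlgHom.id k _)) (σ' := ev Z.endAlgEquiv d.2)
          (P.fib d.1.1 d.1.2) (𝟙 (Z.fib.obj d.2)) (fun t => P.ev_algHom t d.1.1 d.1.2)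
          (fun t => (Category.comp_id _).trans (Category.id_comp (ev Z.endAlgEquiv d.2 t)).symm) t
        rw [tensorHom_id, ← tensEnd_map] at h
        exact h
      · refine sq (R'.ev_algHom _ _ _) ?_
        have h := tensEnd_natural (ρ := (ev X.endAlgEquiv d.1.1).comp (AlgHom.id k _))
          (ρ' := ev X.endAlgEquiv d.1.1) (σ := (ev W'.endAlgEquiv (R.obj d.1.2 d.2)).comp R.algHom)
          (𝟙 (X.fib.obj d.1.1)) (R.fib d.1.2 d.2)
          (fun t => (Category.comp_id _).trans (Category.id_comp (ev X.endAlgEquiv d.1.1 t)).symm)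
          (fun t => R.ev_algHom t d.1.2 d.2) (TensorProduct.assoc k _ _ _ t)
        rw [id_tensorHom, ← tensEnd_map] at h
        exact h
  refine ⟨u, fun x y z => ?_⟩
  have aux : ∀ {A B C D : FGModuleCat.{u} k} {i : A ≅ B} {j : C ≅ B} {f : A ⟶ D} {g : D ⟶ C}
      (_ : f ≫ g = (i ≪≫ j.symm).hom), f ≫ g ≫ j.hom = i.hom := fun {A B C D i j f g} h => by
    rw [reassoc_of% h, Iso.trans_hom, Category.assoc, Iso.symm_hom, Iso.inv_hom_id,
      Category.comp_id]
  exact aux (hu ((x, y), z))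

theorem exists_iso_leftUnitor (P : DeligneProduct I X Z) {l : Z ⟶ X} {m : FibCat.Mor Z.obj X.obj}
    (hm : Represents m l) (H : ∀ a : X.EndAlg, endAlgMap l a = P.algHom (1 ⊗ₜ a)) :
    ∃ u : (Functor.curry.obj P.box).obj (𝟙_ _) ⋙ m.T ≅ 𝟭 X.Cat, ∀ x : X.Cat,
      m.τ.hom.app (P.obj (𝟙_ _) x) ≫ X.fib.map (u.hom.app x) =
        P.fib (𝟙_ _) x ≫ Functor.OplaxMonoidal.η I.fib ▷ X.fib.obj x ≫ (λ_ (X.fib.obj x)).hom := by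
  have aux : ∀ {A A' : FGModuleCat.{u} k} (f : A ⟶ A'), (𝟙 (I.fib.obj (𝟙_ _)) ⊗ₘ f) ≫
      Functor.OplaxMonoidal.η I.fib ▷ A' ≫ (λ_ A').hom =
        (Functor.OplaxMonoidal.η I.fib ▷ A ≫ (λ_ A).hom) ≫ f := fun {A A'} f => by
    rw [id_tensorHom, whisker_exchange_assoc, leftUnitor_naturality, Category.assoc]
  have sq : ∀ {A B C A' B' C' : FGModuleCat.{u} k} {f : A ⟶ A'} {g : B ⟶ B'} {h : C ⟶ C'}
      {p : A ⟶ B} {q : B ⟶ C} {p' : A' ⟶ B'} {q' : B' ⟶ C'} (_ : f ≫ p' = p ≫ g)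
      (_ : g ≫ q' = q ≫ h), f ≫ p' ≫ q' = (p ≫ q) ≫ h := fun h h' => by
    rw [reassoc_of% h, h', Category.assoc]
  refine exists_iso_of_fib hm ((Functor.curry.obj P.box).obj (𝟙_ _)) (𝟭 X.Cat)
    (fun x => P.fibIso.app (𝟙_ _, x) ≪≫
    whiskerRightIso (Functor.Monoidal.εIso I.fib).symm (X.fib.obj x) ≪≫ λ_ (X.fib.obj x))
    (fun {x x'} g => sq (P.fib_natural (𝟙 (𝟙_ _)) g) ?_) fun x a => ?_
  · rw [CategoryTheory.Functor.map_id]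
    exact aux _
  · rw [H]
    refine sq (P.ev_algHom _ _ _) ?_
    rw [tensEnd_tmul, map_one]
    exact aux _

theorem exists_iso_rightUnitor (P : DeligneProduct X I Z) {l : Z ⟶ X} {m : FibCat.Mor Z.obj X.obj}
    (hm : Represents m l) (H : ∀ a : X.EndAlg, endAlgMap l a = P.algHom (a ⊗ₜ 1)) :
    ∃ u : (Functor.curry.obj P.box).flip.obj (𝟙_ _) ⋙ m.T ≅ 𝟭 X.Cat, ∀ x : X.Cat,
      m.τ.hom.app (P.obj x (𝟙_ _)) ≫ X.fib.map (u.hom.app x) =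
        P.fib x (𝟙_ _) ≫ X.fib.obj x ◁ Functor.OplaxMonoidal.η I.fib ≫ (ρ_ (X.fib.obj x)).hom := by
  have aux : ∀ {A A' : FGModuleCat.{u} k} (f : A ⟶ A'), (f ⊗ₘ 𝟙 (I.fib.obj (𝟙_ _))) ≫
      A' ◁ Functor.OplaxMonoidal.η I.fib ≫ (ρ_ A').hom =
        (A ◁ Functor.OplaxMonoidal.η I.fib ≫ (ρ_ A).hom) ≫ f := fun {A A'} f => by
    rw [tensorHom_id, ← whisker_exchange_assoc, rightUnitor_naturality, Category.assoc]
  have sq : ∀ {A B C A' B' C' : FGModuleCat.{u} k} {f : A ⟶ A'} {g : B ⟶ B'} {h : C ⟶ C'}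
      {p : A ⟶ B} {q : B ⟶ C} {p' : A' ⟶ B'} {q' : B' ⟶ C'} (_ : f ≫ p' = p ≫ g)
      (_ : g ≫ q' = q ≫ h), f ≫ p' ≫ q' = (p ≫ q) ≫ h := fun h h' => by
    rw [reassoc_of% h, h', Category.assoc]
  refine exists_iso_of_fib hm ((Functor.curry.obj P.box).flip.obj (𝟙_ _)) (𝟭 X.Cat)
    (fun x => P.fibIso.app (x, 𝟙_ _) ≪≫
    whiskerLeftIso (X.fib.obj x) (Functor.Monoidal.εIso I.fib).symm ≪≫ ρ_ (X.fib.obj x))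
    (fun {x x'} g => sq (P.fib_natural g (𝟙 (𝟙_ _))) ?_) fun x a => ?_
  · rw [CategoryTheory.Functor.map_id]
    exact aux _
  · rw [H]
    refine sq (P.ev_algHom _ _ _) ?_
    rw [tensEnd_tmul, map_one]
    exact aux _

end DeligneProduct

/-! ### Transport of the tensor product of Hopf algebras -/

namespace FusFib

variable {k : Type u} [Field k] [IsAlgClosed k]

theorem pairProduct_algHom_eq {X Y W : FusFib k} (ω : X.endHopf ⊗ Y.endHopf ≅ W.endHopf) :
    (pairProduct ω).algHom = SSHopf.toAlgHom ω.hom :=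
  AlgHom.ext fun t => pairProduct_algHom ω t

section

variable [MonoidalCategory (FusFib k)] [(endFunctor k).rightOp.Monoidal]

/-- The isomorphism `End F ⊗ End F' ≅ End (F ⊗ F')` which is part of a monoidal structure. -/
def endTensorIso (X Y : FusFib k) : X.endHopf ⊗ Y.endHopf ≅ (X ⊗ Y).endHopf :=
  (Functor.Monoidal.μIso (endFunctor k).rightOp X Y).symm.unop

theorem endTensorIso_natural {X Y X' Y' : FusFib k} (f : X ⟶ X') (g : Y ⟶ Y') :
    ((endFunctor k).map f.op ⊗ₘ (endFunctor k).map g.op) ≫ (endTensorIso X Y).hom =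
      (endTensorIso X' Y').hom ≫ (endFunctor k).map (f ⊗ₘ g).op :=
  congrArg Quiver.Hom.unop (Functor.OplaxMonoidal.δ_natural (endFunctor k).rightOp f g)

theorem endTensorIso_assoc (X Y Z : FusFib k) :
    (endTensorIso X Y).hom ▷ Z.endHopf ≫ (endTensorIso (X ⊗ Y) Z).hom =
      (α_ X.endHopf Y.endHopf Z.endHopf).hom ≫ X.endHopf ◁ (endTensorIso Y Z).hom ≫
        (endTensorIso X (Y ⊗ Z)).hom ≫ (endFunctor k).map (α_ X Y Z).hom.op := by
  have h := congrArg Quiver.Hom.unop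
    (Functor.OplaxMonoidal.associativity (endFunctor k).rightOp X Y Z)
  have aux : ∀ {A B C D E F : SSHopf k} {a : A ≅ B} {f : A ⟶ C} {g : C ⟶ D} {p : B ⟶ E}
      {q : E ⟶ F} {r : F ⟶ D} (_ : (a.inv ≫ f) ≫ g = (p ≫ q) ≫ r), f ≫ g = a.hom ≫ p ≫ q ≫ r := by
    intro A B C D E F a f g p q r h
    rw [Category.assoc, Category.assoc, Iso.inv_comp_eq] at h
    exact h
  exact aux (a := α_ X.endHopf Y.endHopf Z.endHopf) h

theorem endTensorIso_leftUnitor (X : FusFib k) :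
    (λ_ X.endHopf).hom ≫ (endFunctor k).map (λ_ X).hom.op =
      (Functor.OplaxMonoidal.η (endFunctor k).rightOp).unop ▷ X.endHopf ≫
        (endTensorIso (𝟙_ _) X).hom := by
  have h := congrArg Quiver.Hom.unop
    (Functor.OplaxMonoidal.left_unitality_hom (endFunctor k).rightOp X)
  have aux : ∀ {A B C D : SSHopf k} {a : A ≅ B} {f : A ⟶ C} {g : C ⟶ D} {p : B ⟶ D}
      (_ : (a.inv ≫ f) ≫ g = p), a.hom ≫ p = f ≫ g := by
    rintro A B C D a f g p rfl
    simp
  exact aux (a := λ_ X.endHopf) h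

theorem endTensorIso_rightUnitor (X : FusFib k) :
    (ρ_ X.endHopf).hom ≫ (endFunctor k).map (ρ_ X).hom.op =
      X.endHopf ◁ (Functor.OplaxMonoidal.η (endFunctor k).rightOp).unop ≫
        (endTensorIso X (𝟙_ _)).hom := by
  have h := congrArg Quiver.Hom.unop
    (Functor.OplaxMonoidal.right_unitality_hom (endFunctor k).rightOp X)
  have aux : ∀ {A B C D : SSHopf k} {a : A ≅ B} {f : A ⟶ C} {g : C ⟶ D} {p : B ⟶ D}
      (_ : (a.inv ≫ f) ≫ g = p), a.hom ≫ p = f ≫ g := by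
    rintro A B C D a f g p rfl
    simp
  exact aux (a := ρ_ X.endHopf) h

/-- If `(C, F) ↦ End F` is monoidal then the tensor product is a Deligne tensor product. -/
def deligneMonoidal (hu : Nonempty ((𝟙_ (FusFib k)).obj ≅ FibCat.vec k)) : DeligneMonoidal k where
  monoidal := inferInstance
  boxProd X Y := pairProduct (endTensorIso X Y)
  unit := hu
  tensorHom {X X' Y Y'} f g m n p hm hn hp :=
    DeligneProduct.exists_iso_map _ _ hm hn hp fun t => by
      rw [pairProduct_algHom_eq, pairProduct_algHom_eq]
      exact DFunLike.congr_fun (congrArg (fun f : _ ⟶ (X ⊗ Y).endHopf => f.hom.toBialgHom)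
        (endTensorIso_natural f g)) t
  associator X Y Z m hm := DeligneProduct.exists_iso_assoc _ _ _ _ hm fun t => by
    rw [pairProduct_algHom_eq, pairProduct_algHom_eq, pairProduct_algHom_eq, pairProduct_algHom_eq]
    exact DFunLike.congr_fun (congrArg (fun f : _ ⟶ ((X ⊗ Y) ⊗ Z).endHopf => f.hom.toBialgHom)
        (endTensorIso_assoc X Y Z)) t
  leftUnitor X m hm := DeligneProduct.exists_iso_leftUnitor _ hm fun a => by
    rw [pairProduct_algHom_eq]
    have h := DFunLike.congr_fun (congrArg
      (fun f : _ ⟶ ((𝟙_ (FusFib k)) ⊗ X).endHopf => f.hom.toBialgHom)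
        (endTensorIso_leftUnitor X)) (TensorProduct.tmul k (1 : k) (show X.endHopf.obj from a))
    have h₁ : TensorProduct.lid k X.EndAlg ((1 : k) ⊗ₜ[k] a) = a :=
      (TensorProduct.lid_tmul a (1 : k)).trans (one_smul k a)
    exact (congrArg (endAlgMap (λ_ X).hom) h₁).symm.trans (h.trans
      (congrArg (fun b : (𝟙_ (FusFib k)).EndAlg =>
        SSHopf.toAlgHom (endTensorIso (𝟙_ _) X).hom (TensorProduct.tmul k b a))
          (map_one (SSHopf.toAlgHom (Functor.OplaxMonoidal.η (endFunctor k).rightOp).unop))))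
  rightUnitor X m hm := DeligneProduct.exists_iso_rightUnitor _ hm fun a => by
    rw [pairProduct_algHom_eq]
    have h := DFunLike.congr_fun (congrArg
      (fun f : _ ⟶ (X ⊗ (𝟙_ (FusFib k))).endHopf => f.hom.toBialgHom)
        (endTensorIso_rightUnitor X)) (TensorProduct.tmul k (show X.endHopf.obj from a) (1 : k))
    have h₁ : TensorProduct.rid k X.EndAlg (a ⊗ₜ[k] (1 : k)) = a :=
      (TensorProduct.rid_tmul a (1 : k)).trans (one_smul k a)
    exact (congrArg (endAlgMap (ρ_ X).hom) h₁).symm.trans (h.trans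
      (congrArg (fun b : (𝟙_ (FusFib k)).EndAlg =>
        SSHopf.toAlgHom (endTensorIso X (𝟙_ _)).hom (TensorProduct.tmul k a b))
          (map_one (SSHopf.toAlgHom (Functor.OplaxMonoidal.η (endFunctor k).rightOp).unop))))

end

end FusFib

/-- The reconstruction equivalence as an equivalence onto fusion categories with fiber functor. -/
def FusFib.opEquivalence (k : Type u) [Field k] [IsAlgClosed k] : (SSHopf k)ᵒᵖ ≌ FusFib k :=
  (reconstruction k).equivalence.leftOp

theorem DeligneMonoidal.nonempty (k : Type u) [Field k] [IsAlgClosed k] :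
    Nonempty (DeligneMonoidal k) :=
  have := isIso_forgetMor k
  ⟨@FusFib.deligneMonoidal k _ _ (Monoidal.transport (FusFib.opEquivalence k))
    (inferInstance : (Monoidal.equivalenceTransported (FusFib.opEquivalence k)).inverse.Monoidal)
    ⟨@asIso (FibCat k) _ (modFib k (HopfAlgCat.of k k)) (FibCat.vec k)
      (Quotient.mk _ (forgetMor k)) this⟩⟩

end

theorem mainTheorem7 (k : Type u) [Field k] [IsAlgClosed k] :
    (∀ (X Y : FusFib k) (m m' : FibCat.Mor X.obj Y.obj),
      (∀ s t : FibCat.TwoMor m m', s.σ = t.σ) ∧ ∀ s : FibCat.TwoMor m m', IsIso s.σ) ∧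
    Nonempty (DeligneMonoidal k) ∧
    ∃ R : Reconstruction k, ∀ D : DeligneMonoidal k,
      letI := D.monoidal
      ∃ (_ : R.equivalence.functor.Monoidal) (_ : R.equivalence.inverse.Monoidal),
        R.equivalence.IsMonoidal ∧
        ∀ (X Y : FusFib k) (a : (R.Q.obj (op X)).obj) (b : (R.Q.obj (op Y)).obj)
          (x : X.Cat) (y : Y.Cat),
          NatTrans.app ((R.endIso (X ⊗ Y)).iso
              ((μ R.equivalence.inverse (op X) (op Y)).hom.toBialgHom (a ⊗ₜ[k] b)))
              ((D.boxProd X Y).obj x y) ≫ (D.boxProd X Y).fib x y =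
            (D.boxProd X Y).fib x y ≫ (NatTrans.app ((R.endIso X).iso a) x ⊗ₘ
              NatTrans.app ((R.endIso Y).iso b) y) := by
  exact ⟨fun X Y m m' => ⟨FusFib.twoMor_ext, FusFib.isIso_twoMor⟩, DeligneMonoidal.nonempty k,
    reconstruction k, fun D => D.exists_isMonoidal⟩
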